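/- Let $G$ be a finite group, $V$ a finite-dimensional complex representation of $G$, and $u\in G$ a central element with $u^2=1$ acting on $V$ by $-1$. Let $S^2V\subset V\otimes V$ be the space of symmetric $2$-tensors and $(S^2V)^G$ its subspace of $G$-invariants. For $B\in S^2V$ let $A(G,V,u,B)$ be the following Hopf algebra over $\mathbb{C}$. Let $\mathbb{C}[G\ltimes V]=\mathbb{C}[G]\ltimes\Lambda V$ be the Hopf superalgebra in which $gvg^{-1}=g\cdot v$, the elements $g\in G$ are even with $\Delta(g)=g\otimes g$, $\varepsilon(g)=1$, and the elements $v\in V$ are odd with $\Delta(v)=v\otimes 1+1\otimes v$, $\varepsilon(v)=0$. Put $J=e^{B}\in\mathbb{C}[G\ltimes V]^{\otimes 2}$ (tensor square of superalgebras) and $\Delta^J(x)=J^{-1}\Delta(x)J$. As an algebra with counit, $A(G,V,u,B)$ is $\mathbb{C}[G\ltimes V]$, and its coproduct is $$x\mapsto \Delta^J_0(x)-(-1)^{p(x)}(u\otimes 1)\,\Delta^J_1(x)$$ for $x$ homogeneous of parity $p(x)$, where $\Delta^J_0(x)$ and $\Delta^J_1(x)$ are the components of $\Delta^J(x)$ whose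 second tensor factor is even and odd, respectively. Let $\mathrm{Aut}(G,V)$ be the group of all pairs $(\varphi,\eta)$, where $\varphi$ is an automorphism of $G$ with $\varphi(u)=u$ and $\eta:V\to V$ is a linear isomorphism with $\eta(g\cdot v)=\varphi(g)\cdot\eta(v)$ for all $g\in G$, $v\in V$. It acts on $S^2V/(S^2V)^G$ by $(\varphi,\eta)\cdot B=(\eta\otimes\eta)(B)$. Then each $A(G,V,u,B)$ is indeed a Hopf algebra and, for fixed $G,V,u$, the map sending $A(G,V,u,B)$ to the orbit of the class of $B$ is a well-defined bijection from the set of Hopf algebra isomorphism classes of the $A(G,V,u,B)$, $B\in S^2V$, onto $$\frac{S^2V/(S^2V)^G}{\mathrm{Aut}(G,V)}.$$ -/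

import Mathlib

open scoped TensorProduct

namespace SupergroupHopf

noncomputable section

/-! ### The Hopf superalgebra `ℂ[G ⋉ V] = ℂ[G] ⋉ ΛV` -/

section Superalgebra

variable {G V : Type*} [Group G] [AddCommGroup V] [Module ℂ V]

/-- The exterior algebra `ΛV` of a representation `ρ` of `G` on `V`
(a type synonym which remembers `ρ`, so that it can carry the induced action of `G`). -/
def ExtAlg (_ρ : Representation ℂ G V) : Type _ := ExteriorAlgebra ℂ V

instance (ρ : Representation ℂ G V) : Ring (ExtAlg ρ) :=
  inferInstanceAs (Ring (ExteriorAlgebra ℂ V))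

instance (ρ : Representation ℂ G V) : Algebra ℂ (ExtAlg ρ) :=
  inferInstanceAs (Algebra ℂ (ExteriorAlgebra ℂ V))

/-- The action of `G` on `ΛV` by algebra automorphisms which extends the action on `V`. -/
instance (ρ : Representation ℂ G V) : MulSemiringAction G (ExtAlg ρ) where
  smul g x := ExteriorAlgebra.map (ρ g) x
  one_smul x := by
    change ExteriorAlgebra.map (ρ 1) x = x
    rw [map_one]
    exact DFunLike.congr_fun (ExteriorAlgebra.map_id (R := ℂ) (M := V)) x
  mul_smul g h x := by
    change ExteriorAlgebra.map (ρ (g * h)) x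
      = ExteriorAlgebra.map (ρ g) (ExteriorAlgebra.map (ρ h) x)
    rw [map_mul]
    exact (DFunLike.congr_fun (ExteriorAlgebra.map_comp_map (R := ℂ) (ρ h) (ρ g)) x).symm
  smul_zero g := map_zero (ExteriorAlgebra.map (ρ g))
  smul_add g x y := map_add (ExteriorAlgebra.map (ρ g)) x y
  smul_one g := map_one (ExteriorAlgebra.map (ρ g))
  smul_mul g x y := map_mul (ExteriorAlgebra.map (ρ g)) x y

theorem extAlg_smul_def (ρ : Representation ℂ G V) (g : G) (x : ExtAlg ρ) :
    g • x = ExteriorAlgebra.map (ρ g) x := rfl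

instance (ρ : Representation ℂ G V) : SMulCommClass G ℂ (ExtAlg ρ) where
  smul_comm g c x := map_smul (ExteriorAlgebra.map (ρ g)) c x

/-- The algebra `ℂ[G ⋉ V] = ℂ[G] ⋉ ΛV`: its elements are the finite sums `∑ a_g g` with
`a_g ∈ ΛV`, and `g a = (g • a) g`. -/
abbrev SupergroupAlgebra (ρ : Representation ℂ G V) : Type _ :=
  SkewMonoidAlgebra (ExtAlg ρ) G

/-- The element `g ∈ G` of `ℂ[G ⋉ V]`. -/
def ofG (ρ : Representation ℂ G V) : G →* SupergroupAlgebra ρ :=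
  SkewMonoidAlgebra.of (ExtAlg ρ) G

/-- The inclusion `V → ΛV`. -/
def extι (ρ : Representation ℂ G V) : V →ₗ[ℂ] ExtAlg ρ := ExteriorAlgebra.ι ℂ

/-- The inclusion `V → ΛV → ℂ[G ⋉ V]`. -/
def ofV (ρ : Representation ℂ G V) : V →ₗ[ℂ] SupergroupAlgebra ρ :=
  SkewMonoidAlgebra.lsingle (M := ExtAlg ρ) ℂ (1 : G) ∘ₗ extι ρ

/-- The even (`i = 0`) and odd (`i = 1`) parts of `ΛV`. -/
abbrev extParity (ρ : Representation ℂ G V) (i : ZMod 2) : Submodule ℂ (ExtAlg ρ) :=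
  CliffordAlgebra.evenOdd (0 : QuadraticForm ℂ V) i

instance (ρ : Representation ℂ G V) : GradedAlgebra (extParity ρ) :=
  CliffordAlgebra.gradedAlgebra (0 : QuadraticForm ℂ V)

theorem smul_mem_extParity (ρ : Representation ℂ G V) (g : G) {i : ZMod 2} {x : ExtAlg ρ}
    (hx : x ∈ extParity ρ i) : g • x ∈ extParity ρ i := by
  have key : (CliffordAlgebra.evenOdd (0 : QuadraticForm ℂ V) i).map
      (ExteriorAlgebra.map (ρ g)).toLinearMap ≤ CliffordAlgebra.evenOdd 0 i := by
    unfold CliffordAlgebra.evenOdd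
    rw [Submodule.map_iSup]
    refine iSup_mono fun j => ?_
    rw [Submodule.map_pow]
    refine pow_le_pow_left' ?_ _
    rintro _ ⟨_, ⟨v, rfl⟩, rfl⟩
    exact ⟨ρ g v, (ExteriorAlgebra.map_apply_ι (R := ℂ) (ρ g) v).symm⟩
  exact key (Submodule.mem_map_of_mem hx)

/-- The `ℤ/2`-grading of `ℂ[G ⋉ V]` for which `G` is even and `V` is odd. -/
def parity (ρ : Representation ℂ G V) (i : ZMod 2) : Submodule ℂ (SupergroupAlgebra ρ) where
  carrier := {x | ∀ g, x.coeff g ∈ extParity ρ i}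
  zero_mem' _ := Submodule.zero_mem _
  add_mem' hx hy g := by
    rw [SkewMonoidAlgebra.coeff_add]
    exact Submodule.add_mem _ (hx g) (hy g)
  smul_mem' c _ hx g := Submodule.smul_mem _ c (hx g)

theorem single_mem_parity (ρ : Representation ℂ G V) (g : G) {i : ZMod 2} {a : ExtAlg ρ}
    (ha : a ∈ extParity ρ i) : SkewMonoidAlgebra.single g a ∈ parity ρ i := by
  classical
  intro h
  rw [SkewMonoidAlgebra.coeff_single_apply]
  split_ifs
  · exact ha
  · exact Submodule.zero_mem _

/-- The coefficientwise projection of `ℂ[G ⋉ V]` to its part of parity `i`. -/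
def parityProj (ρ : Representation ℂ G V) (i : ZMod 2) :
    SupergroupAlgebra ρ →ₗ[ℂ] SupergroupAlgebra ρ :=
  (SkewMonoidAlgebra.coeffLinearEquiv (S := ℂ) (k := ExtAlg ρ) (G := G)).symm.toLinearMap ∘ₗ
    Finsupp.mapRange.linearMap (GradedAlgebra.proj (extParity ρ) i) ∘ₗ
    (SkewMonoidAlgebra.coeffLinearEquiv (S := ℂ) (k := ExtAlg ρ) (G := G)).toLinearMap

theorem parityProj_coeff (ρ : Representation ℂ G V) (i : ZMod 2) (x : SupergroupAlgebra ρ)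
    (g : G) : (parityProj ρ i x).coeff g
      = (DirectSum.decompose (extParity ρ) (x.coeff g) i : ExtAlg ρ) := rfl

theorem parityProj_mem (ρ : Representation ℂ G V) (i : ZMod 2) (x : SupergroupAlgebra ρ) :
    parityProj ρ i x ∈ parity ρ i := fun g => by
  rw [parityProj_coeff]
  exact SetLike.coe_mem _

instance parityGradedMonoid (ρ : Representation ℂ G V) : SetLike.GradedMonoid (parity ρ) where
  one_mem := single_mem_parity ρ 1 SetLike.GradedOne.one_mem
  mul_mem i j x y hx hy := by
    rw [SkewMonoidAlgebra.mul_def, SkewMonoidAlgebra.sum_def', Finset.sum_congr rfl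
      (fun _ _ => SkewMonoidAlgebra.sum_def' _ _)]
    refine Submodule.sum_mem _ fun g _ => Submodule.sum_mem _ fun h _ => ?_
    exact single_mem_parity ρ _
      (SetLike.GradedMul.mul_mem (hx g) (smul_mem_extParity ρ g (hy h)))

theorem parityProj_of_mem_same (ρ : Representation ℂ G V) {i : ZMod 2}
    {x : SupergroupAlgebra ρ} (hx : x ∈ parity ρ i) : parityProj ρ i x = x :=
  SkewMonoidAlgebra.ext fun g => by
    rw [parityProj_coeff, DirectSum.decompose_of_mem_same (extParity ρ) (hx g)]

theorem parityProj_of_mem_ne (ρ : Representation ℂ G V) {i j : ZMod 2}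
    {x : SupergroupAlgebra ρ} (hx : x ∈ parity ρ i) (hij : i ≠ j) : parityProj ρ j x = 0 :=
  SkewMonoidAlgebra.ext fun g => by
    rw [parityProj_coeff, DirectSum.decompose_of_mem_ne (extParity ρ) (hx g) hij,
      SkewMonoidAlgebra.coeff_zero, Finsupp.zero_apply]

theorem sum_parityProj (ρ : Representation ℂ G V) (x : SupergroupAlgebra ρ) :
    parityProj ρ 0 x + parityProj ρ 1 x = x := by
  refine SkewMonoidAlgebra.ext fun g => ?_
  rw [SkewMonoidAlgebra.coeff_add, Finsupp.add_apply, parityProj_coeff, parityProj_coeff]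
  induction x.coeff g using DirectSum.Decomposition.inductionOn (extParity ρ) with
  | zero => simp
  | homogeneous a =>
    rename_i i
    fin_cases i
    · exact (congrArg₂ (· + ·) (DirectSum.decompose_of_mem_same (extParity ρ) a.2)
        (DirectSum.decompose_of_mem_ne (extParity ρ) a.2 zero_ne_one)).trans (add_zero _)
    · exact (congrArg₂ (· + ·) (DirectSum.decompose_of_mem_ne (extParity ρ) a.2 one_ne_zero)
        (DirectSum.decompose_of_mem_same (extParity ρ) a.2)).trans (zero_add _)
  | add a b ha hb =>
    rw [DirectSum.decompose_add, DirectSum.add_apply, DirectSum.add_apply, Submodule.coe_add,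
      Submodule.coe_add, add_add_add_comm, ha, hb]

/-- `ℂ[G ⋉ V]` is a superalgebra. -/
instance parityGradedAlgebra (ρ : Representation ℂ G V) : GradedAlgebra (parity ρ) where
  toGradedMonoid := parityGradedMonoid ρ
  toDecomposition := DirectSum.Decomposition.ofAddHom (parity ρ)
    (∑ i : ZMod 2, (DirectSum.of (fun i => parity ρ i) i).comp
      ((parityProj ρ i).codRestrict (parity ρ i) (parityProj_mem ρ i)).toAddMonoidHom)
    (by
      refine DFunLike.ext _ _ fun x => ?_
      rw [AddMonoidHom.comp_apply, AddMonoidHom.finsetSum_apply, map_sum]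
      simp only [AddMonoidHom.comp_apply, DirectSum.coeAddMonoidHom_of]
      exact (Fin.sum_univ_two _).trans (sum_parityProj ρ x))
    (by
      refine DirectSum.addHom_ext fun i x => ?_
      rw [AddMonoidHom.comp_apply, DirectSum.coeAddMonoidHom_of, AddMonoidHom.finsetSum_apply,
        Finset.sum_eq_single i]
      · exact congrArg (DirectSum.of (fun i => parity ρ i) i)
          (Subtype.ext (parityProj_of_mem_same ρ x.2))
      · intro j _ hj
        exact (congrArg (DirectSum.of (fun i => parity ρ i) j)
          (Subtype.ext (parityProj_of_mem_ne ρ x.2 hj.symm))).trans (map_zero _)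
      · exact fun h => (h (Finset.mem_univ i)).elim)

/-- The tensor square `ℂ[G ⋉ V] ⊗ ℂ[G ⋉ V]` in the sense of superalgebras:
`(a ⊗ b) (a' ⊗ b') = (-1)^(p(b) p(a')) a a' ⊗ b b'`. -/
abbrev SuperTensorSq (ρ : Representation ℂ G V) : Type _ :=
  parity ρ ᵍ⊗[ℂ] parity ρ

theorem ofG_mem_parity (ρ : Representation ℂ G V) (g : G) : ofG ρ g ∈ parity ρ 0 :=
  single_mem_parity ρ g SetLike.GradedOne.one_mem

theorem ofV_mem_parity (ρ : Representation ℂ G V) (v : V) : ofV ρ v ∈ parity ρ 1 :=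
  single_mem_parity ρ 1 (CliffordAlgebra.ι_mem_evenOdd_one 0 v)

theorem ofV_mul_ofV (ρ : Representation ℂ G V) (v : V) : ofV ρ v * ofV ρ v = 0 := by
  have h : SkewMonoidAlgebra.single (1 : G) (extι ρ v)
      * SkewMonoidAlgebra.single (1 : G) (extι ρ v) = 0 := by
    rw [SkewMonoidAlgebra.single_mul_single, one_smul]
    exact (congrArg (SkewMonoidAlgebra.single _) (ExteriorAlgebra.ι_sq_zero v)).trans
      (SkewMonoidAlgebra.single_zero _)
  exact h

theorem ofG_mul_ofV (ρ : Representation ℂ G V) (g : G) (v : V) :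
    ofG ρ g * ofV ρ v = ofV ρ (ρ g v) * ofG ρ g := by
  have h : SkewMonoidAlgebra.single g (1 : ExtAlg ρ)
      * SkewMonoidAlgebra.single (1 : G) (extι ρ v)
      = SkewMonoidAlgebra.single (1 : G) (extι ρ (ρ g v))
        * SkewMonoidAlgebra.single g (1 : ExtAlg ρ) := by
    rw [SkewMonoidAlgebra.single_mul_single, SkewMonoidAlgebra.single_mul_single, one_mul,
      mul_one, one_mul, one_smul, mul_one]
    exact congrArg (SkewMonoidAlgebra.single g) (ExteriorAlgebra.map_apply_ι (R := ℂ) (ρ g) v)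
  exact h

/-- In the super tensor square, `(a ⊗ b) (a' ⊗ b') = (-1)^(p(b) p(a')) a a' ⊗ b b'`. -/
theorem superTensor_mul (ρ : Representation ℂ G V) {i j : ZMod 2} (a b a' b' : SupergroupAlgebra ρ)
    (hb : b ∈ parity ρ i) (ha' : a' ∈ parity ρ j) :
    ((a ᵍ⊗ₜ[ℂ] b : SuperTensorSq ρ) * (a' ᵍ⊗ₜ[ℂ] b' : SuperTensorSq ρ) : SuperTensorSq ρ)
      = (-1 : ℤˣ) ^ (i * j) • ((a * a') ᵍ⊗ₜ[ℂ] (b * b')) :=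
  GradedTensorProduct.tmul_coe_mul_coe_tmul (parity ρ) (parity ρ) a ⟨b, hb⟩ ⟨a', ha'⟩ b'

/-- The coproduct of the elements of `V`: `v ↦ v ⊗ 1 + 1 ⊗ v`. -/
def primitive (ρ : Representation ℂ G V) : V →ₗ[ℂ] SuperTensorSq ρ :=
  (GradedTensorProduct.includeLeft (parity ρ) (parity ρ)).toLinearMap ∘ₗ ofV ρ +
    (GradedTensorProduct.includeRight (parity ρ) (parity ρ)).toLinearMap ∘ₗ ofV ρ

theorem primitive_apply (ρ : Representation ℂ G V) (v : V) :
    primitive ρ v = ofV ρ v ᵍ⊗ₜ[ℂ] 1 + 1 ᵍ⊗ₜ[ℂ] ofV ρ v := rfl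

theorem primitive_mul_self (ρ : Representation ℂ G V) (v : V) :
    primitive ρ v * primitive ρ v = 0 := by
  have h0 : (1 : SupergroupAlgebra ρ) ∈ parity ρ 0 := SetLike.GradedOne.one_mem
  have hv := ofV_mem_parity ρ v
  rw [primitive_apply, add_mul, mul_add, mul_add, superTensor_mul ρ _ _ _ _ h0 hv,
    superTensor_mul ρ _ _ _ _ h0 h0, superTensor_mul ρ _ _ _ _ hv hv,
    superTensor_mul ρ _ _ _ _ hv h0, ofV_mul_ofV]
  simp [GradedTensorProduct.tmul]

/-- The coproduct of the elements of `G`: `g ↦ g ⊗ g`. -/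
def grouplike (ρ : Representation ℂ G V) : G →* SuperTensorSq ρ where
  toFun g := ofG ρ g ᵍ⊗ₜ[ℂ] ofG ρ g
  map_one' := by
    rw [map_one]
    rfl
  map_mul' g h := by
    rw [superTensor_mul ρ _ _ _ _ (ofG_mem_parity ρ g) (ofG_mem_parity ρ h), map_mul]
    simp

/-- The extension of `v ↦ v ⊗ 1 + 1 ⊗ v` to an algebra homomorphism on `ΛV`. -/
def extComul (ρ : Representation ℂ G V) : ExtAlg ρ →ₐ[ℂ] SuperTensorSq ρ :=
  (ExteriorAlgebra.lift ℂ ⟨primitive ρ, primitive_mul_self ρ⟩ :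
    ExteriorAlgebra ℂ V →ₐ[ℂ] SuperTensorSq ρ)

theorem extComul_ι (ρ : Representation ℂ G V) (v : V) :
    extComul ρ (extι ρ v) = primitive ρ v :=
  ExteriorAlgebra.lift_ι_apply ℂ (primitive ρ) (primitive_mul_self ρ) v

theorem smul_extι (ρ : Representation ℂ G V) (g : G) (v : V) :
    g • extι ρ v = extι ρ (ρ g v) :=
  ExteriorAlgebra.map_apply_ι (R := ℂ) (ρ g) v

theorem extAlg_induction (ρ : Representation ℂ G V) {C : ExtAlg ρ → Prop}
    (algebraMap : ∀ c : ℂ, C (algebraMap ℂ (ExtAlg ρ) c)) (ι : ∀ v, C (extι ρ v))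
    (mul : ∀ a b, C a → C b → C (a * b)) (add : ∀ a b, C a → C b → C (a + b))
    (a : ExtAlg ρ) : C a :=
  ExteriorAlgebra.induction (R := ℂ) (M := V) algebraMap ι mul add a

theorem extComul_smul_mul (ρ : Representation ℂ G V) (x : ExtAlg ρ) (g : G) :
    extComul ρ (g • x) * grouplike ρ g = grouplike ρ g * extComul ρ x := by
  induction x using extAlg_induction ρ with
  | algebraMap c => rw [smul_algebraMap, AlgHom.commutes, Algebra.commutes]
  | ι v =>
    have h0 : (1 : SupergroupAlgebra ρ) ∈ parity ρ 0 := SetLike.GradedOne.one_mem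
    have hg := ofG_mem_parity ρ g
    change _ * (ofG ρ g ᵍ⊗ₜ[ℂ] ofG ρ g) = (ofG ρ g ᵍ⊗ₜ[ℂ] ofG ρ g) * _
    rw [smul_extι, extComul_ι, extComul_ι, primitive_apply, primitive_apply, add_mul, mul_add,
      superTensor_mul ρ _ _ _ _ h0 hg, superTensor_mul ρ _ _ _ _ (ofV_mem_parity ρ _) hg,
      superTensor_mul ρ _ _ _ _ hg (ofV_mem_parity ρ v), superTensor_mul ρ _ _ _ _ hg h0,
      ofG_mul_ofV]
    simp
  | mul a b ha hb =>
    rw [smul_mul', map_mul, map_mul, mul_assoc, hb, ← mul_assoc, ha, mul_assoc]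
  | add a b ha hb => rw [smul_add, map_add, map_add, add_mul, mul_add, ha, hb]

/-- The coproduct of the Hopf superalgebra `ℂ[G ⋉ V]`: the algebra homomorphism to the super
tensor square with `g ↦ g ⊗ g` for `g ∈ G` and `v ↦ v ⊗ 1 + 1 ⊗ v` for `v ∈ V`. -/
def superComul (ρ : Representation ℂ G V) : SupergroupAlgebra ρ →ₐ[ℂ] SuperTensorSq ρ :=
  SkewMonoidAlgebra.liftNCAlgHom (extComul ρ) (grouplike ρ)
    (fun {x g} => extComul_smul_mul ρ x g)

/-- The counit of `ΛV`: the algebra homomorphism to `ℂ` with `v ↦ 0` for `v ∈ V`. -/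
def extCounit (ρ : Representation ℂ G V) : ExtAlg ρ →ₐ[ℂ] ℂ :=
  (ExteriorAlgebra.algebraMapInv : ExteriorAlgebra ℂ V →ₐ[ℂ] ℂ)

theorem extCounit_ι (ρ : Representation ℂ G V) (v : V) : extCounit ρ (extι ρ v) = 0 :=
  ExteriorAlgebra.lift_ι_apply ℂ (0 : V →ₗ[ℂ] ℂ) (fun _ => by simp) v

theorem extCounit_smul (ρ : Representation ℂ G V) (x : ExtAlg ρ) (g : G) :
    extCounit ρ (g • x) = extCounit ρ x := by
  induction x using extAlg_induction ρ with
  | algebraMap c => rw [smul_algebraMap]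
  | ι v => rw [smul_extι, extCounit_ι, extCounit_ι]
  | mul a b ha hb => rw [smul_mul', map_mul, map_mul, ha, hb]
  | add a b ha hb => rw [smul_add, map_add, map_add, ha, hb]

/-- The counit of `ℂ[G ⋉ V]`: the algebra homomorphism to `ℂ` with `g ↦ 1` for `g ∈ G` and
`v ↦ 0` for `v ∈ V`. -/
def superCounit (ρ : Representation ℂ G V) : SupergroupAlgebra ρ →ₐ[ℂ] ℂ :=
  SkewMonoidAlgebra.liftNCAlgHom (extCounit ρ) (1 : G →* ℂ)
    (fun {x g} => by rw [extCounit_smul, mul_comm])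

/-! ### The twist `J = e^B` and the Hopf algebra `A(G, V, u, B)` -/

/-- The inclusion `V ⊗ V → ℂ[G ⋉ V] ⊗ ℂ[G ⋉ V]`. -/
def tensorIncl (ρ : Representation ℂ G V) : V ⊗[ℂ] V →ₗ[ℂ] SuperTensorSq ρ :=
  (GradedTensorProduct.of ℂ (parity ρ) (parity ρ)).toLinearMap ∘ₗ
    TensorProduct.map (ofV ρ) (ofV ρ)

/-- `e^B` for a tensor `B ∈ V ⊗ V`, in the super tensor square of `ℂ[G ⋉ V]`. The exponential
series stops after the term with index `dim V`, because `B^k` lies in `Λ^k V ⊗ Λ^k V`. -/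
def expTensor (ρ : Representation ℂ G V) (B : V ⊗[ℂ] V) : SuperTensorSq ρ :=
  ∑ k ∈ Finset.range (Module.finrank ℂ V + 1), ((k.factorial : ℂ)⁻¹) • tensorIncl ρ B ^ k

/-- The coproduct `Δ^J(x) = J⁻¹ Δ(x) J` of the twisted Hopf superalgebra `ℂ[G ⋉ V]^J`, where
`J = e^B` and `J⁻¹ = e^(-B)`. -/
def twistedComul (ρ : Representation ℂ G V) (B : V ⊗[ℂ] V) :
    SupergroupAlgebra ρ →ₗ[ℂ] SuperTensorSq ρ :=
  LinearMap.mulLeft ℂ (expTensor ρ (-B)) ∘ₗ LinearMap.mulRight ℂ (expTensor ρ B) ∘ₗ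
    (superComul ρ).toLinearMap

/-- The part `Δ₀` (for `i = 0`) or `Δ₁` (for `i = 1`) of a tensor of `ℂ[G ⋉ V] ⊗ ℂ[G ⋉ V]`, i.e.
its component in `ℂ[G ⋉ V] ⊗ ℂ[G ⋉ V]_i`, as an element of the ordinary tensor square. -/
def rightPart (ρ : Representation ℂ G V) (i : ZMod 2) :
    SuperTensorSq ρ →ₗ[ℂ] SupergroupAlgebra ρ ⊗[ℂ] SupergroupAlgebra ρ :=
  TensorProduct.map LinearMap.id (GradedAlgebra.proj (parity ρ) i) ∘ₗ
    (GradedTensorProduct.of ℂ (parity ρ) (parity ρ)).symm.toLinearMap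

/-- The parity involution `x ↦ (-1)^p(x) x`. -/
def parityInvol (ρ : Representation ℂ G V) : SupergroupAlgebra ρ →ₗ[ℂ] SupergroupAlgebra ρ :=
  GradedAlgebra.proj (parity ρ) 0 - GradedAlgebra.proj (parity ρ) 1

/-- The coproduct of `A(G, V, u, B)`, obtained from that of `ℂ[G ⋉ V]^J` by modification by `u`:
`x ↦ Δ₀(x) - (-1)^p(x) (u ⊗ 1) Δ₁(x)`, where `Δ = Δ^J`. -/
def modifiedComul (ρ : Representation ℂ G V) (u : G) (B : V ⊗[ℂ] V) :
    SupergroupAlgebra ρ →ₗ[ℂ] SupergroupAlgebra ρ ⊗[ℂ] SupergroupAlgebra ρ :=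
  rightPart ρ 0 ∘ₗ twistedComul ρ B -
    LinearMap.mulLeft ℂ (ofG ρ u ⊗ₜ[ℂ] 1) ∘ₗ rightPart ρ 1 ∘ₗ twistedComul ρ B ∘ₗ parityInvol ρ

/-- `A(G, V, u, B)`, as an algebra equal to `ℂ[G ⋉ V]`. -/
def AGVuB (ρ : Representation ℂ G V) (_u : G) (_B : V ⊗[ℂ] V) : Type _ := SupergroupAlgebra ρ

instance (ρ : Representation ℂ G V) (u : G) (B : V ⊗[ℂ] V) : Ring (AGVuB ρ u B) :=
  inferInstanceAs (Ring (SupergroupAlgebra ρ))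

instance (ρ : Representation ℂ G V) (u : G) (B : V ⊗[ℂ] V) : Algebra ℂ (AGVuB ρ u B) :=
  inferInstanceAs (Algebra ℂ (SupergroupAlgebra ρ))

/-- The coproduct and the counit of `A(G, V, u, B)`. -/
instance (ρ : Representation ℂ G V) (u : G) (B : V ⊗[ℂ] V) : CoalgebraStruct ℂ (AGVuB ρ u B) where
  comul := modifiedComul ρ u B
  counit := (superCounit ρ).toLinearMap

end Superalgebra

/-- An algebra with a coproduct and a counit is a Hopf algebra. (The antipode is determined by the
other operations, so its existence is a property, and it is preserved by every isomorphism of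
algebras and coalgebras.) -/
structure IsHopfAlgebra (H : Type*) [Ring H] [Algebra ℂ H] [CoalgebraStruct ℂ H] : Prop where
  comul_one : CoalgebraStruct.comul (R := ℂ) (1 : H) = 1
  comul_mul : ∀ x y : H, CoalgebraStruct.comul (R := ℂ) (x * y)
    = CoalgebraStruct.comul (R := ℂ) x * CoalgebraStruct.comul (R := ℂ) y
  counit_one : CoalgebraStruct.counit (R := ℂ) (1 : H) = 1
  counit_mul : ∀ x y : H, CoalgebraStruct.counit (R := ℂ) (x * y)
    = CoalgebraStruct.counit (R := ℂ) x * CoalgebraStruct.counit (R := ℂ) y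
  coassoc : ∀ x : H, TensorProduct.assoc ℂ H H H
      ((CoalgebraStruct.comul (R := ℂ) (A := H)).rTensor H (CoalgebraStruct.comul (R := ℂ) x))
    = (CoalgebraStruct.comul (R := ℂ) (A := H)).lTensor H (CoalgebraStruct.comul (R := ℂ) x)
  rTensor_counit : ∀ x : H,
    (CoalgebraStruct.counit (R := ℂ) (A := H)).rTensor H (CoalgebraStruct.comul (R := ℂ) x)
      = 1 ⊗ₜ[ℂ] x
  lTensor_counit : ∀ x : H,
    (CoalgebraStruct.counit (R := ℂ) (A := H)).lTensor H (CoalgebraStruct.comul (R := ℂ) x)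
      = x ⊗ₜ[ℂ] 1
  exists_antipode : ∃ S : H →ₗ[ℂ] H, ∀ x : H,
    LinearMap.mul' ℂ H (S.rTensor H (CoalgebraStruct.comul (R := ℂ) x))
        = algebraMap ℂ H (CoalgebraStruct.counit (R := ℂ) x) ∧
      LinearMap.mul' ℂ H (S.lTensor H (CoalgebraStruct.comul (R := ℂ) x))
        = algebraMap ℂ H (CoalgebraStruct.counit (R := ℂ) x)

/-! ### Symmetric tensors, the group `Aut(G, V)` and the two equivalence relations -/

section Moduli

variable {G V : Type*} [Group G] [AddCommGroup V] [Module ℂ V]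

/-- `S²V`, the space of symmetric tensors in `V ⊗ V`. -/
def SymTensor (V : Type*) [AddCommGroup V] [Module ℂ V] : Submodule ℂ (V ⊗[ℂ] V) :=
  LinearMap.eqLocus (TensorProduct.comm ℂ V V).toLinearMap LinearMap.id

/-- The map `η ⊗ η` on symmetric tensors. -/
def symMap (η : V →ₗ[ℂ] V) : SymTensor V →ₗ[ℂ] SymTensor V :=
  (TensorProduct.map η η).restrict (fun t ht => by
    change TensorProduct.comm ℂ V V t = t at ht
    change TensorProduct.comm ℂ V V (TensorProduct.map η η t) = TensorProduct.map η η t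
    rw [← TensorProduct.map_comm, ht])

theorem symMap_coe (η : V →ₗ[ℂ] V) (B : SymTensor V) :
    (symMap η B : V ⊗[ℂ] V) = TensorProduct.map η η B := rfl

theorem symMap_one : symMap (1 : V →ₗ[ℂ] V) = 1 :=
  LinearMap.ext fun B => Subtype.ext (by
    rw [symMap_coe, TensorProduct.map_one]
    rfl)

theorem symMap_mul (η θ : V →ₗ[ℂ] V) : symMap (η * θ) = symMap η * symMap θ :=
  LinearMap.ext fun B => Subtype.ext (by
    rw [symMap_coe, TensorProduct.map_mul]
    rfl)

/-- The representation of `G` on `S²V`. -/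
def symRep (ρ : Representation ℂ G V) : Representation ℂ G (SymTensor V) where
  toFun g := symMap (ρ g)
  map_one' := by rw [map_one, symMap_one]
  map_mul' g h := by rw [map_mul, symMap_mul]

/-- The quotient space `S²V / (S²V)^G`. -/
abbrev SymQuot (ρ : Representation ℂ G V) : Type _ :=
  SymTensor V ⧸ (symRep ρ).invariants

/-- The group of all pairs `(φ, η)`, where `φ` is an automorphism of `G` with `φ u = u` and `η` is
an isomorphism of `G`-representations from `V` to `φ^* V`. -/
def AutPair (ρ : Representation ℂ G V) (u : G) : Subgroup (MulAut G × (V ≃ₗ[ℂ] V)) where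
  carrier := {p | p.1 u = u ∧ ∀ (g : G) (v : V), p.2 (ρ g v) = ρ (p.1 g) (p.2 v)}
  one_mem' := ⟨rfl, fun _ _ => rfl⟩
  mul_mem' {p q} hp hq := by
    refine ⟨?_, fun g v => ?_⟩
    · change p.1 (q.1 u) = u
      rw [hq.1, hp.1]
    · change p.2 (q.2 (ρ g v)) = ρ (p.1 (q.1 g)) (p.2 (q.2 v))
      rw [hq.2, hp.2]
  inv_mem' {p} hp := by
    refine ⟨?_, fun g v => ?_⟩
    · change p.1.symm u = u
      rw [MulEquiv.symm_apply_eq, hp.1]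
    · change p.2.symm (ρ g v) = ρ (p.1.symm g) (p.2.symm v)
      rw [LinearEquiv.symm_apply_eq, hp.2, LinearEquiv.apply_symm_apply,
        MulEquiv.apply_symm_apply]

theorem symMap_mem_invariants (ρ : Representation ℂ G V) (u : G) (p : AutPair ρ u)
    {B : SymTensor V} (hB : B ∈ (symRep ρ).invariants) :
    symMap (p.1.2 : V →ₗ[ℂ] V) B ∈ (symRep ρ).invariants := by
  intro g
  have h : ρ g * (p.1.2 : V →ₗ[ℂ] V) = (p.1.2 : V →ₗ[ℂ] V) * ρ (p.1.1.symm g) :=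
    LinearMap.ext fun v => by
      change ρ g (p.1.2 v) = p.1.2 (ρ (p.1.1.symm g) v)
      rw [p.2.2, MulEquiv.apply_symm_apply]
  change (symMap (ρ g) * symMap (p.1.2 : V →ₗ[ℂ] V)) B = _
  rw [← symMap_mul, h, symMap_mul]
  exact congrArg (symMap (p.1.2 : V →ₗ[ℂ] V)) (hB (p.1.1.symm g))

/-- The action of the pairs `(φ, η)` on `S²V / (S²V)^G`, by `B ↦ (η ⊗ η)(B)`. -/
instance (ρ : Representation ℂ G V) (u : G) : MulAction (AutPair ρ u) (SymQuot ρ) where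
  smul p x := (symRep ρ).invariants.mapQ (symRep ρ).invariants (symMap (p.1.2 : V →ₗ[ℂ] V))
    (fun _ hB => symMap_mem_invariants ρ u p hB) x
  one_smul x := by
    induction x using Submodule.Quotient.induction_on with
    | H B => exact congrArg Submodule.Quotient.mk (DFunLike.congr_fun symMap_one B)
  mul_smul p q x := by
    induction x using Submodule.Quotient.induction_on with
    | H B =>
      exact congrArg Submodule.Quotient.mk
        (DFunLike.congr_fun (symMap_mul (p.1.2 : V →ₗ[ℂ] V) (q.1.2 : V →ₗ[ℂ] V)) B)

/-- The quotient set `(S²V / (S²V)^G) / Aut(G, V)`. -/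
abbrev SymModuli (ρ : Representation ℂ G V) (u : G) : Type _ :=
  MulAction.orbitRel.Quotient (AutPair ρ u) (SymQuot ρ)

/-- Isomorphism of the Hopf algebras `A(G, V, u, B)`, as an equivalence relation on the
`B ∈ S²V`. -/
def hopfIsoSetoid (ρ : Representation ℂ G V) (u : G) : Setoid (SymTensor V) where
  r B B' := Nonempty (AGVuB ρ u (B : V ⊗[ℂ] V) ≃ₐc[ℂ] AGVuB ρ u (B' : V ⊗[ℂ] V))
  iseqv :=
    { refl := fun _ => ⟨BialgEquiv.refl (R := ℂ) (A := AGVuB ρ u _)⟩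
      symm := fun ⟨e⟩ => ⟨e.symm⟩
      trans := fun ⟨e⟩ ⟨f⟩ => ⟨e.trans f⟩ }

/-- The set of Hopf algebra isomorphism classes of the `A(G, V, u, B)`, `B ∈ S²V`. -/
abbrev HopfIsoClasses (ρ : Representation ℂ G V) (u : G) : Type _ :=
  Quotient (hopfIsoSetoid ρ u)

end Moduli

end

end SupergroupHopf

namespace SupergroupHopf

noncomputable section

/-! ### Generators of `ℂ[G ⋉ V]` -/

section Generators

variable {G V : Type*} [Group G] [AddCommGroup V] [Module ℂ V] (ρ : Representation ℂ G V)

/-! Conjugation by `u` is the parity involution of `A = ℂ[G ⋉ V]`, so super signs can be absorbed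
into factors `u`. The map `a ⊗ b ↦ a u^p(b) ⊗ b` (`bosonize`) is an algebra homomorphism from the
super tensor square to the ordinary one, and the coproduct of `A(G, V, u, B)` is its composite with
`Δ^J` (`modifiedComul_eq`). Under it `J` becomes `e^B̂`, where `B̂` is the sum of `v u ⊗ w` over the
terms `v ⊗ w` of `B`. The coproduct is therefore an algebra homomorphism, and on generators it is `v
↦ v ⊗ 1 + u ⊗ v`, since `B̂` commutes with this element, and `g ↦ e^(gB - B)^ (g ⊗ g)`, with the hat
again meaning the inserted `u`. Hence it depends on `B` only through the differences `gB - B`, that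
is, through the class of `B` modulo invariants.

Hopf axioms. Coassociativity and counitality are equalities of algebra homomorphisms, so generators
suffice. Both iterated coproducts of `g` are conjugates of `g ⊗ g ⊗ g` by `e^(B₁₂ + B₁₃ + B₂₃)`. The
antipode `g ↦ g⁻¹`, `v ↦ -u v` does not involve `B`; it works because a symmetric tensor multiplies
to zero in `ΛV`.

Pairs give isomorphisms. A pair `(φ, η)` extends to an algebra automorphism, and it intertwines the
coproducts of `B` and `B'` when `B' - ηB` is invariant, because then `η(gB - B) = φ(g)B' - B'`
(`comulHom_autHom`).

Isomorphisms give pairs. An isomorphism `f` need not preserve `G` or `V`, but its components of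
degree at most one in `ΛV` suffice. Modulo the ideal generated by `V` the coproduct is that of
`ℂ[G]`, so `f(g)` reduces to a group element `φ(g)`. The reduction of `f(v)` is skew-primitive and
anticommutes with that of `f(u)`, so it vanishes. The degree one part of `f(g)` vanishes, and that
of `f(v)` lies in `V · 1` and defines `η`. Comparing components in `V ⊗ V` gives `η(gB - B) = φ(g)B'
- B'` up to an antisymmetric tensor (`exists_comp₁₁_comulHom`), which is zero by symmetry of `B` and
`B'` (`HasLeadingPart.map_sub_eq`). Thus `B' - ηB` is invariant. -/

/-- The inclusion `ΛV → ℂ[G ⋉ V]`. -/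
def ofExt : ExtAlg ρ →ₐ[ℂ] SupergroupAlgebra ρ where
  toRingHom := SkewMonoidAlgebra.singleOneRingHom
  commutes' _ := rfl

theorem ofExt_mul_ofG (a : ExtAlg ρ) (g : G) :
    ofExt ρ a * ofG ρ g = SkewMonoidAlgebra.single g a := by
  change SkewMonoidAlgebra.single 1 a * SkewMonoidAlgebra.single g 1 = _
  rw [SkewMonoidAlgebra.single_mul_single, one_smul, mul_one, one_mul]

/-- `ℂ[G ⋉ V]` is spanned by the products `v₁ ⋯ v_k g`. -/
theorem supergroup_induction {C : SupergroupAlgebra ρ → Prop} (ofG : ∀ g, C (ofG ρ g))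
    (ofV_mul : ∀ v x, C x → C (ofV ρ v * x)) (add : ∀ x y, C x → C y → C (x + y))
    (smul : ∀ (c : ℂ) x, C x → C (c • x)) (x : SupergroupAlgebra ρ) : C x := by
  have key : ∀ (a : ExtAlg ρ) (x : SupergroupAlgebra ρ), C x → C (ofExt ρ a * x) := by
    intro a
    induction a using extAlg_induction ρ with
    | algebraMap c =>
      intro x hx
      rw [AlgHom.commutes, ← Algebra.smul_def]
      exact smul c x hx
    | ι v => exact fun x hx => ofV_mul v x hx
    | mul a b ha hb =>
      intro x hx
      rw [map_mul, mul_assoc]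
      exact ha _ (hb _ hx)
    | add a b ha hb =>
      intro x hx
      rw [map_add, add_mul]
      exact add _ _ (ha _ hx) (hb _ hx)
  induction x using SkewMonoidAlgebra.induction_on with
  | zero => simpa using smul 0 _ (ofG 1)
  | single g a =>
    rw [← ofExt_mul_ofG]
    exact key a _ (ofG g)
  | add x y hx hy => exact add x y hx hy

theorem supergroup_algHom_ext {R : Type*} [Semiring R] [Algebra ℂ R]
    {f f' : SupergroupAlgebra ρ →ₐ[ℂ] R} (hG : ∀ g, f (ofG ρ g) = f' (ofG ρ g))
    (hV : ∀ v, f (ofV ρ v) = f' (ofV ρ v)) : f = f' := by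
  refine AlgHom.ext fun x => ?_
  induction x using supergroup_induction ρ with
  | ofG g => exact hG g
  | ofV_mul v x hx => rw [map_mul, map_mul, hV, hx]
  | add x y hx hy => rw [map_add, map_add, hx, hy]
  | smul c x hx => rw [map_smul, map_smul, hx]

/-! ### Algebra homomorphisms out of `ℂ[G ⋉ V]` -/

section Lift

variable {R : Type*} [Ring R] [Algebra ℂ R] (fV : V →ₗ[ℂ] R) (fG : G →* R)
  (hsq : ∀ v, fV v * fV v = 0)

/-- The algebra homomorphism from `ΛV` with given values on `V`. -/
def extLift : ExtAlg ρ →ₐ[ℂ] R :=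
  (ExteriorAlgebra.lift ℂ ⟨fV, hsq⟩ : ExteriorAlgebra ℂ V →ₐ[ℂ] R)

theorem extLift_extι (v : V) : extLift ρ fV hsq (extι ρ v) = fV v :=
  ExteriorAlgebra.lift_ι_apply ℂ fV hsq v

theorem extLift_smul_mul
    (hcomm : ∀ g v, fV (ρ g v) * fG g = fG g * fV v)
    (x : ExtAlg ρ) (g : G) :
    extLift ρ fV hsq (g • x) * fG g = fG g * extLift ρ fV hsq x := by
  induction x using extAlg_induction ρ with
  | algebraMap c => rw [smul_algebraMap, AlgHom.commutes, Algebra.commutes]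
  | ι v => rw [smul_extι, extLift_extι, extLift_extι, hcomm]
  | mul a b ha hb => rw [smul_mul', map_mul, map_mul, mul_assoc, hb, ← mul_assoc, ha, mul_assoc]
  | add a b ha hb => rw [smul_add, map_add, map_add, add_mul, mul_add, ha, hb]

/-- The algebra homomorphism from `ℂ[G ⋉ V]` with given values on `G` and on `V`. -/
def supergroupLift
    (hcomm : ∀ g v, fV (ρ g v) * fG g = fG g * fV v) :
    SupergroupAlgebra ρ →ₐ[ℂ] R :=
  SkewMonoidAlgebra.liftNCAlgHom (extLift ρ fV hsq) fG
    (fun {x g} => extLift_smul_mul ρ fV fG hsq hcomm x g)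

theorem supergroupLift_ofG
    (hcomm : ∀ g v, fV (ρ g v) * fG g = fG g * fV v) (g : G) :
    supergroupLift ρ fV fG hsq hcomm (ofG ρ g) = fG g := by
  change SkewMonoidAlgebra.liftNC _ _ (SkewMonoidAlgebra.single g 1) = _
  rw [SkewMonoidAlgebra.liftNC_single]
  change extLift ρ fV hsq 1 * fG g = fG g
  rw [map_one, one_mul]

theorem supergroupLift_ofV
    (hcomm : ∀ g v, fV (ρ g v) * fG g = fG g * fV v) (v : V) :
    supergroupLift ρ fV fG hsq hcomm (ofV ρ v) = fV v := by
  change SkewMonoidAlgebra.liftNC _ _ (SkewMonoidAlgebra.single 1 (extι ρ v)) = _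
  rw [SkewMonoidAlgebra.liftNC_single]
  change extLift ρ fV hsq (extι ρ v) * fG 1 = fV v
  rw [map_one, mul_one, extLift_extι]

end Lift

theorem superComul_ofG (g : G) : superComul ρ (ofG ρ g) = ofG ρ g ᵍ⊗ₜ[ℂ] ofG ρ g := by
  change SkewMonoidAlgebra.liftNC _ _ (SkewMonoidAlgebra.single g 1) = _
  rw [SkewMonoidAlgebra.liftNC_single]
  change extComul ρ 1 * grouplike ρ g = _
  rw [map_one, one_mul]
  rfl

theorem superComul_ofV (v : V) : superComul ρ (ofV ρ v) = primitive ρ v := by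
  change SkewMonoidAlgebra.liftNC _ _ (SkewMonoidAlgebra.single 1 (extι ρ v)) = _
  rw [SkewMonoidAlgebra.liftNC_single]
  change extComul ρ (extι ρ v) * grouplike ρ 1 = _
  rw [map_one, mul_one, extComul_ι]

theorem superCounit_ofG (g : G) : superCounit ρ (ofG ρ g) = 1 := by
  change SkewMonoidAlgebra.liftNC _ _ (SkewMonoidAlgebra.single g 1) = _
  rw [SkewMonoidAlgebra.liftNC_single]
  change extCounit ρ 1 * 1 = _
  rw [map_one, one_mul]

theorem superCounit_ofV (v : V) : superCounit ρ (ofV ρ v) = 0 := by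
  change SkewMonoidAlgebra.liftNC _ _ (SkewMonoidAlgebra.single 1 (extι ρ v)) = _
  rw [SkewMonoidAlgebra.liftNC_single]
  change extCounit ρ (extι ρ v) * _ = _
  rw [extCounit_ι, zero_mul]

theorem ofV_mul_ofV_comm (v w : V) : ofV ρ v * ofV ρ w = -(ofV ρ w * ofV ρ v) := by
  have h := ofV_mul_ofV ρ (v + w)
  rw [map_add, add_mul, mul_add, mul_add, ofV_mul_ofV, ofV_mul_ofV, zero_add, add_zero] at h
  exact eq_neg_of_add_eq_zero_left h

end Generators

/-! ### Parity as conjugation by `u` -/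

/-- The element `u` is central, of square `1`, and acts on `V` by `-1`. -/
structure IsParityElement {G V : Type*} [Group G] [AddCommGroup V] [Module ℂ V]
    (ρ : Representation ℂ G V) (u : G) : Prop where
  comm : ∀ g, u * g = g * u
  mul_self : u * u = 1
  apply_eq : ∀ v, ρ u v = -v

section Parity

variable {G V : Type*} [Group G] [AddCommGroup V] [Module ℂ V] {ρ : Representation ℂ G V} {u : G}

namespace IsParityElement

theorem ofG_mul_self (hu : IsParityElement ρ u) : ofG ρ u * ofG ρ u = 1 := by
  rw [← map_mul, hu.mul_self, map_one]

theorem ofG_mul_ofG (hu : IsParityElement ρ u) (g : G) :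
    ofG ρ u * ofG ρ g = ofG ρ g * ofG ρ u := by
  rw [← map_mul, hu.comm, map_mul]

theorem ofG_mul_ofV (hu : IsParityElement ρ u) (v : V) :
    ofG ρ u * ofV ρ v = -(ofV ρ v * ofG ρ u) := by
  rw [SupergroupHopf.ofG_mul_ofV, hu.apply_eq, map_neg, neg_mul]

end IsParityElement

theorem ofV_mul_mem_parity (v : V) {i : ZMod 2} {x : SupergroupAlgebra ρ} (hx : x ∈ parity ρ i) :
    ofV ρ v * x ∈ parity ρ (1 + i) :=
  SetLike.GradedMul.mul_mem (ofV_mem_parity ρ v) hx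

theorem proj_of_mem_same {i : ZMod 2} {x : SupergroupAlgebra ρ} (hx : x ∈ parity ρ i) :
    GradedAlgebra.proj (parity ρ) i x = x := by
  rw [GradedAlgebra.proj_apply, DirectSum.decompose_of_mem_same _ hx]

theorem proj_of_mem_ne {i j : ZMod 2} {x : SupergroupAlgebra ρ} (hx : x ∈ parity ρ i)
    (hij : i ≠ j) : GradedAlgebra.proj (parity ρ) j x = 0 := by
  rw [GradedAlgebra.proj_apply, DirectSum.decompose_of_mem_ne _ hx hij]

theorem proj_mem (i : ZMod 2) (x : SupergroupAlgebra ρ) :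
    GradedAlgebra.proj (parity ρ) i x ∈ parity ρ i := by
  rw [GradedAlgebra.proj_apply]
  exact SetLike.coe_mem _

theorem proj_zero_add_proj_one (x : SupergroupAlgebra ρ) :
    GradedAlgebra.proj (parity ρ) 0 x + GradedAlgebra.proj (parity ρ) 1 x = x := by
  classical
  conv_rhs => rw [← DirectSum.sum_support_decompose (parity ρ) x]
  simp only [GradedAlgebra.proj_apply]
  rw [Finset.sum_subset (Finset.subset_univ _)]
  · exact (Fin.sum_univ_two (fun i : Fin 2 =>
      ((DirectSum.decompose (parity ρ) x) i : SupergroupAlgebra ρ))).symm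
  · intro i _ hi
    simpa using hi

theorem proj_ofV_mul (v : V) (i : ZMod 2) (x : SupergroupAlgebra ρ) :
    GradedAlgebra.proj (parity ρ) (1 + i) (ofV ρ v * x)
      = ofV ρ v * GradedAlgebra.proj (parity ρ) i x := by
  have hne : (1 + (1 + i) : ZMod 2) ≠ 1 + i := by revert i; decide
  have hx : x = GradedAlgebra.proj (parity ρ) i x + GradedAlgebra.proj (parity ρ) (1 + i) x := by
    fin_cases i
    · exact (proj_zero_add_proj_one x).symm
    · exact ((add_comm _ _).trans (proj_zero_add_proj_one x)).symm
  conv_lhs => rw [hx, mul_add, map_add]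
  rw [proj_of_mem_same (ofV_mul_mem_parity v (proj_mem i x)),
    proj_of_mem_ne (ofV_mul_mem_parity v (proj_mem (1 + i) x)) hne, add_zero]

theorem parityInvol_ofV_mul (v : V) (x : SupergroupAlgebra ρ) :
    parityInvol ρ (ofV ρ v * x) = -(ofV ρ v * parityInvol ρ x) := by
  have h0 := proj_ofV_mul v 0 x
  have h1 := proj_ofV_mul v 1 x
  rw [show (1 + 1 : ZMod 2) = 0 from rfl] at h1
  rw [add_zero] at h0
  rw [parityInvol, LinearMap.sub_apply, LinearMap.sub_apply, h0, h1, mul_sub, neg_sub]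

/-- Both sides fix each `g` and change sign when `v` is multiplied on the left. This turns the sign
`(-1)^p(x)` into an inner automorphism, which a multiplicative coproduct can transport. -/
theorem IsParityElement.parityInvol_eq (hu : IsParityElement ρ u) (x : SupergroupAlgebra ρ) :
    parityInvol ρ x = ofG ρ u * x * ofG ρ u := by
  induction x using supergroup_induction ρ with
  | ofG g =>
    rw [hu.ofG_mul_ofG, mul_assoc, hu.ofG_mul_self, mul_one, parityInvol, LinearMap.sub_apply,
      proj_of_mem_same (ofG_mem_parity ρ g), proj_of_mem_ne (ofG_mem_parity ρ g) zero_ne_one,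
      sub_zero]
  | ofV_mul v x hx =>
    rw [parityInvol_ofV_mul, hx, ← mul_assoc, ← mul_assoc, ← mul_assoc, hu.ofG_mul_ofV, neg_mul,
      neg_mul]
  | add x y hx hy => rw [map_add, hx, hy, mul_add, add_mul]
  | smul c x hx => rw [map_smul, hx, mul_smul_comm, smul_mul_assoc]

theorem IsParityElement.ofG_mul_of_mem_parity_one (hu : IsParityElement ρ u)
    {x : SupergroupAlgebra ρ} (hx : x ∈ parity ρ 1) : ofG ρ u * x = -(x * ofG ρ u) := by
  have h := hu.parityInvol_eq x
  rw [parityInvol, LinearMap.sub_apply, proj_of_mem_same hx, proj_of_mem_ne hx one_ne_zero,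
    zero_sub] at h
  rw [← neg_mul, h, mul_assoc, hu.ofG_mul_self, mul_one]

theorem IsParityElement.ofG_mul_of_mem_parity_zero (hu : IsParityElement ρ u)
    {x : SupergroupAlgebra ρ} (hx : x ∈ parity ρ 0) : ofG ρ u * x = x * ofG ρ u := by
  have h := hu.parityInvol_eq x
  rw [parityInvol, LinearMap.sub_apply, proj_of_mem_same hx, proj_of_mem_ne hx zero_ne_one,
    sub_zero] at h
  conv_rhs => rw [h, mul_assoc, hu.ofG_mul_self, mul_one]

/-- The algebra homomorphism `b ↦ u ^ p(b) ⊗ b`. -/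
def twistRight (ρ : Representation ℂ G V) (u : G) :
    SupergroupAlgebra ρ →ₐ[ℂ] SupergroupAlgebra ρ ⊗[ℂ] SupergroupAlgebra ρ :=
  supergroupLift ρ (TensorProduct.mk ℂ _ _ (ofG ρ u) ∘ₗ ofV ρ)
    ((Algebra.TensorProduct.includeRight : _ →ₐ[ℂ] SupergroupAlgebra ρ ⊗[ℂ] SupergroupAlgebra ρ)
      |>.toMonoidHom.comp (ofG ρ))
    (fun v => by simp [ofV_mul_ofV])
    (fun g v => by simp [SupergroupHopf.ofG_mul_ofV])

theorem twistRight_apply (hu : IsParityElement ρ u) (b : SupergroupAlgebra ρ) :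
    twistRight ρ u b = 1 ⊗ₜ GradedAlgebra.proj (parity ρ) 0 b
      + ofG ρ u ⊗ₜ GradedAlgebra.proj (parity ρ) 1 b := by
  induction b using supergroup_induction ρ with
  | ofG g =>
    rw [proj_of_mem_same (ofG_mem_parity ρ g), proj_of_mem_ne (ofG_mem_parity ρ g) zero_ne_one,
      TensorProduct.tmul_zero, add_zero]
    exact supergroupLift_ofG ..
  | ofV_mul v x hx =>
    have h0 := proj_ofV_mul v 0 x
    have h1 := proj_ofV_mul v 1 x
    rw [show (1 + 1 : ZMod 2) = 0 from rfl] at h1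
    rw [add_zero] at h0
    have h2 : twistRight ρ u (ofV ρ v) = ofG ρ u ⊗ₜ ofV ρ v := supergroupLift_ofV ..
    rw [map_mul, hx, h0, h1, h2, mul_add, Algebra.TensorProduct.tmul_mul_tmul,
      Algebra.TensorProduct.tmul_mul_tmul, mul_one, hu.ofG_mul_self, add_comm]
  | add x y hx hy =>
    rw [map_add, hx, hy, map_add, map_add, TensorProduct.tmul_add, TensorProduct.tmul_add]
    abel
  | smul c x hx =>
    rw [map_smul, hx, map_smul, map_smul, TensorProduct.tmul_smul, TensorProduct.tmul_smul,
      smul_add]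

/-- The algebra homomorphism `a ⊗ b ↦ a u ^ p(b) ⊗ b` from the super tensor square to the ordinary
tensor square. -/
def bosonize (hu : IsParityElement ρ u) :
    SuperTensorSq ρ →ₐ[ℂ] SupergroupAlgebra ρ ⊗[ℂ] SupergroupAlgebra ρ :=
  GradedTensorProduct.lift (parity ρ) (parity ρ) Algebra.TensorProduct.includeLeft (twistRight ρ u)
    (by
      -- The images of the two factors must supercommute. An odd `b` is sent to `u ⊗ b`, and moving
      -- `a` past `u` produces exactly the Koszul sign; an even `b` is sent to `1 ⊗ b`, and no sign
      -- occurs.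
      intro i j a b
      rw [twistRight_apply hu, Algebra.TensorProduct.includeLeft_apply]
      have hi : i = 0 ∨ i = 1 := (by decide : ∀ i : ZMod 2, i = 0 ∨ i = 1) i
      have hj : j = 0 ∨ j = 1 := (by decide : ∀ i : ZMod 2, i = 0 ∨ i = 1) j
      rcases hj with rfl | rfl
      · rw [proj_of_mem_same b.2, proj_of_mem_ne b.2 zero_ne_one]
        simp
      · rw [proj_of_mem_same b.2, proj_of_mem_ne b.2 one_ne_zero]
        rcases hi with rfl | rfl
        · simp [hu.ofG_mul_of_mem_parity_zero a.2]
        · simp [hu.ofG_mul_of_mem_parity_one a.2, TensorProduct.neg_tmul])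

theorem bosonize_tmul (hu : IsParityElement ρ u) (a b : SupergroupAlgebra ρ) :
    bosonize hu (a ᵍ⊗ₜ[ℂ] b) = a ⊗ₜ GradedAlgebra.proj (parity ρ) 0 b
      + (a * ofG ρ u) ⊗ₜ GradedAlgebra.proj (parity ρ) 1 b := by
  refine (GradedTensorProduct.lift_tmul (parity ρ) (parity ρ) _ _ _ a b).trans ?_
  rw [twistRight_apply hu, Algebra.TensorProduct.includeLeft_apply, mul_add,
    Algebra.TensorProduct.tmul_mul_tmul, Algebra.TensorProduct.tmul_mul_tmul, mul_one, one_mul,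
    one_mul]

end Parity

/-! ### The exponential of a nilpotent element of a complex algebra -/

section Exp

variable {R S : Type*} [Ring R] [Ring S]

/-- A sum of `n` commuting elements of square zero has vanishing `n + 1`-st power. -/
theorem sum_pow_card_succ_eq_zero {ι : Type*} (s : Finset ι) (f : ι → R)
    (hcomm : ∀ i j, Commute (f i) (f j)) (hsq : ∀ i, f i ^ 2 = 0) :
    (∑ i ∈ s, f i) ^ (s.card + 1) = 0 := by
  classical
  induction s using Finset.induction_on with
  | empty => simp
  | insert i s hi ih =>
    rw [Finset.sum_insert hi, Finset.card_insert_of_notMem hi]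
    -- For commuting summands, vanishing powers `2` and `s.card + 1` give the vanishing power
    -- `s.card + 2`: one less than the sum of the exponents is enough.
    exact Commute.add_pow_eq_zero_of_add_le_succ_of_pow_eq_zero
      (Commute.sum_right _ _ _ fun j _ => hcomm i j) (hsq i) ih (by omega)

variable [Algebra ℂ R] [Algebra ℂ S]

/-- The exponential of a nilpotent element of a complex algebra. -/
def nilExp (x : R) : R :=
  letI : Module ℚ R := Module.compHom R (algebraMap ℚ ℂ)
  IsNilpotent.exp x

theorem nilExp_eq_sum {x : R} {k : ℕ} (h : x ^ k = 0) :
    nilExp x = ∑ i ∈ Finset.range k, ((i.factorial : ℂ)⁻¹) • x ^ i := by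
  let : Module ℚ R := Module.compHom R (algebraMap ℚ ℂ)
  refine (IsNilpotent.exp_eq_sum h).trans (Finset.sum_congr rfl fun i _ => ?_)
  change (algebraMap ℚ ℂ (i.factorial : ℚ)⁻¹) • x ^ i = _
  rw [map_inv₀, map_natCast]

theorem nilExp_zero : nilExp (0 : R) = 1 := by
  rw [nilExp_eq_sum (pow_one 0)]
  simp

theorem nilExp_add {x y : R} (h : Commute x y) (hx : IsNilpotent x) (hy : IsNilpotent y) :
    nilExp (x + y) = nilExp x * nilExp y :=
  letI : Module ℚ R := Module.compHom R (algebraMap ℚ ℂ)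
  IsNilpotent.exp_add_of_commute h hx hy

theorem nilExp_neg_mul {x : R} (hx : IsNilpotent x) : nilExp (-x) * nilExp x = 1 :=
  letI : Module ℚ R := Module.compHom R (algebraMap ℚ ℂ)
  IsNilpotent.exp_neg_mul_exp_self hx

theorem nilExp_mul_neg {x : R} (hx : IsNilpotent x) : nilExp x * nilExp (-x) = 1 :=
  letI : Module ℚ R := Module.compHom R (algebraMap ℚ ℂ)
  IsNilpotent.exp_mul_exp_neg_self hx

theorem map_nilExp (f : R →ₐ[ℂ] S) {x : R} (hx : IsNilpotent x) :
    f (nilExp x) = nilExp (f x) := by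
  obtain ⟨k, hk⟩ := hx
  have hk' : f x ^ k = 0 := by rw [← map_pow, hk, map_zero]
  rw [nilExp_eq_sum hk, nilExp_eq_sum hk', map_sum]
  exact Finset.sum_congr rfl fun i _ => by rw [map_smul, map_pow]

theorem semiconjBy_nilExp {a x y : R} (h : SemiconjBy a x y) (hx : IsNilpotent x)
    (hy : IsNilpotent y) : SemiconjBy a (nilExp x) (nilExp y) := by
  obtain ⟨k, hk⟩ := hx
  obtain ⟨l, hl⟩ := hy
  have hk' : x ^ max k l = 0 := pow_eq_zero_of_le (le_max_left _ _) hk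
  have hl' : y ^ max k l = 0 := pow_eq_zero_of_le (le_max_right _ _) hl
  rw [nilExp_eq_sum hk', nilExp_eq_sum hl']
  unfold SemiconjBy
  rw [Finset.mul_sum, Finset.sum_mul]
  exact Finset.sum_congr rfl fun i _ => by
    rw [mul_smul_comm, smul_mul_assoc, (h.pow_right i).eq]

/-- The exponential of `x` agrees with `1 + x` up to a multiple of `x ^ 2`. -/
theorem exists_nilExp_eq {x : R} (hx : IsNilpotent x) :
    ∃ r : R, nilExp x = 1 + x + x * (x * r) := by
  obtain ⟨k, hk⟩ := hx
  -- The exponent is raised by two so that the terms of index `0` and `1` can be split off for every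
  -- `k`.
  have hk' : x ^ (k + 2) = 0 := pow_eq_zero_of_le (by omega) hk
  refine ⟨∑ i ∈ Finset.range k, (((i + 2).factorial : ℂ)⁻¹) • x ^ i, ?_⟩
  rw [nilExp_eq_sum hk', Finset.sum_range_succ', Finset.sum_range_succ', Finset.mul_sum,
    Finset.mul_sum]
  have : ∀ i ∈ Finset.range k, (((i + 1 + 1).factorial : ℂ)⁻¹) • x ^ (i + 1 + 1)
      = x * (x * ((((i + 2).factorial : ℂ)⁻¹) • x ^ i)) := fun i _ => by
    rw [mul_smul_comm, mul_smul_comm, pow_succ', pow_succ']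
  rw [Finset.sum_congr rfl this]
  simp
  abel

end Exp

/-! ### The coproduct of `A(G, V, u, B)` as an algebra homomorphism -/

section Comul

variable {G V : Type*} [Group G] [AddCommGroup V] [Module ℂ V] {ρ : Representation ℂ G V} {u : G}

/-- The linear map `v ⊗ w ↦ v u ⊗ w`. -/
def twistIncl (ρ : Representation ℂ G V) (u : G) :
    V ⊗[ℂ] V →ₗ[ℂ] SupergroupAlgebra ρ ⊗[ℂ] SupergroupAlgebra ρ :=
  TensorProduct.map (LinearMap.mulRight ℂ (ofG ρ u) ∘ₗ ofV ρ) (ofV ρ)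

theorem twistIncl_tmul (v w : V) :
    twistIncl ρ u (v ⊗ₜ w) = (ofV ρ v * ofG ρ u) ⊗ₜ ofV ρ w := rfl

theorem bosonize_tensorIncl (hu : IsParityElement ρ u) (B : V ⊗[ℂ] V) :
    bosonize hu (tensorIncl ρ B) = twistIncl ρ u B := by
  induction B using TensorProduct.induction_on with
  | zero => simp
  | tmul v w =>
    refine (bosonize_tmul hu (ofV ρ v) (ofV ρ w)).trans ?_
    rw [proj_of_mem_same (ofV_mem_parity ρ w), proj_of_mem_ne (ofV_mem_parity ρ w) one_ne_zero,
      TensorProduct.tmul_zero, zero_add, twistIncl_tmul]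
  | add x y hx hy => rw [map_add, map_add, map_add, hx, hy]

namespace IsParityElement

theorem ofV_u_mul_ofV_u (hu : IsParityElement ρ u) (v w : V) :
    (ofV ρ v * ofG ρ u) * (ofV ρ w * ofG ρ u) = -(ofV ρ v * ofV ρ w) := by
  rw [mul_assoc, ← mul_assoc (ofG ρ u), hu.ofG_mul_ofV, neg_mul, mul_assoc, hu.ofG_mul_self,
    mul_one, mul_neg]

/-- For pure tensors, exchanging the factors anticommutes both `v, v'` and `w, w'`, and the two
signs cancel. -/
theorem commute_twistIncl (hu : IsParityElement ρ u) (B B' : V ⊗[ℂ] V) :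
    Commute (twistIncl ρ u B) (twistIncl ρ u B') := by
  induction B using TensorProduct.induction_on with
  | zero => rw [map_zero]; exact Commute.zero_left _
  | add x y hx hy => rw [map_add]; exact hx.add_left hy
  | tmul v w =>
    induction B' using TensorProduct.induction_on with
    | zero => rw [map_zero]; exact Commute.zero_right _
    | add x y hx hy => rw [map_add]; exact hx.add_right hy
    | tmul v' w' =>
      rw [twistIncl_tmul, twistIncl_tmul]
      unfold Commute SemiconjBy
      rw [Algebra.TensorProduct.tmul_mul_tmul, Algebra.TensorProduct.tmul_mul_tmul,
        hu.ofV_u_mul_ofV_u, hu.ofV_u_mul_ofV_u, ofV_mul_ofV_comm ρ v v', ofV_mul_ofV_comm ρ w w',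
        TensorProduct.tmul_neg, ← TensorProduct.neg_tmul, neg_neg]

/-- Expanded along a basis of the left factor, `B` is a sum of `dim V` pure tensors. Their images
commute and square to zero because the right factor does. The resulting exponent is the truncation
chosen in `expTensor`. -/
theorem twistIncl_pow (hu : IsParityElement ρ u) [FiniteDimensional ℂ V] (B : V ⊗[ℂ] V) :
    twistIncl ρ u B ^ (Module.finrank ℂ V + 1) = 0 := by
  let b := Module.finBasis ℂ V
  obtain ⟨c, rfl⟩ := TensorProduct.eq_repr_basis_left b B
  rw [Finsupp.sum_fintype _ _ (fun i => TensorProduct.tmul_zero _ _), map_sum]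
  have := sum_pow_card_succ_eq_zero Finset.univ (fun i => twistIncl ρ u (b i ⊗ₜ c i))
    (fun i j => hu.commute_twistIncl _ _) (fun i => by
      rw [pow_two, twistIncl_tmul, Algebra.TensorProduct.tmul_mul_tmul, ofV_mul_ofV,
        TensorProduct.tmul_zero])
  rwa [Finset.card_univ, Fintype.card_fin] at this

theorem isNilpotent_twistIncl (hu : IsParityElement ρ u) [FiniteDimensional ℂ V]
    (B : V ⊗[ℂ] V) : IsNilpotent (twistIncl ρ u B) :=
  ⟨_, hu.twistIncl_pow B⟩

end IsParityElement

/-- The image of `e^B` in the ordinary tensor square. -/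
def expTwist (ρ : Representation ℂ G V) (u : G) (B : V ⊗[ℂ] V) :
    SupergroupAlgebra ρ ⊗[ℂ] SupergroupAlgebra ρ :=
  nilExp (twistIncl ρ u B)

theorem semiconjBy_twistIncl (hu : IsParityElement ρ u) (g : G) (B : V ⊗[ℂ] V) :
    SemiconjBy (ofG ρ g ⊗ₜ[ℂ] ofG ρ g) (twistIncl ρ u B)
      (twistIncl ρ u (TensorProduct.map (ρ g) (ρ g) B)) := by
  induction B using TensorProduct.induction_on with
  | zero => rw [map_zero, map_zero, map_zero]; exact SemiconjBy.zero_right _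
  | add x y hx hy => rw [map_add, map_add, map_add]; exact hx.add_right hy
  | tmul v w =>
    rw [TensorProduct.map_tmul, twistIncl_tmul, twistIncl_tmul]
    unfold SemiconjBy
    rw [Algebra.TensorProduct.tmul_mul_tmul, Algebra.TensorProduct.tmul_mul_tmul, ofG_mul_ofV,
      ← mul_assoc, ofG_mul_ofV, mul_assoc, mul_assoc, hu.ofG_mul_ofG]

theorem IsParityElement.map_apply (hu : IsParityElement ρ u) (B : V ⊗[ℂ] V) :
    TensorProduct.map (ρ u) (ρ u) B = B := by
  induction B using TensorProduct.induction_on with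
  | zero => rw [map_zero]
  | add x y hx hy => rw [map_add, hx, hy]
  | tmul v w =>
    rw [TensorProduct.map_tmul, hu.apply_eq, hu.apply_eq, TensorProduct.neg_tmul,
      TensorProduct.tmul_neg, neg_neg]

/-- The coproduct of `A(G, V, u, 0)`. -/
def baseComul (hu : IsParityElement ρ u) :
    SupergroupAlgebra ρ →ₐ[ℂ] SupergroupAlgebra ρ ⊗[ℂ] SupergroupAlgebra ρ :=
  (bosonize hu).comp (superComul ρ)

theorem baseComul_ofG (hu : IsParityElement ρ u) (g : G) :
    baseComul hu (ofG ρ g) = ofG ρ g ⊗ₜ ofG ρ g := by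
  rw [baseComul, AlgHom.comp_apply, superComul_ofG, bosonize_tmul,
    proj_of_mem_same (ofG_mem_parity ρ g), proj_of_mem_ne (ofG_mem_parity ρ g) zero_ne_one,
    TensorProduct.tmul_zero, add_zero]

theorem baseComul_ofV (hu : IsParityElement ρ u) (v : V) :
    baseComul hu (ofV ρ v) = ofV ρ v ⊗ₜ 1 + ofG ρ u ⊗ₜ ofV ρ v := by
  have h1 : (1 : SupergroupAlgebra ρ) ∈ parity ρ 0 := SetLike.GradedOne.one_mem
  rw [baseComul, AlgHom.comp_apply, superComul_ofV, primitive_apply, map_add, bosonize_tmul,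
    bosonize_tmul, proj_of_mem_same h1, proj_of_mem_ne h1 zero_ne_one,
    proj_of_mem_same (ofV_mem_parity ρ v), proj_of_mem_ne (ofV_mem_parity ρ v) one_ne_zero,
    TensorProduct.tmul_zero, TensorProduct.tmul_zero, add_zero, zero_add, one_mul]

/-- For `a u ⊗ b` and `v ⊗ 1`, `v` passes both `u` and `a`; for `u ⊗ v`, `u` passes `a` and `v`
passes `b`. Each time two signs cancel. Consequently the twist leaves the coproduct of `V`
unchanged. -/
theorem commute_twistIncl_ofV (hu : IsParityElement ρ u) (B : V ⊗[ℂ] V) (v : V) :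
    Commute (twistIncl ρ u B) (ofV ρ v ⊗ₜ 1 + ofG ρ u ⊗ₜ ofV ρ v) := by
  induction B using TensorProduct.induction_on with
  | zero => rw [map_zero]; exact Commute.zero_left _
  | add x y hx hy => rw [map_add]; exact hx.add_left hy
  | tmul a b =>
    rw [twistIncl_tmul]
    unfold Commute SemiconjBy
    simp only [mul_add, add_mul, Algebra.TensorProduct.tmul_mul_tmul, mul_one, one_mul]
    congr 1
    · rw [mul_assoc, hu.ofG_mul_ofV, mul_neg, ← mul_assoc, ← mul_assoc, ofV_mul_ofV_comm ρ a v,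
        neg_mul, neg_neg]
    · rw [← mul_assoc, hu.ofG_mul_ofV, neg_mul, TensorProduct.neg_tmul, ← TensorProduct.tmul_neg,
        ofV_mul_ofV_comm ρ v b, neg_neg]

theorem rightPart_zero_eq (hu : IsParityElement ρ u) (t : SuperTensorSq ρ) :
    rightPart ρ 0 t = (GradedAlgebra.proj (parity ρ) 0).lTensor _ (bosonize hu t) := by
  have h : rightPart ρ 0
      = (GradedAlgebra.proj (parity ρ) 0).lTensor _ ∘ₗ (bosonize hu).toLinearMap := by
    refine GradedTensorProduct.hom_ext _ _ (TensorProduct.ext' fun a b => ?_)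
    refine Eq.trans ?_ (congrArg ((GradedAlgebra.proj (parity ρ) 0).lTensor _)
      (bosonize_tmul hu a b).symm)
    rw [map_add, LinearMap.lTensor_tmul, LinearMap.lTensor_tmul,
      proj_of_mem_same (proj_mem 0 b), proj_of_mem_ne (proj_mem 1 b) one_ne_zero,
      TensorProduct.tmul_zero, add_zero]
    rfl
  exact DFunLike.congr_fun h t

/-- `bosonize` alters only the left slot, so right parities can be read off after it. On the odd
part it has inserted one `u`, which the additional factor `u` cancels since `u² = 1`. -/
theorem rightPart_one_eq (hu : IsParityElement ρ u) (t : SuperTensorSq ρ) :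
    rightPart ρ 1 t
      = (GradedAlgebra.proj (parity ρ) 1).lTensor _ (bosonize hu t) * (ofG ρ u ⊗ₜ 1) := by
  have h : rightPart ρ 1 = LinearMap.mulRight ℂ (ofG ρ u ⊗ₜ 1) ∘ₗ
      (GradedAlgebra.proj (parity ρ) 1).lTensor _ ∘ₗ (bosonize hu).toLinearMap := by
    refine GradedTensorProduct.hom_ext _ _ (TensorProduct.ext' fun a b => ?_)
    refine Eq.trans ?_ (congrArg
      (fun z => (GradedAlgebra.proj (parity ρ) 1).lTensor _ z * (ofG ρ u ⊗ₜ 1))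
      (bosonize_tmul hu a b).symm)
    rw [map_add, LinearMap.lTensor_tmul, LinearMap.lTensor_tmul,
      proj_of_mem_same (proj_mem 1 b), proj_of_mem_ne (proj_mem 0 b) zero_ne_one,
      TensorProduct.tmul_zero, zero_add, Algebra.TensorProduct.tmul_mul_tmul, mul_one, mul_assoc,
      hu.ofG_mul_self, mul_one]
    rfl
  exact DFunLike.congr_fun h t

/-- Conjugation by `u ⊗ u` negates the part with odd right factor and replaces the left factor `a`
by `u a u`. The outer factors `u` restore `a`, and the minus sign of the formula cancels the
negation. -/
theorem proj_one_conj_add_proj_zero (hu : IsParityElement ρ u)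
    (t : SupergroupAlgebra ρ ⊗[ℂ] SupergroupAlgebra ρ) :
    (GradedAlgebra.proj (parity ρ) 0).lTensor _ t - (ofG ρ u ⊗ₜ 1) *
      ((GradedAlgebra.proj (parity ρ) 1).lTensor _
        ((ofG ρ u ⊗ₜ ofG ρ u) * t * (ofG ρ u ⊗ₜ ofG ρ u)) * (ofG ρ u ⊗ₜ 1)) = t := by
  induction t using TensorProduct.induction_on with
  | zero => simp
  | add x y hx hy =>
    conv_rhs => rw [← hx, ← hy]
    simp only [map_add, mul_add, add_mul]
    abel
  | tmul a b =>
    rw [Algebra.TensorProduct.tmul_mul_tmul, Algebra.TensorProduct.tmul_mul_tmul,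
      ← hu.parityInvol_eq b, LinearMap.lTensor_tmul, LinearMap.lTensor_tmul,
      Algebra.TensorProduct.tmul_mul_tmul, Algebra.TensorProduct.tmul_mul_tmul, parityInvol,
      LinearMap.sub_apply, map_sub, proj_of_mem_same (proj_mem 1 b),
      proj_of_mem_ne (proj_mem 0 b) zero_ne_one, zero_sub, mul_one, one_mul,
      TensorProduct.tmul_neg, sub_neg_eq_add, mul_assoc, mul_assoc, hu.ofG_mul_self, mul_one,
      ← mul_assoc, hu.ofG_mul_self, one_mul, ← TensorProduct.tmul_add, proj_zero_add_proj_one]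

variable [FiniteDimensional ℂ V]

theorem bosonize_expTensor (hu : IsParityElement ρ u) (B : V ⊗[ℂ] V) :
    bosonize hu (expTensor ρ B) = expTwist ρ u B := by
  rw [expTwist, nilExp_eq_sum (hu.twistIncl_pow B), expTensor, map_sum]
  exact Finset.sum_congr rfl fun i _ => by rw [map_smul, map_pow, bosonize_tensorIncl]

theorem expTwist_neg_mul (hu : IsParityElement ρ u) (B : V ⊗[ℂ] V) :
    expTwist ρ u (-B) * expTwist ρ u B = 1 := by
  rw [expTwist, expTwist, map_neg, nilExp_neg_mul (hu.isNilpotent_twistIncl B)]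

theorem expTwist_mul_neg (hu : IsParityElement ρ u) (B : V ⊗[ℂ] V) :
    expTwist ρ u B * expTwist ρ u (-B) = 1 := by
  rw [expTwist, expTwist, map_neg, nilExp_mul_neg (hu.isNilpotent_twistIncl B)]

theorem expTwist_add (hu : IsParityElement ρ u) (B B' : V ⊗[ℂ] V) :
    expTwist ρ u (B + B') = expTwist ρ u B * expTwist ρ u B' := by
  rw [expTwist, map_add]
  exact nilExp_add (hu.commute_twistIncl B B') (hu.isNilpotent_twistIncl B)
    (hu.isNilpotent_twistIncl B')

theorem semiconjBy_expTwist (hu : IsParityElement ρ u) (g : G) (B : V ⊗[ℂ] V) :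
    SemiconjBy (ofG ρ g ⊗ₜ[ℂ] ofG ρ g) (expTwist ρ u B)
      (expTwist ρ u (TensorProduct.map (ρ g) (ρ g) B)) :=
  semiconjBy_nilExp (semiconjBy_twistIncl hu g B) (hu.isNilpotent_twistIncl _) (hu.isNilpotent_twistIncl _)

/-- The coproduct of `A(G, V, u, B)` as an algebra homomorphism. -/
def comulHom (hu : IsParityElement ρ u) (B : V ⊗[ℂ] V) :
    SupergroupAlgebra ρ →ₐ[ℂ] SupergroupAlgebra ρ ⊗[ℂ] SupergroupAlgebra ρ :=
  AlgHom.ofLinearMap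
    (LinearMap.mulLeft ℂ (expTwist ρ u (-B)) ∘ₗ LinearMap.mulRight ℂ (expTwist ρ u B) ∘ₗ
      (baseComul hu).toLinearMap)
    (by
      change expTwist ρ u (-B) * (baseComul hu 1 * expTwist ρ u B) = 1
      rw [map_one, one_mul, expTwist_neg_mul hu])
    (fun x y => by
      change expTwist ρ u (-B) * (baseComul hu (x * y) * expTwist ρ u B)
        = (expTwist ρ u (-B) * (baseComul hu x * expTwist ρ u B))
          * (expTwist ρ u (-B) * (baseComul hu y * expTwist ρ u B))
      rw [map_mul]
      simp only [mul_assoc]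
      rw [← mul_assoc (expTwist ρ u B) (expTwist ρ u (-B)), expTwist_mul_neg hu, one_mul])

theorem comulHom_apply (hu : IsParityElement ρ u) (B : V ⊗[ℂ] V) (x : SupergroupAlgebra ρ) :
    comulHom hu B x = expTwist ρ u (-B) * (baseComul hu x * expTwist ρ u B) := rfl

/-- Moving `g ⊗ g` past `e^B` turns `B` into `gB`, and the commuting exponents `gB` and `-B` add up.
Only the class of `B` modulo invariants matters here. -/
theorem comulHom_ofG (hu : IsParityElement ρ u) (B : V ⊗[ℂ] V) (g : G) :
    comulHom hu B (ofG ρ g)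
      = expTwist ρ u (TensorProduct.map (ρ g) (ρ g) B - B) * (ofG ρ g ⊗ₜ ofG ρ g) := by
  rw [comulHom_apply, baseComul_ofG, (semiconjBy_expTwist hu g B).eq, ← mul_assoc,
    ← expTwist_add hu, neg_add_eq_sub]

theorem comulHom_ofG_parity (hu : IsParityElement ρ u) (B : V ⊗[ℂ] V) :
    comulHom hu B (ofG ρ u) = ofG ρ u ⊗ₜ ofG ρ u := by
  rw [comulHom_ofG, hu.map_apply, sub_self, expTwist, map_zero, nilExp_zero, one_mul]

theorem comulHom_ofV (hu : IsParityElement ρ u) (B : V ⊗[ℂ] V) (v : V) :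
    comulHom hu B (ofV ρ v) = ofV ρ v ⊗ₜ 1 + ofG ρ u ⊗ₜ ofV ρ v := by
  have h : SemiconjBy (ofV ρ v ⊗ₜ 1 + ofG ρ u ⊗ₜ ofV ρ v) (expTwist ρ u B) (expTwist ρ u B) :=
    semiconjBy_nilExp (commute_twistIncl_ofV hu B v).symm (hu.isNilpotent_twistIncl B)
      (hu.isNilpotent_twistIncl B)
  rw [comulHom_apply, baseComul_ofV, h.eq, ← mul_assoc, expTwist_neg_mul hu, one_mul]

theorem bosonize_twistedComul (hu : IsParityElement ρ u) (B : V ⊗[ℂ] V)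
    (x : SupergroupAlgebra ρ) : bosonize hu (twistedComul ρ B x) = comulHom hu B x := by
  change bosonize hu (expTensor ρ (-B) * (superComul ρ x * expTensor ρ B)) = _
  rw [map_mul, map_mul, bosonize_expTensor, bosonize_expTensor]
  rfl

/-- This replaces the given formula, with its parts and signs, by a manifestly multiplicative
coproduct. The sign becomes conjugation by `u`, and `u` is grouplike even after the twist since it
fixes `V ⊗ V`. -/
theorem modifiedComul_eq (hu : IsParityElement ρ u) (B : V ⊗[ℂ] V) (x : SupergroupAlgebra ρ) :
    modifiedComul ρ u B x = comulHom hu B x := by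
  change rightPart ρ 0 (twistedComul ρ B x)
    - (ofG ρ u ⊗ₜ 1) * rightPart ρ 1 (twistedComul ρ B (parityInvol ρ x)) = _
  rw [rightPart_zero_eq hu, rightPart_one_eq hu, bosonize_twistedComul, bosonize_twistedComul,
    hu.parityInvol_eq, map_mul (comulHom hu B), map_mul (comulHom hu B), comulHom_ofG_parity, proj_one_conj_add_proj_zero hu]

end Comul

/-! ### `A(G, V, u, B)` is a Hopf algebra -/

section Coalgebra

variable {G V : Type*} [Group G] [AddCommGroup V] [Module ℂ V] {ρ : Representation ℂ G V} {u : G}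

theorem conj_nilExp_add {R : Type*} [Ring R] [Algebra ℂ R] {p q : R} (y : R) (h : Commute p q)
    (hp : IsNilpotent p) (hq : IsNilpotent q) :
    nilExp (-p) * (nilExp (-q) * (y * nilExp q) * nilExp p)
      = nilExp (-(p + q)) * (y * nilExp (p + q)) := by
  rw [neg_add, nilExp_add h.neg_left.neg_right hp.neg hq.neg, add_comm p q,
    nilExp_add h.symm hq hp]
  simp only [mul_assoc]

/-- The tensor cube `A ⊗ (A ⊗ A)` of `A = ℂ[G ⋉ V]`. -/
def TripleTensor (ρ : Representation ℂ G V) : Type _ :=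
  SupergroupAlgebra ρ ⊗[ℂ] (SupergroupAlgebra ρ ⊗[ℂ] SupergroupAlgebra ρ)

instance : Ring (TripleTensor ρ) :=
  inferInstanceAs (Ring (SupergroupAlgebra ρ ⊗[ℂ] (SupergroupAlgebra ρ ⊗[ℂ] SupergroupAlgebra ρ)))

instance : Algebra ℂ (TripleTensor ρ) :=
  inferInstanceAs (Algebra ℂ
    (SupergroupAlgebra ρ ⊗[ℂ] (SupergroupAlgebra ρ ⊗[ℂ] SupergroupAlgebra ρ)))

/-- The pure tensor `x ⊗ (y ⊗ z)`. -/
def tmul₃ (x y z : SupergroupAlgebra ρ) : TripleTensor ρ := (x ⊗ₜ[ℂ] (y ⊗ₜ[ℂ] z) :)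

theorem tmul₃_mul (x y z x' y' z' : SupergroupAlgebra ρ) :
    tmul₃ x y z * tmul₃ x' y' z' = tmul₃ (x * x') (y * y') (z * z') := by
  have h : (x ⊗ₜ[ℂ] (y ⊗ₜ[ℂ] z)) * (x' ⊗ₜ[ℂ] (y' ⊗ₜ[ℂ] z'))
      = (x * x') ⊗ₜ[ℂ] ((y * y') ⊗ₜ[ℂ] (z * z')) := by
    rw [Algebra.TensorProduct.tmul_mul_tmul, Algebra.TensorProduct.tmul_mul_tmul]
  exact h

theorem tmul₃_neg_left (x y z : SupergroupAlgebra ρ) : tmul₃ (-x) y z = -tmul₃ x y z :=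
  TensorProduct.neg_tmul ..

theorem tmul₃_neg_mid (x y z : SupergroupAlgebra ρ) : tmul₃ x (-y) z = -tmul₃ x y z := by
  have h : x ⊗ₜ[ℂ] ((-y) ⊗ₜ[ℂ] z) = -(x ⊗ₜ[ℂ] (y ⊗ₜ[ℂ] z)) := by
    rw [TensorProduct.neg_tmul, TensorProduct.tmul_neg]
  exact h

theorem tmul₃_neg_right (x y z : SupergroupAlgebra ρ) : tmul₃ x y (-z) = -tmul₃ x y z := by
  have h : x ⊗ₜ[ℂ] (y ⊗ₜ[ℂ] (-z)) = -(x ⊗ₜ[ℂ] (y ⊗ₜ[ℂ] z)) := by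
    rw [TensorProduct.tmul_neg, TensorProduct.tmul_neg]
  exact h

/-- The inclusion `x ↦ x ⊗ 1` of the tensor square in the tensor cube. -/
def tripleLeft (ρ : Representation ℂ G V) :
    SupergroupAlgebra ρ ⊗[ℂ] SupergroupAlgebra ρ →ₐ[ℂ] TripleTensor ρ :=
  (Algebra.TensorProduct.map (AlgHom.id ℂ _) Algebra.TensorProduct.includeLeft :
    SupergroupAlgebra ρ ⊗[ℂ] SupergroupAlgebra ρ →ₐ[ℂ]
      SupergroupAlgebra ρ ⊗[ℂ] (SupergroupAlgebra ρ ⊗[ℂ] SupergroupAlgebra ρ))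

/-- The inclusion `x ↦ 1 ⊗ x` of the tensor square in the tensor cube. -/
def tripleRight (ρ : Representation ℂ G V) :
    SupergroupAlgebra ρ ⊗[ℂ] SupergroupAlgebra ρ →ₐ[ℂ] TripleTensor ρ :=
  (Algebra.TensorProduct.includeRight : SupergroupAlgebra ρ ⊗[ℂ] SupergroupAlgebra ρ →ₐ[ℂ]
    SupergroupAlgebra ρ ⊗[ℂ] (SupergroupAlgebra ρ ⊗[ℂ] SupergroupAlgebra ρ))

theorem tripleLeft_tmul (x y : SupergroupAlgebra ρ) : tripleLeft ρ (x ⊗ₜ y) = tmul₃ x y 1 := rfl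

theorem tripleRight_tmul (x y : SupergroupAlgebra ρ) : tripleRight ρ (x ⊗ₜ y) = tmul₃ 1 x y := rfl

/-- The linear map `v ⊗ w ↦ v u ⊗ w ⊗ 1`. -/
def twistIncl₁₂ (ρ : Representation ℂ G V) (u : G) : V ⊗[ℂ] V →ₗ[ℂ] TripleTensor ρ :=
  (tripleLeft ρ).toLinearMap ∘ₗ twistIncl ρ u

/-- The linear map `v ⊗ w ↦ 1 ⊗ v u ⊗ w`. -/
def twistIncl₂₃ (ρ : Representation ℂ G V) (u : G) : V ⊗[ℂ] V →ₗ[ℂ] TripleTensor ρ :=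
  (tripleRight ρ).toLinearMap ∘ₗ twistIncl ρ u

/-- The linear map `v ⊗ w ↦ v u ⊗ u ⊗ w`. -/
def twistIncl₁₃ (ρ : Representation ℂ G V) (u : G) : V ⊗[ℂ] V →ₗ[ℂ] TripleTensor ρ :=
  ((TensorProduct.mk ℂ _ _ (ofG ρ u)).lTensor _ ∘ₗ twistIncl ρ u :
    V ⊗[ℂ] V →ₗ[ℂ] SupergroupAlgebra ρ ⊗[ℂ] (SupergroupAlgebra ρ ⊗[ℂ] SupergroupAlgebra ρ))

theorem twistIncl₁₂_tmul (v w : V) :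
    twistIncl₁₂ ρ u (v ⊗ₜ w) = tmul₃ (ofV ρ v * ofG ρ u) (ofV ρ w) 1 := rfl

theorem twistIncl₂₃_tmul (v w : V) :
    twistIncl₂₃ ρ u (v ⊗ₜ w) = tmul₃ 1 (ofV ρ v * ofG ρ u) (ofV ρ w) := rfl

theorem twistIncl₁₃_tmul (v w : V) :
    twistIncl₁₃ ρ u (v ⊗ₜ w) = tmul₃ (ofV ρ v * ofG ρ u) (ofG ρ u) (ofV ρ w) := rfl

theorem commute_of_tmul {R : Type*} [Ring R] [Algebra ℂ R] (f f' : V ⊗[ℂ] V →ₗ[ℂ] R)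
    (h : ∀ v w v' w', Commute (f (v ⊗ₜ w)) (f' (v' ⊗ₜ w'))) (B B' : V ⊗[ℂ] V) :
    Commute (f B) (f' B') := by
  induction B using TensorProduct.induction_on with
  | zero => rw [map_zero]; exact Commute.zero_left _
  | add x y hx hy => rw [map_add]; exact hx.add_left hy
  | tmul v w =>
    induction B' using TensorProduct.induction_on with
    | zero => rw [map_zero]; exact Commute.zero_right _
    | add x y hx hy => rw [map_add]; exact hx.add_right hy
    | tmul v' w' => exact h v w v' w'

/-- In this pair, as in the next two, exactly two anticommutations occur. The middle factor `u` of
`twistIncl₁₃` supplies one of them. -/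
theorem commute_twistIncl₁₂_twistIncl₁₃ (hu : IsParityElement ρ u) (B B' : V ⊗[ℂ] V) :
    Commute (twistIncl₁₂ ρ u B) (twistIncl₁₃ ρ u B') := by
  refine commute_of_tmul _ _ (fun v w v' w' => ?_) B B'
  rw [twistIncl₁₂_tmul, twistIncl₁₃_tmul]
  unfold Commute SemiconjBy
  rw [tmul₃_mul, tmul₃_mul, hu.ofV_u_mul_ofV_u, hu.ofV_u_mul_ofV_u, ofV_mul_ofV_comm ρ v v',
    hu.ofG_mul_ofV, mul_one, one_mul, tmul₃_neg_mid, neg_neg, tmul₃_neg_left, neg_neg]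

theorem commute_twistIncl₁₂_twistIncl₂₃ (hu : IsParityElement ρ u) (B B' : V ⊗[ℂ] V) :
    Commute (twistIncl₁₂ ρ u B) (twistIncl₂₃ ρ u B') := by
  refine commute_of_tmul _ _ (fun v w v' w' => ?_) B B'
  rw [twistIncl₁₂_tmul, twistIncl₂₃_tmul]
  unfold Commute SemiconjBy
  rw [tmul₃_mul, tmul₃_mul, mul_one, one_mul, mul_one, one_mul, mul_assoc, hu.ofG_mul_ofV,
    mul_neg, ← mul_assoc, ← mul_assoc, ofV_mul_ofV_comm ρ w v', neg_mul]

theorem commute_twistIncl₁₃_twistIncl₂₃ (hu : IsParityElement ρ u) (B B' : V ⊗[ℂ] V) :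
    Commute (twistIncl₁₃ ρ u B) (twistIncl₂₃ ρ u B') := by
  refine commute_of_tmul _ _ (fun v w v' w' => ?_) B B'
  rw [twistIncl₁₃_tmul, twistIncl₂₃_tmul]
  unfold Commute SemiconjBy
  rw [tmul₃_mul, tmul₃_mul, mul_one, one_mul, ← mul_assoc, hu.ofG_mul_ofV,
    ofV_mul_ofV_comm ρ w w', neg_mul, tmul₃_neg_mid, tmul₃_neg_right, neg_neg]

/-- `x ↦ 1 ⊗ 1 ⊗ x`. -/
def tripleLast (ρ : Representation ℂ G V) : SupergroupAlgebra ρ →ₐ[ℂ] TripleTensor ρ :=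
  (tripleRight ρ).comp Algebra.TensorProduct.includeRight

/-- `x ↦ x ⊗ 1 ⊗ 1`. -/
def tripleFirst (ρ : Representation ℂ G V) : SupergroupAlgebra ρ →ₐ[ℂ] TripleTensor ρ :=
  (tripleLeft ρ).comp Algebra.TensorProduct.includeLeft

theorem tripleLast_apply (x : SupergroupAlgebra ρ) : tripleLast ρ x = tmul₃ 1 1 x := rfl

theorem tripleFirst_apply (x : SupergroupAlgebra ρ) : tripleFirst ρ x = tmul₃ x 1 1 := rfl

theorem commute_tripleLeft_tripleLast (t : SupergroupAlgebra ρ ⊗[ℂ] SupergroupAlgebra ρ)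
    (x : SupergroupAlgebra ρ) : Commute (tripleLeft ρ t) (tripleLast ρ x) := by
  induction t using TensorProduct.induction_on with
  | zero => rw [map_zero]; exact Commute.zero_left _
  | add s t hs ht => rw [map_add]; exact hs.add_left ht
  | tmul a b =>
    rw [tripleLeft_tmul, tripleLast_apply]
    unfold Commute SemiconjBy
    rw [tmul₃_mul, tmul₃_mul, mul_one, mul_one, one_mul, one_mul, mul_one, one_mul]

theorem commute_tripleFirst_tripleRight (t : SupergroupAlgebra ρ ⊗[ℂ] SupergroupAlgebra ρ)
    (x : SupergroupAlgebra ρ) : Commute (tripleFirst ρ x) (tripleRight ρ t) := by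
  induction t using TensorProduct.induction_on with
  | zero => rw [map_zero]; exact Commute.zero_right _
  | add s t hs ht => rw [map_add]; exact hs.add_right ht
  | tmul a b =>
    rw [tripleRight_tmul, tripleFirst_apply]
    unfold Commute SemiconjBy
    rw [tmul₃_mul, tmul₃_mul, mul_one, mul_one, one_mul, one_mul, mul_one, one_mul]

variable [FiniteDimensional ℂ V]

/-- `Δ ⊗ 1`, with values in `A ⊗ (A ⊗ A)`. -/
def comulLeft (hu : IsParityElement ρ u) (B : V ⊗[ℂ] V) :
    SupergroupAlgebra ρ ⊗[ℂ] SupergroupAlgebra ρ →ₐ[ℂ] TripleTensor ρ :=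
  ((Algebra.TensorProduct.assoc ℂ ℂ ℂ _ _ _).toAlgHom.comp
    (Algebra.TensorProduct.map (comulHom hu B) (AlgHom.id ℂ _)) :
      SupergroupAlgebra ρ ⊗[ℂ] SupergroupAlgebra ρ →ₐ[ℂ]
        SupergroupAlgebra ρ ⊗[ℂ] (SupergroupAlgebra ρ ⊗[ℂ] SupergroupAlgebra ρ))

/-- `1 ⊗ Δ`. -/
def comulRight (hu : IsParityElement ρ u) (B : V ⊗[ℂ] V) :
    SupergroupAlgebra ρ ⊗[ℂ] SupergroupAlgebra ρ →ₐ[ℂ] TripleTensor ρ :=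
  (Algebra.TensorProduct.map (AlgHom.id ℂ _) (comulHom hu B) :
    SupergroupAlgebra ρ ⊗[ℂ] SupergroupAlgebra ρ →ₐ[ℂ]
      SupergroupAlgebra ρ ⊗[ℂ] (SupergroupAlgebra ρ ⊗[ℂ] SupergroupAlgebra ρ))

theorem comulLeft_tmul (hu : IsParityElement ρ u) (B : V ⊗[ℂ] V) (x y : SupergroupAlgebra ρ) :
    comulLeft hu B (x ⊗ₜ y) = tripleLeft ρ (comulHom hu B x) * tripleLast ρ y := by
  change (TensorProduct.assoc ℂ _ _ _ (comulHom hu B x ⊗ₜ[ℂ] y) : TripleTensor ρ) = _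
  induction comulHom hu B x using TensorProduct.induction_on with
  | zero =>
    rw [map_zero, zero_mul, TensorProduct.zero_tmul]
    exact map_zero (TensorProduct.assoc ℂ _ _ _)
  | add s t hs ht =>
    rw [map_add, add_mul, ← hs, ← ht, TensorProduct.add_tmul]
    exact map_add (TensorProduct.assoc ℂ _ _ _) _ _
  | tmul a b =>
    rw [tripleLeft_tmul, tripleLast_apply, tmul₃_mul, mul_one, mul_one, one_mul]
    rfl

theorem comulRight_tmul (hu : IsParityElement ρ u) (B : V ⊗[ℂ] V) (x y : SupergroupAlgebra ρ) :
    comulRight hu B (x ⊗ₜ y) = tripleFirst ρ x * tripleRight ρ (comulHom hu B y) := by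
  have h : x ⊗ₜ[ℂ] comulHom hu B y
      = (x ⊗ₜ[ℂ] (1 ⊗ₜ[ℂ] 1)) * (1 ⊗ₜ[ℂ] comulHom hu B y) := by
    rw [← Algebra.TensorProduct.one_def, Algebra.TensorProduct.tmul_mul_tmul, one_mul, mul_one]
  exact h

/-- Since `u² = 1`, the coproduct of `v u` is `v u ⊗ u + 1 ⊗ v u`. The factor `u` in the middle of
`twistIncl₁₃` comes from here. -/
theorem comulLeft_twistIncl (hu : IsParityElement ρ u) (B B' : V ⊗[ℂ] V) :
    comulLeft hu B (twistIncl ρ u B') = twistIncl₁₃ ρ u B' + twistIncl₂₃ ρ u B' := by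
  induction B' using TensorProduct.induction_on with
  | zero => simp
  | add x y hx hy => simp only [map_add, hx, hy]; abel
  | tmul v w =>
    rw [twistIncl_tmul, comulLeft_tmul, map_mul, comulHom_ofV, comulHom_ofG_parity, map_mul,
      map_add, tripleLeft_tmul, tripleLeft_tmul, tripleLeft_tmul, tripleLast_apply, add_mul,
      add_mul, twistIncl₁₃_tmul, twistIncl₂₃_tmul]
    simp only [tmul₃_mul, mul_one, one_mul, hu.ofG_mul_self]

theorem comulRight_twistIncl (hu : IsParityElement ρ u) (B B' : V ⊗[ℂ] V) :
    comulRight hu B (twistIncl ρ u B') = twistIncl₁₂ ρ u B' + twistIncl₁₃ ρ u B' := by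
  induction B' using TensorProduct.induction_on with
  | zero => simp
  | add x y hx hy => simp only [map_add, hx, hy]; abel
  | tmul v w =>
    rw [twistIncl_tmul, comulRight_tmul, comulHom_ofV, map_add, tripleRight_tmul,
      tripleRight_tmul, tripleFirst_apply, mul_add, twistIncl₁₂_tmul, twistIncl₁₃_tmul]
    simp only [tmul₃_mul, mul_one, one_mul]

theorem comulLeft_expTwist (hu : IsParityElement ρ u) (B B' : V ⊗[ℂ] V) :
    comulLeft hu B (expTwist ρ u B') = nilExp (twistIncl₁₃ ρ u B' + twistIncl₂₃ ρ u B') := by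
  rw [expTwist, map_nilExp _ (hu.isNilpotent_twistIncl B'), comulLeft_twistIncl]

theorem comulRight_expTwist (hu : IsParityElement ρ u) (B B' : V ⊗[ℂ] V) :
    comulRight hu B (expTwist ρ u B') = nilExp (twistIncl₁₂ ρ u B' + twistIncl₁₃ ρ u B') := by
  rw [expTwist, map_nilExp _ (hu.isNilpotent_twistIncl B'), comulRight_twistIncl]

theorem tripleLeft_expTwist (hu : IsParityElement ρ u) (B : V ⊗[ℂ] V) :
    tripleLeft ρ (expTwist ρ u B) = nilExp (twistIncl₁₂ ρ u B) :=
  map_nilExp _ (hu.isNilpotent_twistIncl B)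

theorem tripleRight_expTwist (hu : IsParityElement ρ u) (B : V ⊗[ℂ] V) :
    tripleRight ρ (expTwist ρ u B) = nilExp (twistIncl₂₃ ρ u B) :=
  map_nilExp _ (hu.isNilpotent_twistIncl B)

theorem comulLeft_ofG (hu : IsParityElement ρ u) (B : V ⊗[ℂ] V) (g : G) :
    comulLeft hu B (ofG ρ g ⊗ₜ ofG ρ g) = nilExp (-twistIncl₁₂ ρ u B)
      * (tmul₃ (ofG ρ g) (ofG ρ g) (ofG ρ g) * nilExp (twistIncl₁₂ ρ u B)) := by
  rw [comulLeft_tmul, comulHom_apply, baseComul_ofG, map_mul, map_mul, mul_assoc, mul_assoc,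
    (commute_tripleLeft_tripleLast _ _).eq, ← mul_assoc (tripleLeft ρ (_ ⊗ₜ[ℂ] _)),
    tripleLeft_tmul, tripleLast_apply, tmul₃_mul, mul_one, one_mul,
    tripleLeft_expTwist hu, tripleLeft_expTwist hu, map_neg]

theorem comulRight_ofG (hu : IsParityElement ρ u) (B : V ⊗[ℂ] V) (g : G) :
    comulRight hu B (ofG ρ g ⊗ₜ ofG ρ g) = nilExp (-twistIncl₂₃ ρ u B)
      * (tmul₃ (ofG ρ g) (ofG ρ g) (ofG ρ g) * nilExp (twistIncl₂₃ ρ u B)) := by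
  rw [comulRight_tmul, comulHom_apply, baseComul_ofG, map_mul, map_mul, ← mul_assoc,
    (commute_tripleFirst_tripleRight _ _).eq, mul_assoc, ← mul_assoc (tripleFirst ρ _),
    tripleRight_tmul, tripleFirst_apply, tmul₃_mul, mul_one, one_mul,
    tripleRight_expTwist hu, tripleRight_expTwist hu, map_neg]

/-- On `g`, one side conjugates `g ⊗ g ⊗ g` by `e^B₁₂` and then by `e^(B₁₃ + B₂₃)`, the other by
`e^B₂₃` and then by `e^(B₁₂ + B₁₃)`. All exponents commute, so both conjugations are by `e^(B₁₂ +
B₁₃ + B₂₃)`. On `V` the twist is invisible. -/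
theorem comulHom_coassoc (hu : IsParityElement ρ u) (B : V ⊗[ℂ] V) (x : SupergroupAlgebra ρ) :
    comulLeft hu B (comulHom hu B x) = comulRight hu B (comulHom hu B x) := by
  refine DFunLike.congr_fun (supergroup_algHom_ext ρ (f := (comulLeft hu B).comp (comulHom hu B))
    (f' := (comulRight hu B).comp (comulHom hu B)) (fun g => ?_) (fun v => ?_)) x
  · have h12 : IsNilpotent (twistIncl₁₂ ρ u B) :=
      (hu.isNilpotent_twistIncl B).map (tripleLeft ρ)
    have h23 : IsNilpotent (twistIncl₂₃ ρ u B) :=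
      (hu.isNilpotent_twistIncl B).map (tripleRight ρ)
    -- The sums of two exponents are images of `B̂` under algebra homomorphisms, so their nilpotency
    -- is automatic.
    have hL := (hu.isNilpotent_twistIncl B).map (comulLeft hu B)
    have hR := (hu.isNilpotent_twistIncl B).map (comulRight hu B)
    rw [comulLeft_twistIncl] at hL
    rw [comulRight_twistIncl] at hR
    have c1 := commute_twistIncl₁₂_twistIncl₁₃ hu B B
    have c2 := commute_twistIncl₁₂_twistIncl₂₃ hu B B
    have c3 := commute_twistIncl₁₃_twistIncl₂₃ hu B B
    rw [AlgHom.comp_apply, AlgHom.comp_apply, comulHom_apply, baseComul_ofG, map_mul, map_mul,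
      map_mul, map_mul, comulLeft_expTwist, comulLeft_expTwist, comulRight_expTwist,
      comulRight_expTwist, comulLeft_ofG, comulRight_ofG, map_neg, map_neg, map_neg, ← neg_add,
      ← neg_add, conj_nilExp_add _ (c1.add_right c2).symm hL h12,
      conj_nilExp_add _ (c2.add_left c3) hR h23,
      add_rotate (twistIncl₁₂ ρ u B) (twistIncl₁₃ ρ u B) (twistIncl₂₃ ρ u B)]
  · rw [AlgHom.comp_apply, AlgHom.comp_apply, comulHom_ofV, map_add, map_add, comulLeft_tmul,
      comulLeft_tmul, comulRight_tmul, comulRight_tmul, comulHom_ofV, comulHom_ofG_parity,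
      map_one, map_one, map_one, map_add, map_add, tripleLeft_tmul, tripleLeft_tmul,
      tripleLeft_tmul, tripleRight_tmul, tripleRight_tmul, tripleFirst_apply, tripleFirst_apply,
      tripleLast_apply]
    simp only [mul_add, tmul₃_mul, mul_one, one_mul, add_assoc]

theorem counit_left (hu : IsParityElement ρ u) (B : V ⊗[ℂ] V) (x : SupergroupAlgebra ρ) :
    Algebra.TensorProduct.map (superCounit ρ) (AlgHom.id ℂ _) (comulHom hu B x) = 1 ⊗ₜ x := by
  refine DFunLike.congr_fun (supergroup_algHom_ext ρ
    (f := (Algebra.TensorProduct.map (superCounit ρ) (AlgHom.id ℂ _)).comp (comulHom hu B))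
    (f' := Algebra.TensorProduct.includeRight) (fun g => ?_) (fun v => ?_)) x
  · have key : ∀ B' : V ⊗[ℂ] V, Algebra.TensorProduct.map (superCounit ρ)
        (AlgHom.id ℂ (SupergroupAlgebra ρ)) (twistIncl ρ u B') = 0 := fun B' => by
      induction B' using TensorProduct.induction_on with
      | zero => simp
      | add x y hx hy => rw [map_add, map_add, hx, hy, add_zero]
      | tmul v w =>
        rw [twistIncl_tmul, Algebra.TensorProduct.map_tmul, map_mul, superCounit_ofV, zero_mul,
          TensorProduct.zero_tmul]
    rw [AlgHom.comp_apply, comulHom_ofG, map_mul, expTwist,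
      map_nilExp _ (hu.isNilpotent_twistIncl _), key, nilExp_zero, one_mul,
      Algebra.TensorProduct.map_tmul, superCounit_ofG]
    rfl
  · rw [AlgHom.comp_apply, comulHom_ofV, map_add, Algebra.TensorProduct.map_tmul,
      Algebra.TensorProduct.map_tmul, superCounit_ofG, superCounit_ofV, TensorProduct.zero_tmul,
      zero_add]
    rfl

theorem counit_right (hu : IsParityElement ρ u) (B : V ⊗[ℂ] V) (x : SupergroupAlgebra ρ) :
    Algebra.TensorProduct.map (AlgHom.id ℂ _) (superCounit ρ) (comulHom hu B x) = x ⊗ₜ 1 := by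
  refine DFunLike.congr_fun (supergroup_algHom_ext ρ
    (f := (Algebra.TensorProduct.map (AlgHom.id ℂ _) (superCounit ρ)).comp (comulHom hu B))
    (f' := Algebra.TensorProduct.includeLeft) (fun g => ?_) (fun v => ?_)) x
  · have key : ∀ B' : V ⊗[ℂ] V, Algebra.TensorProduct.map
        (AlgHom.id ℂ (SupergroupAlgebra ρ)) (superCounit ρ) (twistIncl ρ u B') = 0 := fun B' => by
      induction B' using TensorProduct.induction_on with
      | zero => simp
      | add x y hx hy => rw [map_add, map_add, hx, hy, add_zero]
      | tmul v w =>
        rw [twistIncl_tmul, Algebra.TensorProduct.map_tmul, superCounit_ofV,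
          TensorProduct.tmul_zero]
    rw [AlgHom.comp_apply, comulHom_ofG, map_mul, expTwist,
      map_nilExp _ (hu.isNilpotent_twistIncl _), key, nilExp_zero, one_mul,
      Algebra.TensorProduct.map_tmul, superCounit_ofG]
    rfl
  · rw [AlgHom.comp_apply, comulHom_ofV, map_add, Algebra.TensorProduct.map_tmul,
      Algebra.TensorProduct.map_tmul, superCounit_ofV, TensorProduct.tmul_zero, map_one,
      add_zero]
    rfl

end Coalgebra

/-! ### The antipode -/

section Antipode

variable {G V : Type*} [Group G] [AddCommGroup V] [Module ℂ V] {ρ : Representation ℂ G V} {u : G}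

open MulOpposite

/-- The antipode `g ↦ g⁻¹`, `v ↦ -u v`, as an algebra homomorphism to the opposite algebra. -/
def antipodeHom (hu : IsParityElement ρ u) : SupergroupAlgebra ρ →ₐ[ℂ] (SupergroupAlgebra ρ)ᵐᵒᵖ :=
  supergroupLift ρ
    ((opLinearEquiv ℂ).toLinearMap ∘ₗ (-(LinearMap.mulLeft ℂ (ofG ρ u) ∘ₗ ofV ρ)))
    { toFun := fun g => op (ofG ρ g⁻¹)
      map_one' := by rw [inv_one, map_one, op_one]
      map_mul' := fun g h => by rw [mul_inv_rev, map_mul, op_mul] }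
    (fun v => by
      change op (-(ofG ρ u * ofV ρ v)) * op (-(ofG ρ u * ofV ρ v)) = 0
      rw [← op_mul, neg_mul_neg, hu.ofG_mul_ofV, neg_mul_neg, hu.ofV_u_mul_ofV_u, ofV_mul_ofV,
        neg_zero, op_zero])
    (fun g v => by
      change op (-(ofG ρ u * ofV ρ (ρ g v))) * op (ofG ρ g⁻¹)
        = op (ofG ρ g⁻¹) * op (-(ofG ρ u * ofV ρ v))
      rw [← op_mul, ← op_mul, mul_neg, neg_mul, ← mul_assoc, ← hu.ofG_mul_ofG, mul_assoc,
        mul_assoc, ofG_mul_ofV, ← Module.End.mul_apply, ← map_mul, inv_mul_cancel, map_one]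
      rfl)

/-- The antipode of `A(G, V, u, B)`. -/
def antipode (hu : IsParityElement ρ u) : SupergroupAlgebra ρ →ₗ[ℂ] SupergroupAlgebra ρ :=
  (opLinearEquiv ℂ).symm.toLinearMap ∘ₗ (antipodeHom hu).toLinearMap

theorem antipode_mul (hu : IsParityElement ρ u) (x y : SupergroupAlgebra ρ) :
    antipode hu (x * y) = antipode hu y * antipode hu x := by
  change unop (antipodeHom hu (x * y)) = _
  rw [map_mul, unop_mul]
  rfl

theorem antipode_one (hu : IsParityElement ρ u) : antipode hu 1 = 1 := by
  change unop (antipodeHom hu 1) = _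
  rw [map_one, unop_one]

theorem antipode_ofG (hu : IsParityElement ρ u) (g : G) :
    antipode hu (ofG ρ g) = ofG ρ g⁻¹ := by
  change unop (antipodeHom hu (ofG ρ g)) = _
  rw [antipodeHom, supergroupLift_ofG]
  rfl

theorem antipode_ofV (hu : IsParityElement ρ u) (v : V) :
    antipode hu (ofV ρ v) = -(ofG ρ u * ofV ρ v) := by
  change unop (antipodeHom hu (ofV ρ v)) = _
  rw [antipodeHom, supergroupLift_ofV]
  rfl

theorem antipode_ofG_parity (hu : IsParityElement ρ u) :
    antipode hu (ofG ρ u) = ofG ρ u := by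
  rw [antipode_ofG, inv_eq_of_mul_eq_one_left hu.mul_self]

/-- The linear map `x ⊗ y ↦ S(x) y`. -/
def antipodeLeft (hu : IsParityElement ρ u) :
    SupergroupAlgebra ρ ⊗[ℂ] SupergroupAlgebra ρ →ₗ[ℂ] SupergroupAlgebra ρ :=
  LinearMap.mul' ℂ _ ∘ₗ (antipode hu).rTensor _

/-- The linear map `x ⊗ y ↦ x S(y)`. -/
def antipodeRight (hu : IsParityElement ρ u) :
    SupergroupAlgebra ρ ⊗[ℂ] SupergroupAlgebra ρ →ₗ[ℂ] SupergroupAlgebra ρ :=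
  LinearMap.mul' ℂ _ ∘ₗ (antipode hu).lTensor _

theorem antipodeLeft_tmul (hu : IsParityElement ρ u) (x y : SupergroupAlgebra ρ) :
    antipodeLeft hu (x ⊗ₜ y) = antipode hu x * y := rfl

theorem antipodeRight_tmul (hu : IsParityElement ρ u) (x y : SupergroupAlgebra ρ) :
    antipodeRight hu (x ⊗ₜ y) = x * antipode hu y := rfl

theorem antipodeLeft_mul_tmul (hu : IsParityElement ρ u)
    (t : SupergroupAlgebra ρ ⊗[ℂ] SupergroupAlgebra ρ) (x y : SupergroupAlgebra ρ) :
    antipodeLeft hu (t * (x ⊗ₜ y)) = antipode hu x * antipodeLeft hu t * y := by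
  induction t using TensorProduct.induction_on with
  | zero => simp
  | add s t hs ht => rw [add_mul, map_add, hs, ht, map_add, mul_add, add_mul]
  | tmul a b =>
    rw [Algebra.TensorProduct.tmul_mul_tmul, antipodeLeft_tmul, antipodeLeft_tmul, antipode_mul]
    simp only [mul_assoc]

theorem antipodeRight_tmul_mul (hu : IsParityElement ρ u)
    (t : SupergroupAlgebra ρ ⊗[ℂ] SupergroupAlgebra ρ) (x y : SupergroupAlgebra ρ) :
    antipodeRight hu ((x ⊗ₜ y) * t) = x * antipodeRight hu t * antipode hu y := by
  induction t using TensorProduct.induction_on with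
  | zero => simp
  | add s t hs ht => rw [mul_add, map_add, hs, ht, map_add, mul_add, add_mul]
  | tmul a b =>
    rw [Algebra.TensorProduct.tmul_mul_tmul, antipodeRight_tmul, antipodeRight_tmul, antipode_mul]
    simp only [mul_assoc]

/-- The antipode reverses products, so the contraction of `t` ends up in the middle, between `S(a)`
and `b`; being scalar, it can be pulled out. On the right-hand contraction the roles of the two
factors are exchanged. -/
theorem antipodeLeft_mul (hu : IsParityElement ρ u)
    {t : SupergroupAlgebra ρ ⊗[ℂ] SupergroupAlgebra ρ} {c : ℂ}
    (ht : antipodeLeft hu t = algebraMap ℂ _ c)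
    (s : SupergroupAlgebra ρ ⊗[ℂ] SupergroupAlgebra ρ) :
    antipodeLeft hu (t * s) = c • antipodeLeft hu s := by
  induction s using TensorProduct.induction_on with
  | zero => simp
  | add x y hx hy => rw [mul_add, map_add, hx, hy, map_add, smul_add]
  | tmul a b =>
    rw [antipodeLeft_mul_tmul, ht, ← Algebra.commutes, mul_assoc, ← Algebra.smul_def,
      antipodeLeft_tmul]

theorem antipodeRight_mul (hu : IsParityElement ρ u)
    {s : SupergroupAlgebra ρ ⊗[ℂ] SupergroupAlgebra ρ} {c : ℂ}
    (hs : antipodeRight hu s = algebraMap ℂ _ c)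
    (t : SupergroupAlgebra ρ ⊗[ℂ] SupergroupAlgebra ρ) :
    antipodeRight hu (t * s) = c • antipodeRight hu t := by
  induction t using TensorProduct.induction_on with
  | zero => simp
  | add x y hx hy => rw [add_mul, map_add, hx, hy, map_add, smul_add]
  | tmul a b =>
    rw [antipodeRight_tmul_mul, hs, ← Algebra.commutes, mul_assoc, ← Algebra.smul_def,
      antipodeRight_tmul]

/-- The counit `x ⊗ y ↦ ε(x) ε(y)` of the tensor square. -/
def counitSq (ρ : Representation ℂ G V) : SupergroupAlgebra ρ ⊗[ℂ] SupergroupAlgebra ρ →ₐ[ℂ] ℂ :=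
  Algebra.TensorProduct.productMap (superCounit ρ) (superCounit ρ)

theorem counitSq_tmul (x y : SupergroupAlgebra ρ) :
    counitSq ρ (x ⊗ₜ y) = superCounit ρ x * superCounit ρ y :=
  Algebra.TensorProduct.productMap_apply_tmul _ _ _ _

/-- The tensors on which both contractions with the antipode agree with the counit. -/
def antipodeSubalgebra (hu : IsParityElement ρ u) :
    Subalgebra ℂ (SupergroupAlgebra ρ ⊗[ℂ] SupergroupAlgebra ρ) where
  carrier := {t | antipodeLeft hu t = algebraMap ℂ _ (counitSq ρ t) ∧
    antipodeRight hu t = algebraMap ℂ _ (counitSq ρ t)}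
  mul_mem' {s t} hs ht := by
    refine ⟨?_, ?_⟩
    · rw [antipodeLeft_mul hu hs.1, ht.1, map_mul, map_mul, Algebra.smul_def]
    · rw [antipodeRight_mul hu ht.2, hs.2, map_mul, map_mul, Algebra.smul_def,
        Algebra.commutes]
  add_mem' {s t} hs ht := by
    refine ⟨?_, ?_⟩
    · rw [map_add, hs.1, ht.1, map_add, map_add]
    · rw [map_add, hs.2, ht.2, map_add, map_add]
  algebraMap_mem' c := by
    have hl : antipodeLeft hu 1 = 1 := by
      rw [Algebra.TensorProduct.one_def, antipodeLeft_tmul, antipode_one, mul_one]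
    have hr : antipodeRight hu 1 = 1 := by
      rw [Algebra.TensorProduct.one_def, antipodeRight_tmul, antipode_one, mul_one]
    refine ⟨?_, ?_⟩
    · rw [AlgHom.commutes, Algebra.algebraMap_eq_smul_one, map_smul, hl, Algebra.algebraMap_self,
        RingHom.id_apply, Algebra.algebraMap_eq_smul_one]
    · rw [AlgHom.commutes, Algebra.algebraMap_eq_smul_one, map_smul, hr, Algebra.algebraMap_self,
        RingHom.id_apply, Algebra.algebraMap_eq_smul_one]

/-- Elements of `V` anticommute, so exchanging tensor factors negates the product; for a symmetric
tensor the product equals its own negative. This is where the symmetry of `B` enters the antipode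
axiom. -/
theorem mul_eq_zero_of_mem_symTensor {B : V ⊗[ℂ] V} (hB : B ∈ SymTensor V) :
    LinearMap.mul' ℂ _ (TensorProduct.map (ofV ρ) (ofV ρ) B) = 0 := by
  have key : ∀ B : V ⊗[ℂ] V, LinearMap.mul' ℂ _ (TensorProduct.map (ofV ρ) (ofV ρ)
      (TensorProduct.comm ℂ V V B))
      = -LinearMap.mul' ℂ _ (TensorProduct.map (ofV ρ) (ofV ρ) B) := by
    intro B
    induction B using TensorProduct.induction_on with
    | zero => simp
    | add x y hx hy => simp only [map_add, hx, hy, neg_add]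
    | tmul v w =>
      rw [TensorProduct.comm_tmul, TensorProduct.map_tmul, TensorProduct.map_tmul,
        LinearMap.mul'_apply, LinearMap.mul'_apply, ofV_mul_ofV_comm]
  have h := key B
  have hB' : TensorProduct.comm ℂ V V B = B := hB
  rw [hB'] at h
  have h2 : (2 : ℂ) • LinearMap.mul' ℂ _ (TensorProduct.map (ofV ρ) (ofV ρ) B) = 0 := by
    rw [two_smul]
    exact eq_neg_iff_add_eq_zero.mp h
  exact (smul_eq_zero.mp h2).resolve_left two_ne_zero

/-- Both contractions of `v u ⊗ w` equal `-v w`: `S(v u) w = u (-u v) w` and `v u S(w) = -v u u w`.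
For symmetric `B` they sum to zero, which is also the counit. -/
theorem twistIncl_mem_antipodeSubalgebra (hu : IsParityElement ρ u) {B : V ⊗[ℂ] V}
    (hB : B ∈ SymTensor V) : twistIncl ρ u B ∈ antipodeSubalgebra hu := by
  have h0 : counitSq ρ (twistIncl ρ u B) = 0 := by
    clear hB
    induction B using TensorProduct.induction_on with
    | zero => simp
    | add x y hx hy => rw [map_add, map_add, hx, hy, add_zero]
    | tmul v w => rw [twistIncl_tmul, counitSq_tmul, superCounit_ofV, mul_zero]
  have hl : antipodeLeft hu (twistIncl ρ u B)
      = -LinearMap.mul' ℂ _ (TensorProduct.map (ofV ρ) (ofV ρ) B) := by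
    clear hB h0
    induction B using TensorProduct.induction_on with
    | zero => simp
    | add x y hx hy => simp only [map_add, hx, hy, neg_add]
    | tmul v w =>
      rw [twistIncl_tmul, antipodeLeft_tmul, antipode_mul, antipode_ofG_parity, antipode_ofV,
        mul_neg, ← mul_assoc, hu.ofG_mul_self, one_mul, neg_mul]
      rfl
  have hr : antipodeRight hu (twistIncl ρ u B)
      = -LinearMap.mul' ℂ _ (TensorProduct.map (ofV ρ) (ofV ρ) B) := by
    clear hB h0 hl
    induction B using TensorProduct.induction_on with
    | zero => simp
    | add x y hx hy => simp only [map_add, hx, hy, neg_add]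
    | tmul v w =>
      rw [twistIncl_tmul, antipodeRight_tmul, antipode_ofV, mul_neg, mul_assoc,
        ← mul_assoc (ofG ρ u), hu.ofG_mul_self, one_mul]
      rfl
  refine ⟨?_, ?_⟩
  · rw [hl, h0, mul_eq_zero_of_mem_symTensor hB, neg_zero, map_zero]
  · rw [hr, h0, mul_eq_zero_of_mem_symTensor hB, neg_zero, map_zero]

variable [FiniteDimensional ℂ V]

theorem expTwist_mem_antipodeSubalgebra (hu : IsParityElement ρ u) {B : V ⊗[ℂ] V}
    (hB : B ∈ SymTensor V) : expTwist ρ u B ∈ antipodeSubalgebra hu := by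
  rw [expTwist, nilExp_eq_sum (hu.twistIncl_pow B)]
  exact Subalgebra.sum_mem _ fun i _ => Subalgebra.smul_mem _
    (Subalgebra.pow_mem _ (twistIncl_mem_antipodeSubalgebra hu hB) i) _

/-- The subalgebra contains `e^B` and `e^(-B)`, the tensors `g ⊗ g` and the coproducts of `V`, hence
the whole image of the coproduct. The contraction identities never have to be checked on products.
-/
theorem comulHom_mem_antipodeSubalgebra (hu : IsParityElement ρ u) {B : V ⊗[ℂ] V}
    (hB : B ∈ SymTensor V) (x : SupergroupAlgebra ρ) :
    comulHom hu B x ∈ antipodeSubalgebra hu := by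
  induction x using supergroup_induction ρ with
  | ofG g =>
    rw [comulHom_apply, baseComul_ofG]
    refine Subalgebra.mul_mem _ (expTwist_mem_antipodeSubalgebra hu (Submodule.neg_mem _ hB))
      (Subalgebra.mul_mem _ ⟨?_, ?_⟩ (expTwist_mem_antipodeSubalgebra hu hB))
    · rw [antipodeLeft_tmul, antipode_ofG, ← map_mul, inv_mul_cancel, counitSq_tmul,
        superCounit_ofG, mul_one, map_one, map_one]
    · rw [antipodeRight_tmul, antipode_ofG, ← map_mul, mul_inv_cancel, counitSq_tmul,
        superCounit_ofG, mul_one, map_one, map_one]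
  | ofV_mul v x hx =>
    rw [map_mul, comulHom_ofV]
    have h0 : counitSq ρ (ofV ρ v ⊗ₜ 1 + ofG ρ u ⊗ₜ ofV ρ v) = 0 := by
      rw [map_add, counitSq_tmul, counitSq_tmul, superCounit_ofV, zero_mul, mul_zero, add_zero]
    refine Subalgebra.mul_mem _ ⟨?_, ?_⟩ hx
    · rw [h0, map_add, antipodeLeft_tmul, antipodeLeft_tmul, antipode_ofV, antipode_ofG_parity,
        mul_one, neg_add_cancel, map_zero]
    · rw [h0, map_add, antipodeRight_tmul, antipodeRight_tmul, antipode_ofV, antipode_one,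
        mul_one, mul_neg, ← mul_assoc, hu.ofG_mul_self, one_mul, add_neg_cancel, map_zero]
  | add x y hx hy => rw [map_add]; exact Subalgebra.add_mem _ hx hy
  | smul c x hx => rw [map_smul]; exact Subalgebra.smul_mem _ hx c

theorem counitSq_comulHom (hu : IsParityElement ρ u) (B : V ⊗[ℂ] V) (x : SupergroupAlgebra ρ) :
    counitSq ρ (comulHom hu B x) = superCounit ρ x := by
  have h : counitSq ρ = (Algebra.TensorProduct.lmul' ℂ).comp ((Algebra.TensorProduct.map
      (AlgHom.id ℂ ℂ) (superCounit ρ)).comp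
        (Algebra.TensorProduct.map (superCounit ρ) (AlgHom.id ℂ _))) :=
    Algebra.TensorProduct.ext' fun a b => rfl
  rw [h, AlgHom.comp_apply, AlgHom.comp_apply, counit_left, Algebra.TensorProduct.map_tmul,
    Algebra.TensorProduct.lmul'_apply_tmul, map_one, one_mul]

theorem modifiedComul_eq_toLinearMap (hu : IsParityElement ρ u) (B : V ⊗[ℂ] V) :
    modifiedComul ρ u B = (comulHom hu B).toLinearMap :=
  LinearMap.ext (modifiedComul_eq hu B)

/-- `A(G, V, u, B)` is a Hopf algebra. -/
theorem isHopfAlgebra_AGVuB (hu : IsParityElement ρ u) (B : SymTensor V) :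
    IsHopfAlgebra (AGVuB ρ u (B : V ⊗[ℂ] V)) where
  comul_one := (modifiedComul_eq hu B 1).trans (map_one _)
  comul_mul x y := by
    change modifiedComul ρ u B (_ * _) = modifiedComul ρ u B _ * modifiedComul ρ u B _
    rw [modifiedComul_eq_toLinearMap hu]
    exact map_mul (comulHom hu (B : V ⊗[ℂ] V)) x y
  counit_one := map_one (superCounit ρ)
  counit_mul x y := map_mul (superCounit ρ) x y
  coassoc x := by
    change TensorProduct.assoc ℂ (SupergroupAlgebra ρ) (SupergroupAlgebra ρ) (SupergroupAlgebra ρ)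
      ((modifiedComul ρ u B).rTensor _ (modifiedComul ρ u B x))
      = (modifiedComul ρ u B).lTensor _ (modifiedComul ρ u B x)
    rw [modifiedComul_eq_toLinearMap hu]
    exact comulHom_coassoc hu B x
  rTensor_counit x := by
    change (superCounit ρ).toLinearMap.rTensor _ (modifiedComul ρ u B x) = _
    rw [modifiedComul_eq_toLinearMap hu]
    exact counit_left hu B x
  lTensor_counit x := by
    change (superCounit ρ).toLinearMap.lTensor _ (modifiedComul ρ u B x) = _
    rw [modifiedComul_eq_toLinearMap hu]
    exact counit_right hu B x
  exists_antipode := by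
    refine ⟨antipode hu, fun x => ?_⟩
    change antipodeLeft hu (modifiedComul ρ u B x) = algebraMap ℂ (SupergroupAlgebra ρ)
        (superCounit ρ x) ∧
      antipodeRight hu (modifiedComul ρ u B x) = algebraMap ℂ (SupergroupAlgebra ρ)
        (superCounit ρ x)
    rw [modifiedComul_eq_toLinearMap hu, ← counitSq_comulHom hu B x]
    exact comulHom_mem_antipodeSubalgebra hu B.2 x

end Antipode

/-! ### Isomorphisms from pairs `(φ, η)` -/

section Isomorphism

variable {G V : Type*} [Group G] [AddCommGroup V] [Module ℂ V] {ρ : Representation ℂ G V} {u : G}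

/-- The endomorphism of the algebra `ℂ[G ⋉ V]` which is given by `φ` on `G` and by `η` on `V`. -/
def autHom (p : AutPair ρ u) : SupergroupAlgebra ρ →ₐ[ℂ] SupergroupAlgebra ρ :=
  supergroupLift ρ (ofV ρ ∘ₗ (p.1.2 : V →ₗ[ℂ] V)) ((ofG ρ).comp (p.1.1 : G →* G))
    (fun v => ofV_mul_ofV ρ (p.1.2 v))
    (fun g v => by
      change ofV ρ (p.1.2 (ρ g v)) * ofG ρ (p.1.1 g) = ofG ρ (p.1.1 g) * ofV ρ (p.1.2 v)
      rw [p.2.2, ofG_mul_ofV])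

theorem autHom_ofG (p : AutPair ρ u) (g : G) : autHom p (ofG ρ g) = ofG ρ (p.1.1 g) :=
  supergroupLift_ofG ..

theorem autHom_ofV (p : AutPair ρ u) (v : V) : autHom p (ofV ρ v) = ofV ρ (p.1.2 v) :=
  supergroupLift_ofV ..

theorem autHom_mul (p q : AutPair ρ u) : autHom (p * q) = (autHom p).comp (autHom q) := by
  refine supergroup_algHom_ext ρ (fun g => ?_) (fun v => ?_)
  · rw [AlgHom.comp_apply, autHom_ofG, autHom_ofG, autHom_ofG]
    rfl
  · rw [AlgHom.comp_apply, autHom_ofV, autHom_ofV, autHom_ofV]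
    rfl

theorem autHom_one : autHom (1 : AutPair ρ u) = AlgHom.id ℂ _ := by
  refine supergroup_algHom_ext ρ (fun g => ?_) (fun v => ?_)
  · rw [autHom_ofG]
    rfl
  · rw [autHom_ofV]
    rfl

theorem superCounit_autHom (p : AutPair ρ u) (x : SupergroupAlgebra ρ) :
    superCounit ρ (autHom p x) = superCounit ρ x := by
  refine DFunLike.congr_fun (supergroup_algHom_ext ρ (f := (superCounit ρ).comp (autHom p))
    (f' := superCounit ρ) (fun g => ?_) (fun v => ?_)) x
  · rw [AlgHom.comp_apply, autHom_ofG, superCounit_ofG, superCounit_ofG]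
  · rw [AlgHom.comp_apply, autHom_ofV, superCounit_ofV, superCounit_ofV]

/-- The condition `φ u = u` is needed because `twistIncl` inserts a factor `u`. -/
theorem map_autHom_twistIncl (p : AutPair ρ u) (B : V ⊗[ℂ] V) :
    Algebra.TensorProduct.map (autHom p) (autHom p) (twistIncl ρ u B)
      = twistIncl ρ u (TensorProduct.map (p.1.2 : V →ₗ[ℂ] V) (p.1.2 : V →ₗ[ℂ] V) B) := by
  induction B using TensorProduct.induction_on with
  | zero => simp
  | add x y hx hy => simp only [map_add, hx, hy]
  | tmul v w =>
    rw [twistIncl_tmul, Algebra.TensorProduct.map_tmul, map_mul, autHom_ofG, autHom_ofV,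
      autHom_ofV, p.2.1, TensorProduct.map_tmul, twistIncl_tmul]
    rfl

theorem map_map_smul (p : AutPair ρ u) (g : G) (B : V ⊗[ℂ] V) :
    TensorProduct.map (p.1.2 : V →ₗ[ℂ] V) (p.1.2 : V →ₗ[ℂ] V) (TensorProduct.map (ρ g) (ρ g) B)
      = TensorProduct.map (ρ (p.1.1 g)) (ρ (p.1.1 g))
        (TensorProduct.map (p.1.2 : V →ₗ[ℂ] V) (p.1.2 : V →ₗ[ℂ] V) B) := by
  have h : (p.1.2 : V →ₗ[ℂ] V) ∘ₗ ρ g = ρ (p.1.1 g) ∘ₗ (p.1.2 : V →ₗ[ℂ] V) :=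
    LinearMap.ext (p.2.2 g)
  rw [← LinearMap.comp_apply, ← LinearMap.comp_apply, ← TensorProduct.map_comp,
    ← TensorProduct.map_comp, h]

variable [FiniteDimensional ℂ V]

/-- On `g`, the exponents to compare are `η(gB) - ηB = φ(g)ηB - ηB` and `φ(g)B' - B'`; they agree
because `B' - ηB` is fixed by `φ(g)`. On `V` neither coproduct involves a twist. -/
theorem comulHom_autHom (hu : IsParityElement ρ u) (p : AutPair ρ u) {B B' : V ⊗[ℂ] V}
    (hB : ∀ g, TensorProduct.map (ρ g) (ρ g)
      (B' - TensorProduct.map (p.1.2 : V →ₗ[ℂ] V) (p.1.2 : V →ₗ[ℂ] V) B)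
      = B' - TensorProduct.map (p.1.2 : V →ₗ[ℂ] V) (p.1.2 : V →ₗ[ℂ] V) B)
    (x : SupergroupAlgebra ρ) :
    Algebra.TensorProduct.map (autHom p) (autHom p) (comulHom hu B x)
      = comulHom hu B' (autHom p x) := by
  refine DFunLike.congr_fun (supergroup_algHom_ext ρ
    (f := (Algebra.TensorProduct.map (autHom p) (autHom p)).comp (comulHom hu B))
    (f' := (comulHom hu B').comp (autHom p)) (fun g => ?_) (fun v => ?_)) x
  · have h := hB (p.1.1 g)
    rw [map_sub, sub_eq_sub_iff_sub_eq_sub] at h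
    rw [AlgHom.comp_apply, AlgHom.comp_apply, autHom_ofG, comulHom_ofG, comulHom_ofG, map_mul,
      Algebra.TensorProduct.map_tmul, autHom_ofG, expTwist, expTwist,
      map_nilExp _ (hu.isNilpotent_twistIncl _), map_autHom_twistIncl, map_sub, map_map_smul, h]
  · rw [AlgHom.comp_apply, AlgHom.comp_apply, autHom_ofV, comulHom_ofV, comulHom_ofV, map_add,
      Algebra.TensorProduct.map_tmul, Algebra.TensorProduct.map_tmul, autHom_ofV, autHom_ofG,
      p.2.1, map_one]

theorem nonempty_bialgEquiv_of_algHom (hu : IsParityElement ρ u) {B B' : V ⊗[ℂ] V}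
    (f f' : SupergroupAlgebra ρ →ₐ[ℂ] SupergroupAlgebra ρ) (h : f.comp f' = AlgHom.id ℂ _)
    (h' : f'.comp f = AlgHom.id ℂ _) (hε : ∀ x, superCounit ρ (f x) = superCounit ρ x)
    (hΔ : ∀ x, Algebra.TensorProduct.map f f (comulHom hu B x) = comulHom hu B' (f x)) :
    Nonempty (AGVuB ρ u B ≃ₐc[ℂ] AGVuB ρ u B') := by
  let e : SupergroupAlgebra ρ ≃ₐ[ℂ] SupergroupAlgebra ρ := AlgEquiv.ofAlgHom f f' h h'
  exact ⟨{
    toFun := e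
    invFun := e.symm
    left_inv := e.left_inv
    right_inv := e.right_inv
    map_add' := e.map_add
    map_mul' := e.map_mul
    map_smul' := map_smul f
    counit_comp := LinearMap.ext hε
    map_comp_comul := by
      change TensorProduct.map f.toLinearMap f.toLinearMap ∘ₗ modifiedComul ρ u B
        = modifiedComul ρ u B' ∘ₗ f.toLinearMap
      rw [modifiedComul_eq_toLinearMap hu, modifiedComul_eq_toLinearMap hu]
      exact LinearMap.ext hΔ }⟩

theorem exists_algHom_of_bialgEquiv (hu : IsParityElement ρ u) {B B' : V ⊗[ℂ] V}
    (e : AGVuB ρ u B ≃ₐc[ℂ] AGVuB ρ u B') :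
    ∃ f : SupergroupAlgebra ρ →ₐ[ℂ] SupergroupAlgebra ρ, (∀ x : SupergroupAlgebra ρ, f x = e x) ∧
      ∀ x, Algebra.TensorProduct.map f f (comulHom hu B x) = comulHom hu B' (f x) := by
  let f : SupergroupAlgebra ρ →ₐ[ℂ] SupergroupAlgebra ρ :=
    AlgHom.ofLinearMap (e.toCoalgEquiv.toCoalgHom.toLinearMap) (map_one e) (map_mul e)
  have h : TensorProduct.map f.toLinearMap f.toLinearMap ∘ₗ modifiedComul ρ u B
      = modifiedComul ρ u B' ∘ₗ f.toLinearMap := e.toCoalgEquiv.toCoalgHom.map_comp_comul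
  rw [modifiedComul_eq_toLinearMap hu, modifiedComul_eq_toLinearMap hu] at h
  exact ⟨f, fun _ => rfl, DFunLike.congr_fun h⟩

end Isomorphism

/-! ### The components of degree zero and one -/

section Degree

variable {G V : Type*} [Group G] [AddCommGroup V] [Module ℂ V] {ρ : Representation ℂ G V} {u : G}

/-- The projection `ΛV → V` to the part of degree one. -/
def extDegOne (ρ : Representation ℂ G V) : ExtAlg ρ →ₗ[ℂ] V :=
  (ExteriorAlgebra.ιInv : ExteriorAlgebra ℂ V →ₗ[ℂ] V)

theorem extDegOne_extι (v : V) : extDegOne ρ (extι ρ v) = v := ExteriorAlgebra.ι_leftInverse v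

/-- The degree zero and one parts together form an algebra homomorphism to the trivial square-zero
extension of `ℂ` by `V`, whose multiplication is this Leibniz rule. -/
theorem extDegOne_mul (a b : ExtAlg ρ) :
    extDegOne ρ (a * b) = extCounit ρ a • extDegOne ρ b + extCounit ρ b • extDegOne ρ a := by
  -- This is the right module structure used in `ExteriorAlgebra.ιInv`, so the second component of
  -- `t` is `extDegOne` by definition.
  let : Module ℂᵐᵒᵖ V := Module.compHom _ ((RingHom.id ℂ).fromOpposite mul_comm)
  have : IsCentralScalar ℂ V := ⟨fun r m => rfl⟩
  let t : ExtAlg ρ →ₐ[ℂ] TrivSqZeroExt ℂ V :=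
    (ExteriorAlgebra.toTrivSqZeroExt : ExteriorAlgebra ℂ V →ₐ[ℂ] TrivSqZeroExt ℂ V)
  have hε : ∀ a : ExtAlg ρ, (t a).fst = extCounit ρ a := by
    have hfst : (TrivSqZeroExt.fstHom ℂ ℂ V).comp
        (ExteriorAlgebra.toTrivSqZeroExt : ExteriorAlgebra ℂ V →ₐ[ℂ] TrivSqZeroExt ℂ V)
          = ExteriorAlgebra.algebraMapInv := by
      refine ExteriorAlgebra.hom_ext (LinearMap.ext fun v => ?_)
      change (ExteriorAlgebra.toTrivSqZeroExt (ExteriorAlgebra.ι ℂ v)).fst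
        = ExteriorAlgebra.algebraMapInv (ExteriorAlgebra.ι ℂ v)
      rw [ExteriorAlgebra.toTrivSqZeroExt_ι, TrivSqZeroExt.fst_inr]
      exact (extCounit_ι ρ v).symm
    exact fun a => DFunLike.congr_fun hfst a
  change (t (a * b)).snd = extCounit ρ a • (t b).snd + extCounit ρ b • (t a).snd
  rw [map_mul, TrivSqZeroExt.snd_mul, hε, hε, op_smul_eq_smul]

theorem extDegOne_smul (g : G) (a : ExtAlg ρ) : extDegOne ρ (g • a) = ρ g (extDegOne ρ a) :=
  DFunLike.congr_fun (ExteriorAlgebra.ιInv_comp_map (ρ g)) a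

theorem extDegOne_one : extDegOne ρ 1 = 0 := by
  have h := extDegOne_mul (ρ := ρ) 1 1
  rw [mul_one, map_one (extCounit ρ), one_smul] at h
  exact left_eq_add.mp h

/-- The component of `x` in `ℂ g`. -/
def degZero (ρ : Representation ℂ G V) (g : G) : SupergroupAlgebra ρ →ₗ[ℂ] ℂ :=
  (extCounit ρ).toLinearMap ∘ₗ Finsupp.lapply g ∘ₗ
    (SkewMonoidAlgebra.coeffLinearEquiv (S := ℂ) (k := ExtAlg ρ) (G := G)).toLinearMap

/-- The component of `x` in `V g`. -/
def degOne (ρ : Representation ℂ G V) (g : G) : SupergroupAlgebra ρ →ₗ[ℂ] V :=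
  extDegOne ρ ∘ₗ Finsupp.lapply g ∘ₗ
    (SkewMonoidAlgebra.coeffLinearEquiv (S := ℂ) (k := ExtAlg ρ) (G := G)).toLinearMap

theorem degZero_apply (g : G) (x : SupergroupAlgebra ρ) :
    degZero ρ g x = extCounit ρ (x.coeff g) := rfl

theorem degOne_apply (g : G) (x : SupergroupAlgebra ρ) :
    degOne ρ g x = extDegOne ρ (x.coeff g) := rfl

open scoped Classical in
theorem degZero_ofG (g h : G) : degZero ρ h (ofG ρ g) = if h = g then 1 else 0 := by
  change extCounit ρ ((SkewMonoidAlgebra.single g (1 : ExtAlg ρ)).coeff h) = _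
  rw [SkewMonoidAlgebra.coeff_single_apply, apply_ite (extCounit ρ), map_one, map_zero]
  simp only [eq_comm]

theorem degOne_ofG (g h : G) : degOne ρ h (ofG ρ g) = 0 := by
  classical
  change extDegOne ρ ((SkewMonoidAlgebra.single g (1 : ExtAlg ρ)).coeff h) = _
  rw [SkewMonoidAlgebra.coeff_single_apply, apply_ite (extDegOne ρ), extDegOne_one, map_zero,
    ite_self]

theorem degZero_ofV (v : V) (h : G) : degZero ρ h (ofV ρ v) = 0 := by
  classical
  change extCounit ρ ((SkewMonoidAlgebra.single 1 (extι ρ v)).coeff h) = _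
  rw [SkewMonoidAlgebra.coeff_single_apply, apply_ite (extCounit ρ), extCounit_ι, map_zero,
    ite_self]

open scoped Classical in
theorem degOne_ofV (v : V) (h : G) : degOne ρ h (ofV ρ v) = if h = 1 then v else 0 := by
  change extDegOne ρ ((SkewMonoidAlgebra.single 1 (extι ρ v)).coeff h) = _
  rw [SkewMonoidAlgebra.coeff_single_apply, apply_ite (extDegOne ρ), extDegOne_extι, map_zero]
  simp only [eq_comm]

open scoped Classical in
theorem degZero_one (h : G) : degZero ρ h 1 = if h = 1 then 1 else 0 := by
  rw [← map_one (ofG ρ), degZero_ofG]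

theorem degZero_mul [Fintype G] (x y : SupergroupAlgebra ρ) (h : G) :
    degZero ρ h (x * y) = ∑ g, degZero ρ g x * degZero ρ (g⁻¹ * h) y := by
  classical
  induction x using SkewMonoidAlgebra.induction_on with
  | zero => simp
  | add x x' hx hx' =>
    rw [add_mul, map_add, hx, hx', ← Finset.sum_add_distrib]
    exact Finset.sum_congr rfl fun g _ => by rw [map_add, add_mul]
  | single k a =>
    rw [Finset.sum_eq_single k]
    · rw [degZero_apply, degZero_apply, degZero_apply, SkewMonoidAlgebra.coeff_single_mul,
        map_mul, extCounit_smul, SkewMonoidAlgebra.coeff_single_apply, if_pos rfl]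
    · intro g _ hg
      rw [degZero_apply, SkewMonoidAlgebra.coeff_single_apply, if_neg hg.symm, map_zero, zero_mul]
    · exact fun hk => (hk (Finset.mem_univ k)).elim

/-- This is the Leibniz rule for the coefficients; `ρ g` appears because `g` must be moved past the
coefficient of the second factor. -/
theorem degOne_mul [Fintype G] (x y : SupergroupAlgebra ρ) (h : G) :
    degOne ρ h (x * y) = ∑ g, (degZero ρ g x • ρ g (degOne ρ (g⁻¹ * h) y)
      + degZero ρ (g⁻¹ * h) y • degOne ρ g x) := by
  classical
  induction x using SkewMonoidAlgebra.induction_on with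
  | zero => simp
  | add x x' hx hx' =>
    rw [add_mul, map_add, hx, hx', ← Finset.sum_add_distrib]
    exact Finset.sum_congr rfl fun g _ => by
      rw [map_add, map_add, add_smul, smul_add, add_add_add_comm]
  | single k a =>
    rw [Finset.sum_eq_single k]
    · rw [degOne_apply, degOne_apply, degOne_apply, degZero_apply, degZero_apply,
        SkewMonoidAlgebra.coeff_single_mul, extDegOne_mul, extDegOne_smul, extCounit_smul,
        SkewMonoidAlgebra.coeff_single_apply, if_pos rfl]
    · intro g _ hg
      rw [degZero_apply, degOne_apply g, SkewMonoidAlgebra.coeff_single_apply, if_neg hg.symm,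
        map_zero, map_zero, zero_smul, smul_zero, add_zero]
    · exact fun hk => (hk (Finset.mem_univ k)).elim

end Degree

/-! ### Components of the coproduct -/

section Components

variable {G V : Type*} [Group G] [AddCommGroup V] [Module ℂ V] {ρ : Representation ℂ G V} {u : G}

open scoped Classical in
/-- In degree zero, `f` is given by `φ` on `G` and vanishes on `V`, and in degree one it is given
by `η` on `V`. -/
structure HasLeadingPart (f : SupergroupAlgebra ρ →ₐ[ℂ] SupergroupAlgebra ρ) (φ : G → G)
    (η : V →ₗ[ℂ] V) : Prop where
  degZero_ofG : ∀ g h, degZero ρ h (f (ofG ρ g)) = if h = φ g then 1 else 0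
  degZero_ofV : ∀ v h, degZero ρ h (f (ofV ρ v)) = 0
  degOne_ofV : ∀ v h, degOne ρ h (f (ofV ρ v)) = if h = 1 then η v else 0

/-- The identity is included so that the component lemmas below serve twice: for the coproduct
itself and for its image under a homomorphism `f`. -/
theorem hasLeadingPart_id : HasLeadingPart (AlgHom.id ℂ (SupergroupAlgebra ρ)) id LinearMap.id where
  degZero_ofG := degZero_ofG
  degZero_ofV := degZero_ofV
  degOne_ofV := degOne_ofV

variable (f : SupergroupAlgebra ρ →ₐ[ℂ] SupergroupAlgebra ρ)

/-- The component of `(f ⊗ f)(t)` in `ℂ h ⊗ ℂ h'`. -/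
def comp₀₀ (h h' : G) : SupergroupAlgebra ρ ⊗[ℂ] SupergroupAlgebra ρ →ₗ[ℂ] ℂ :=
  LinearMap.mul' ℂ ℂ ∘ₗ
    TensorProduct.map (degZero ρ h ∘ₗ f.toLinearMap) (degZero ρ h' ∘ₗ f.toLinearMap)

/-- The component of `(f ⊗ f)(t)` in `ℂ h ⊗ V h'`. -/
def comp₀₁ (h h' : G) : SupergroupAlgebra ρ ⊗[ℂ] SupergroupAlgebra ρ →ₗ[ℂ] V :=
  (TensorProduct.lid ℂ V).toLinearMap ∘ₗ
    TensorProduct.map (degZero ρ h ∘ₗ f.toLinearMap) (degOne ρ h' ∘ₗ f.toLinearMap)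

/-- The component of `(f ⊗ f)(t)` in `V h ⊗ ℂ h'`. -/
def comp₁₀ (h h' : G) : SupergroupAlgebra ρ ⊗[ℂ] SupergroupAlgebra ρ →ₗ[ℂ] V :=
  (TensorProduct.rid ℂ V).toLinearMap ∘ₗ
    TensorProduct.map (degOne ρ h ∘ₗ f.toLinearMap) (degZero ρ h' ∘ₗ f.toLinearMap)

/-- The component of `(f ⊗ f)(t)` in `V h ⊗ V h'`. -/
def comp₁₁ (h h' : G) : SupergroupAlgebra ρ ⊗[ℂ] SupergroupAlgebra ρ →ₗ[ℂ] V ⊗[ℂ] V :=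
  TensorProduct.map (degOne ρ h ∘ₗ f.toLinearMap) (degOne ρ h' ∘ₗ f.toLinearMap)

theorem comp₀₀_tmul (h h' : G) (x y : SupergroupAlgebra ρ) :
    comp₀₀ f h h' (x ⊗ₜ y) = degZero ρ h (f x) * degZero ρ h' (f y) := rfl

theorem comp₀₁_tmul (h h' : G) (x y : SupergroupAlgebra ρ) :
    comp₀₁ f h h' (x ⊗ₜ y) = degZero ρ h (f x) • degOne ρ h' (f y) := rfl

theorem comp₁₀_tmul (h h' : G) (x y : SupergroupAlgebra ρ) :
    comp₁₀ f h h' (x ⊗ₜ y) = degZero ρ h' (f y) • degOne ρ h (f x) := rfl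

theorem comp₁₁_tmul (h h' : G) (x y : SupergroupAlgebra ρ) :
    comp₁₁ f h h' (x ⊗ₜ y) = degOne ρ h (f x) ⊗ₜ degOne ρ h' (f y) := rfl

theorem comp₀₀_map (h h' : G) (t : SupergroupAlgebra ρ ⊗[ℂ] SupergroupAlgebra ρ) :
    comp₀₀ (AlgHom.id ℂ _) h h' (Algebra.TensorProduct.map f f t) = comp₀₀ f h h' t := by
  induction t using TensorProduct.induction_on with
  | zero => simp
  | add s t hs ht => rw [map_add, map_add, hs, ht, map_add]
  | tmul x y => rfl

theorem comp₀₁_map (h h' : G) (t : SupergroupAlgebra ρ ⊗[ℂ] SupergroupAlgebra ρ) :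
    comp₀₁ (AlgHom.id ℂ _) h h' (Algebra.TensorProduct.map f f t) = comp₀₁ f h h' t := by
  induction t using TensorProduct.induction_on with
  | zero => simp
  | add s t hs ht => rw [map_add, map_add, hs, ht, map_add]
  | tmul x y => rfl

theorem comp₁₀_map (h h' : G) (t : SupergroupAlgebra ρ ⊗[ℂ] SupergroupAlgebra ρ) :
    comp₁₀ (AlgHom.id ℂ _) h h' (Algebra.TensorProduct.map f f t) = comp₁₀ f h h' t := by
  induction t using TensorProduct.induction_on with
  | zero => simp
  | add s t hs ht => rw [map_add, map_add, hs, ht, map_add]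
  | tmul x y => rfl

theorem comp₁₁_map (h h' : G) (t : SupergroupAlgebra ρ ⊗[ℂ] SupergroupAlgebra ρ) :
    comp₁₁ (AlgHom.id ℂ _) h h' (Algebra.TensorProduct.map f f t) = comp₁₁ f h h' t := by
  induction t using TensorProduct.induction_on with
  | zero => simp
  | add s t hs ht => rw [map_add, map_add, hs, ht, map_add]
  | tmul x y => rfl

variable {f} [Fintype G]

/-- The degree zero part is multiplicative, so it vanishes on the ideal generated by `f(V)`. Hence
every component with a degree zero slot kills `twistIncl ρ u B * s`, whose left and right factors
both begin with a vector. -/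
theorem degZero_map_ofV_mul (hf : ∀ v h, degZero ρ h (f (ofV ρ v)) = 0) (v : V)
    (x : SupergroupAlgebra ρ) (h : G) : degZero ρ h (f (ofV ρ v * x)) = 0 := by
  rw [map_mul, degZero_mul]
  exact Finset.sum_eq_zero fun g _ => by rw [hf, zero_mul]

theorem comp₀₀_twistIncl_mul (hf : ∀ v h, degZero ρ h (f (ofV ρ v)) = 0) (B : V ⊗[ℂ] V) (h h' : G)
    (s : SupergroupAlgebra ρ ⊗[ℂ] SupergroupAlgebra ρ) :
    comp₀₀ f h h' (twistIncl ρ u B * s) = 0 := by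
  induction B using TensorProduct.induction_on with
  | zero => simp
  | add x y hx hy => rw [map_add, add_mul, map_add, hx, hy, add_zero]
  | tmul v w =>
    induction s using TensorProduct.induction_on with
    | zero => simp
    | add x y hx hy => rw [mul_add, map_add, hx, hy, add_zero]
    | tmul a b =>
      rw [twistIncl_tmul, Algebra.TensorProduct.tmul_mul_tmul, comp₀₀_tmul, mul_assoc,
        degZero_map_ofV_mul hf, zero_mul]

theorem comp₀₁_twistIncl_mul (hf : ∀ v h, degZero ρ h (f (ofV ρ v)) = 0) (B : V ⊗[ℂ] V) (h h' : G)
    (s : SupergroupAlgebra ρ ⊗[ℂ] SupergroupAlgebra ρ) :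
    comp₀₁ f h h' (twistIncl ρ u B * s) = 0 := by
  induction B using TensorProduct.induction_on with
  | zero => simp
  | add x y hx hy => rw [map_add, add_mul, map_add, hx, hy, add_zero]
  | tmul v w =>
    induction s using TensorProduct.induction_on with
    | zero => simp
    | add x y hx hy => rw [mul_add, map_add, hx, hy, add_zero]
    | tmul a b =>
      rw [twistIncl_tmul, Algebra.TensorProduct.tmul_mul_tmul, comp₀₁_tmul, mul_assoc,
        degZero_map_ofV_mul hf, zero_smul]

theorem comp₁₀_twistIncl_mul (hf : ∀ v h, degZero ρ h (f (ofV ρ v)) = 0) (B : V ⊗[ℂ] V) (h h' : G)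
    (s : SupergroupAlgebra ρ ⊗[ℂ] SupergroupAlgebra ρ) :
    comp₁₀ f h h' (twistIncl ρ u B * s) = 0 := by
  induction B using TensorProduct.induction_on with
  | zero => simp
  | add x y hx hy => rw [map_add, add_mul, map_add, hx, hy, add_zero]
  | tmul v w =>
    induction s using TensorProduct.induction_on with
    | zero => simp
    | add x y hx hy => rw [mul_add, map_add, hx, hy, add_zero]
    | tmul a b =>
      rw [twistIncl_tmul, Algebra.TensorProduct.tmul_mul_tmul, comp₁₀_tmul,
        degZero_map_ofV_mul hf, zero_smul]

theorem IsParityElement.degOne_mul (hu : IsParityElement ρ u) (x : SupergroupAlgebra ρ) (h : G) :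
    degOne ρ h (ofG ρ u * x) = -degOne ρ (u⁻¹ * h) x := by
  classical
  rw [SupergroupHopf.degOne_mul]
  simp [degZero_ofG, degOne_ofG, hu.apply_eq]

section LeadingPart

variable {φ : G → G} {η : V →ₗ[ℂ] V}

theorem HasLeadingPart.degZero_ofG_mul (hf : HasLeadingPart f φ η) (g : G)
    (x : SupergroupAlgebra ρ) (h : G) :
    degZero ρ h (f (ofG ρ g * x)) = degZero ρ ((φ g)⁻¹ * h) (f x) := by
  classical
  rw [map_mul, degZero_mul]
  simp [hf.degZero_ofG]

theorem HasLeadingPart.degOne_ofV_mul (hf : HasLeadingPart f φ η) (v : V)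
    (x : SupergroupAlgebra ρ) (h : G) :
    degOne ρ h (f (ofV ρ v * x)) = degZero ρ h (f x) • η v := by
  classical
  rw [map_mul, degOne_mul]
  simp [hf.degZero_ofV, hf.degOne_ofV]

/-- Each slot begins with a vector, which already uses up its degree one; only the degree zero part
of `s` remains. The shift by `φ u` on the left comes from the `u` in `v u ⊗ w`. -/
theorem HasLeadingPart.comp₁₁_twistIncl_mul (hf : HasLeadingPart f φ η) (B : V ⊗[ℂ] V) (h h' : G)
    (s : SupergroupAlgebra ρ ⊗[ℂ] SupergroupAlgebra ρ) :
    comp₁₁ f h h' (twistIncl ρ u B * s)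
      = comp₀₀ f ((φ u)⁻¹ * h) h' s • TensorProduct.map η η B := by
  induction B using TensorProduct.induction_on with
  | zero => simp
  | add x y hx hy => rw [map_add, add_mul, map_add, hx, hy, map_add, smul_add]
  | tmul v w =>
    induction s using TensorProduct.induction_on with
    | zero => simp
    | add x y hx hy => rw [mul_add, map_add, hx, hy, map_add, add_smul]
    | tmul a b =>
      rw [twistIncl_tmul, Algebra.TensorProduct.tmul_mul_tmul, comp₁₁_tmul, mul_assoc,
        hf.degOne_ofV_mul, hf.degOne_ofV_mul, hf.degZero_ofG_mul, comp₀₀_tmul,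
        TensorProduct.map_tmul, TensorProduct.smul_tmul_smul]

variable [FiniteDimensional ℂ V]

theorem comp₀₀_comulHom_ofG (hu : IsParityElement ρ u)
    (hf : ∀ v h, degZero ρ h (f (ofV ρ v)) = 0) (B : V ⊗[ℂ] V) (g h h' : G) :
    comp₀₀ f h h' (comulHom hu B (ofG ρ g))
      = degZero ρ h (f (ofG ρ g)) * degZero ρ h' (f (ofG ρ g)) := by
  obtain ⟨r, hr⟩ := exists_nilExp_eq
    (hu.isNilpotent_twistIncl (TensorProduct.map (ρ g) (ρ g) B - B))
  rw [comulHom_ofG, expTwist, hr, add_mul, add_mul, one_mul, mul_assoc (twistIncl ρ u _), map_add,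
    map_add, comp₀₀_twistIncl_mul hf, comp₀₀_twistIncl_mul hf, add_zero, add_zero, comp₀₀_tmul]

theorem comp₀₁_comulHom_ofG (hu : IsParityElement ρ u)
    (hf : ∀ v h, degZero ρ h (f (ofV ρ v)) = 0) (B : V ⊗[ℂ] V) (g h h' : G) :
    comp₀₁ f h h' (comulHom hu B (ofG ρ g))
      = degZero ρ h (f (ofG ρ g)) • degOne ρ h' (f (ofG ρ g)) := by
  obtain ⟨r, hr⟩ := exists_nilExp_eq
    (hu.isNilpotent_twistIncl (TensorProduct.map (ρ g) (ρ g) B - B))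
  rw [comulHom_ofG, expTwist, hr, add_mul, add_mul, one_mul, mul_assoc (twistIncl ρ u _), map_add,
    map_add, comp₀₁_twistIncl_mul hf, comp₀₁_twistIncl_mul hf, add_zero, add_zero, comp₀₁_tmul]

theorem comp₁₀_comulHom_ofG (hu : IsParityElement ρ u)
    (hf : ∀ v h, degZero ρ h (f (ofV ρ v)) = 0) (B : V ⊗[ℂ] V) (g h h' : G) :
    comp₁₀ f h h' (comulHom hu B (ofG ρ g))
      = degZero ρ h' (f (ofG ρ g)) • degOne ρ h (f (ofG ρ g)) := by
  obtain ⟨r, hr⟩ := exists_nilExp_eq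
    (hu.isNilpotent_twistIncl (TensorProduct.map (ρ g) (ρ g) B - B))
  rw [comulHom_ofG, expTwist, hr, add_mul, add_mul, one_mul, mul_assoc (twistIncl ρ u _), map_add,
    map_add, comp₁₀_twistIncl_mul hf, comp₁₀_twistIncl_mul hf, add_zero, add_zero, comp₁₀_tmul]

/-- Only the constant and linear terms of the exponential contribute: after one factor `twistIncl`
is extracted, the remainder still carries another, and its degree zero component vanishes. -/
theorem HasLeadingPart.comp₁₁_comulHom_ofG (hu : IsParityElement ρ u) (hf : HasLeadingPart f φ η)
    (B : V ⊗[ℂ] V) (g h h' : G) :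
    comp₁₁ f h h' (comulHom hu B (ofG ρ g))
      = degOne ρ h (f (ofG ρ g)) ⊗ₜ degOne ρ h' (f (ofG ρ g))
        + (degZero ρ ((φ u)⁻¹ * h) (f (ofG ρ g)) * degZero ρ h' (f (ofG ρ g)))
          • TensorProduct.map η η (TensorProduct.map (ρ g) (ρ g) B - B) := by
  obtain ⟨r, hr⟩ := exists_nilExp_eq
    (hu.isNilpotent_twistIncl (TensorProduct.map (ρ g) (ρ g) B - B))
  rw [comulHom_ofG, expTwist, hr, add_mul, add_mul, one_mul, mul_assoc (twistIncl ρ u _), map_add,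
    map_add, hf.comp₁₁_twistIncl_mul, hf.comp₁₁_twistIncl_mul, mul_assoc (twistIncl ρ u _),
    comp₀₀_twistIncl_mul hf.degZero_ofV, zero_smul, add_zero, comp₁₁_tmul, comp₀₀_tmul]

theorem comp₀₀_comulHom_ofV_mul (hu : IsParityElement ρ u)
    (hf : ∀ v h, degZero ρ h (f (ofV ρ v)) = 0) (B : V ⊗[ℂ] V) (v : V)
    (x : SupergroupAlgebra ρ) (h h' : G) :
    comp₀₀ f h h' (comulHom hu B (ofV ρ v * x)) = 0 := by
  rw [map_mul, comulHom_ofV]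
  induction comulHom hu B x using TensorProduct.induction_on with
  | zero => simp
  | add x y hx hy => rw [mul_add, map_add, hx, hy, add_zero]
  | tmul a b =>
    rw [add_mul, Algebra.TensorProduct.tmul_mul_tmul, Algebra.TensorProduct.tmul_mul_tmul, map_add,
      comp₀₀_tmul, comp₀₀_tmul, degZero_map_ofV_mul hf, degZero_map_ofV_mul hf, zero_mul, mul_zero,
      add_zero]

theorem HasLeadingPart.comp₀₁_comulHom_ofV_mul (hu : IsParityElement ρ u)
    (hf : HasLeadingPart f φ η) (B : V ⊗[ℂ] V) (v : V) (x : SupergroupAlgebra ρ) (h h' : G) :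
    comp₀₁ f h h' (comulHom hu B (ofV ρ v * x))
      = comp₀₀ f ((φ u)⁻¹ * h) h' (comulHom hu B x) • η v := by
  rw [map_mul, comulHom_ofV]
  induction comulHom hu B x using TensorProduct.induction_on with
  | zero => simp
  | add x y hx hy => rw [mul_add, map_add, hx, hy, map_add, add_smul]
  | tmul a b =>
    rw [add_mul, Algebra.TensorProduct.tmul_mul_tmul, Algebra.TensorProduct.tmul_mul_tmul, map_add,
      comp₀₁_tmul, comp₀₁_tmul, comp₀₀_tmul, degZero_map_ofV_mul hf.degZero_ofV, zero_smul,
      zero_add, hf.degZero_ofG_mul, hf.degOne_ofV_mul, smul_smul]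

theorem HasLeadingPart.comp₁₀_comulHom_ofV_mul (hu : IsParityElement ρ u)
    (hf : HasLeadingPart f φ η) (B : V ⊗[ℂ] V) (v : V) (x : SupergroupAlgebra ρ) (h h' : G) :
    comp₁₀ f h h' (comulHom hu B (ofV ρ v * x))
      = comp₀₀ f h h' (comulHom hu B x) • η v := by
  rw [map_mul, comulHom_ofV]
  induction comulHom hu B x using TensorProduct.induction_on with
  | zero => simp
  | add x y hx hy => rw [mul_add, map_add, hx, hy, map_add, add_smul]
  | tmul a b =>
    rw [add_mul, Algebra.TensorProduct.tmul_mul_tmul, Algebra.TensorProduct.tmul_mul_tmul, map_add,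
      comp₁₀_tmul, comp₁₀_tmul, comp₀₀_tmul, degZero_map_ofV_mul hf.degZero_ofV, zero_smul,
      add_zero, hf.degOne_ofV_mul, one_mul, smul_smul, mul_comm]

/-- The two terms come from `v ⊗ 1` and `u ⊗ v`. The minus sign is the action of `u` on the degree
one part standing in the left slot; it produces antisymmetry later on. -/
theorem comp₁₁_comulHom_ofV_mul (hu : IsParityElement ρ u) (B : V ⊗[ℂ] V) (v : V)
    (x : SupergroupAlgebra ρ) (h h' : G) :
    comp₁₁ (AlgHom.id ℂ _) h h' (comulHom hu B (ofV ρ v * x))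
      = v ⊗ₜ comp₀₁ (AlgHom.id ℂ _) h h' (comulHom hu B x)
        - comp₁₀ (AlgHom.id ℂ _) (u⁻¹ * h) h' (comulHom hu B x) ⊗ₜ v := by
  have h1 := (hasLeadingPart_id (ρ := ρ)).degOne_ofV_mul
  simp only [AlgHom.id_apply, LinearMap.id_apply] at h1
  rw [map_mul, comulHom_ofV]
  induction comulHom hu B x using TensorProduct.induction_on with
  | zero => simp
  | add x y hx hy =>
    rw [mul_add, map_add, hx, hy, map_add, map_add, TensorProduct.add_tmul, TensorProduct.tmul_add]
    abel
  | tmul a b =>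
    rw [add_mul, Algebra.TensorProduct.tmul_mul_tmul, Algebra.TensorProduct.tmul_mul_tmul, map_add,
      comp₁₁_tmul, comp₁₁_tmul, comp₀₁_tmul, comp₁₀_tmul]
    simp only [AlgHom.id_apply]
    rw [one_mul, h1, h1, hu.degOne_mul, TensorProduct.neg_tmul, TensorProduct.smul_tmul,
      TensorProduct.smul_tmul, sub_eq_add_neg]

end LeadingPart

end Components

/-! ### Low-degree components of the coproduct of an arbitrary element -/

section Coaction

variable {G V : Type*} [Group G] [AddCommGroup V] [Module ℂ V] {ρ : Representation ℂ G V} {u : G}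
  [Fintype G]

theorem degZero_ofV_mul (v : V) (x : SupergroupAlgebra ρ) (h : G) :
    degZero ρ h (ofV ρ v * x) = 0 :=
  degZero_map_ofV_mul (f := AlgHom.id ℂ _) degZero_ofV v x h

theorem degOne_ofV_mul (v : V) (x : SupergroupAlgebra ρ) (h : G) :
    degOne ρ h (ofV ρ v * x) = degZero ρ h x • v :=
  hasLeadingPart_id.degOne_ofV_mul v x h

variable [FiniteDimensional ℂ V]

open scoped Classical in
-- Modulo the ideal generated by `V` the coproduct is that of the group algebra, whatever `B` is.
theorem comp₀₀_comulHom (hu : IsParityElement ρ u) (B : V ⊗[ℂ] V) (x : SupergroupAlgebra ρ)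
    (h h' : G) : comp₀₀ (AlgHom.id ℂ _) h h' (comulHom hu B x)
      = if h = h' then degZero ρ h x else 0 := by
  induction x using supergroup_induction ρ with
  | ofG g =>
    rw [comp₀₀_comulHom_ofG hu degZero_ofV, AlgHom.id_apply, degZero_ofG, degZero_ofG]
    by_cases h1 : h = h' <;> by_cases h2 : h = g <;> grind
  | ofV_mul v x hx =>
    rw [comp₀₀_comulHom_ofV_mul hu degZero_ofV, degZero_ofV_mul, ite_self]
  | add x y hx hy =>
    rw [map_add, map_add, hx, hy, map_add]
    split_ifs <;> simp
  | smul c x hx =>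
    rw [map_smul, map_smul, hx, map_smul]
    split_ifs <;> simp

open scoped Classical in
-- In degree one `v g` is sent to `v g ⊗ g + u g ⊗ v g`. The second term is seen here, whence the
-- factor `u`.
theorem comp₀₁_comulHom (hu : IsParityElement ρ u) (B : V ⊗[ℂ] V) (x : SupergroupAlgebra ρ)
    (h h' : G) : comp₀₁ (AlgHom.id ℂ _) h h' (comulHom hu B x)
      = if h = u * h' then degOne ρ h' x else 0 := by
  induction x using supergroup_induction ρ with
  | ofG g =>
    rw [comp₀₁_comulHom_ofG hu degZero_ofV, AlgHom.id_apply, degOne_ofG, smul_zero, ite_self]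
  | ofV_mul v x hx =>
    rw [hasLeadingPart_id.comp₀₁_comulHom_ofV_mul hu, comp₀₀_comulHom, degOne_ofV_mul, id_eq,
      LinearMap.id_apply]
    by_cases h1 : h = u * h'
    · rw [if_pos h1, if_pos (by rw [h1, inv_mul_cancel_left]), h1, inv_mul_cancel_left]
    · rw [if_neg h1, if_neg (fun h2 => h1 (inv_mul_eq_iff_eq_mul.mp h2)), zero_smul]
  | add x y hx hy =>
    rw [map_add, map_add, hx, hy, map_add]
    split_ifs <;> simp
  | smul c x hx =>
    rw [map_smul, map_smul, hx, map_smul]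
    split_ifs <;> simp

open scoped Classical in
theorem comp₁₀_comulHom (hu : IsParityElement ρ u) (B : V ⊗[ℂ] V) (x : SupergroupAlgebra ρ)
    (h h' : G) : comp₁₀ (AlgHom.id ℂ _) h h' (comulHom hu B x)
      = if h = h' then degOne ρ h x else 0 := by
  induction x using supergroup_induction ρ with
  | ofG g =>
    rw [comp₁₀_comulHom_ofG hu degZero_ofV, AlgHom.id_apply, degOne_ofG, smul_zero, ite_self]
  | ofV_mul v x hx =>
    rw [hasLeadingPart_id.comp₁₀_comulHom_ofV_mul hu, comp₀₀_comulHom, degOne_ofV_mul,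
      LinearMap.id_apply, ite_smul, zero_smul]
  | add x y hx hy =>
    rw [map_add, map_add, hx, hy, map_add]
    split_ifs <;> simp
  | smul c x hx =>
    rw [map_smul, map_smul, hx, map_smul]
    split_ifs <;> simp

/-- Two sources contribute in `V ⊗ V`: the linear term of the exponential in the coproduct of `h`,
and the coproduct of the degree two part of `ΛV`, which is antisymmetric. The left index is `u * h`
because of the `u` in `B̂`. -/
theorem exists_comp₁₁_comulHom (hu : IsParityElement ρ u) (B : V ⊗[ℂ] V)
    (x : SupergroupAlgebra ρ) (h : G) :
    ∃ w : V ⊗[ℂ] V, TensorProduct.comm ℂ V V w = -w ∧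
      comp₁₁ (AlgHom.id ℂ _) (u * h) h (comulHom hu B x)
        = degZero ρ h x • (TensorProduct.map (ρ h) (ρ h) B - B) + w := by
  classical
  induction x using supergroup_induction ρ with
  | ofG g =>
    refine ⟨0, by simp, ?_⟩
    rw [hasLeadingPart_id.comp₁₁_comulHom_ofG hu, AlgHom.id_apply, degOne_ofG, degOne_ofG,
      TensorProduct.tmul_zero, zero_add, id_eq, inv_mul_cancel_left, degZero_ofG,
      TensorProduct.map_id, LinearMap.id_apply, add_zero]
    by_cases hg : h = g
    · rw [if_pos hg, mul_one, hg]
    · rw [if_neg hg, mul_zero, zero_smul, zero_smul]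
  | ofV_mul v x hx =>
    refine ⟨v ⊗ₜ degOne ρ h x - degOne ρ h x ⊗ₜ v, by simp, ?_⟩
    rw [comp₁₁_comulHom_ofV_mul, comp₀₁_comulHom, comp₁₀_comulHom, degZero_ofV_mul, zero_smul,
      zero_add, if_pos rfl, inv_mul_cancel_left, if_pos rfl]
  | add x y hx hy =>
    obtain ⟨w, hw, hx⟩ := hx
    obtain ⟨w', hw', hy⟩ := hy
    refine ⟨w + w', by rw [map_add, hw, hw', neg_add], ?_⟩
    rw [map_add, map_add, hx, hy, map_add, add_smul]
    abel
  | smul c x hx =>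
    obtain ⟨w, hw, hx⟩ := hx
    refine ⟨c • w, by rw [map_smul, hw, smul_neg], ?_⟩
    rw [map_smul, map_smul, hx, map_smul, smul_add, smul_assoc]

end Coaction

/-! ### The pair `(φ, η)` of a homomorphism of Hopf algebras -/

section LeadingPart

open scoped Classical in
-- The hypothesis says that the coefficients `a` are those of an element `x` of the span of `ι` with
-- `Δ x = x ⊗ x`. Such an element is zero or a basis vector.
theorem eq_ite_of_mul_eq_ite {ι : Type*} {a : ι → ℂ} (ha : ∀ h h', a h * a h' = if h = h' then a h else 0)
    {k : ι} (hk : a k ≠ 0) (h : ι) : a h = if h = k then 1 else 0 := by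
  have h1 := ha h k
  split_ifs at h1 ⊢ with hh
  · rw [hh] at h1 ⊢
    exact mul_left_cancel₀ hk (by rw [h1, mul_one])
  · exact (mul_eq_zero.mp h1).resolve_right hk

variable {G V : Type*} [Group G] [AddCommGroup V] [Module ℂ V]

theorem eq_zero_of_comm_eq_neg {w : V ⊗[ℂ] V} (hw : TensorProduct.comm ℂ V V w = -w)
    (hw' : w ∈ SymTensor V) : w = 0 := by
  have h1 : TensorProduct.comm ℂ V V w = w := hw'
  rw [h1] at hw
  have h2 : (2 : ℂ) • w = 0 := by
    rw [two_smul]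
    exact eq_neg_iff_add_eq_zero.mp hw
  exact (smul_eq_zero.mp h2).resolve_left two_ne_zero

theorem map_mem_symTensor (η : V →ₗ[ℂ] V) {B : V ⊗[ℂ] V} (hB : B ∈ SymTensor V) :
    TensorProduct.map η η B ∈ SymTensor V :=
  (symMap η ⟨B, hB⟩).2

variable {ρ : Representation ℂ G V} {u : G} [Fintype G]
  {f : SupergroupAlgebra ρ →ₐ[ℂ] SupergroupAlgebra ρ}

open scoped Classical in
theorem HasLeadingPart.degZero_map {φ : G → G} {η : V →ₗ[ℂ] V} (hf : HasLeadingPart f φ η)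
    (x : SupergroupAlgebra ρ) (h : G) :
    degZero ρ h (f x) = ∑ g, if h = φ g then degZero ρ g x else 0 := by
  induction x using supergroup_induction ρ with
  | ofG g =>
    rw [hf.degZero_ofG, Finset.sum_eq_single g]
    · rw [SupergroupHopf.degZero_ofG, if_pos rfl]
    · intro k _ hk
      rw [SupergroupHopf.degZero_ofG, if_neg hk, ite_self]
    · exact fun hg => (hg (Finset.mem_univ g)).elim
  | ofV_mul v x hx =>
    rw [degZero_map_ofV_mul hf.degZero_ofV]
    exact (Finset.sum_eq_zero fun g _ => by
      rw [SupergroupHopf.degZero_ofV_mul, ite_self]).symm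
  | add x y hx hy =>
    rw [map_add, map_add, hx, hy, ← Finset.sum_add_distrib]
    exact Finset.sum_congr rfl fun g _ => by split_ifs <;> simp
  | smul c x hx =>
    rw [map_smul, map_smul, hx, Finset.smul_sum]
    exact Finset.sum_congr rfl fun g _ => by split_ifs <;> simp

open scoped Classical in
theorem HasLeadingPart.degOne_map {φ : G → G} {η : V →ₗ[ℂ] V} (hf : HasLeadingPart f φ η)
    (hG : ∀ g h, degOne ρ h (f (ofG ρ g)) = 0) (x : SupergroupAlgebra ρ) (h : G) :
    degOne ρ h (f x) = ∑ g, if h = φ g then η (degOne ρ g x) else 0 := by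
  induction x using supergroup_induction ρ with
  | ofG g =>
    rw [hG]
    exact (Finset.sum_eq_zero fun k _ => by rw [SupergroupHopf.degOne_ofG, map_zero, ite_self]).symm
  | ofV_mul v x hx =>
    rw [hf.degOne_ofV_mul, hf.degZero_map, Finset.sum_smul]
    refine Finset.sum_congr rfl fun g _ => ?_
    rw [show degOne ρ g (ofV ρ v * x) = degZero ρ g x • v from
      hasLeadingPart_id.degOne_ofV_mul v x g, map_smul, ite_smul, zero_smul]
  | add x y hx hy =>
    rw [map_add, map_add, hx, hy, ← Finset.sum_add_distrib]
    exact Finset.sum_congr rfl fun g _ => by split_ifs <;> simp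
  | smul c x hx =>
    rw [map_smul, map_smul, hx, Finset.smul_sum]
    exact Finset.sum_congr rfl fun g _ => by split_ifs <;> simp

theorem HasLeadingPart.leftInverse {f' : SupergroupAlgebra ρ →ₐ[ℂ] SupergroupAlgebra ρ}
    {φ φ' : G → G} {η η' : V →ₗ[ℂ] V} (hf : HasLeadingPart f φ η) (hf' : HasLeadingPart f' φ' η')
    (hff' : ∀ x, f' (f x) = x) : Function.LeftInverse φ' φ := by
  classical
  intro g
  have h1 := hf'.degZero_map (f (ofG ρ g)) g
  simp only [hff', hf.degZero_ofG, SupergroupHopf.degZero_ofG, if_true] at h1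
  by_contra hne
  rw [Finset.sum_eq_zero] at h1
  · exact one_ne_zero h1
  · intro k _
    split_ifs with h2 h3
    · exact (hne (by rw [← h3, ← h2])).elim
    · rfl
    · rfl

theorem HasLeadingPart.leftInverse_degOne
    {f' : SupergroupAlgebra ρ →ₐ[ℂ] SupergroupAlgebra ρ} {φ : G → G} {φ' : G →* G}
    {η η' : V →ₗ[ℂ] V} (hf : HasLeadingPart f φ η) (hf' : HasLeadingPart f' φ' η')
    (hG : ∀ g h, degOne ρ h (f' (ofG ρ g)) = 0)
    (hff' : ∀ x, f' (f x) = x) : Function.LeftInverse η' η := by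
  classical
  intro v
  have h1 := hf'.degOne_map hG (f (ofV ρ v)) 1
  rw [hff', SupergroupHopf.degOne_ofV, if_pos rfl, Finset.sum_eq_single 1] at h1
  · rw [map_one, if_pos rfl, hf.degOne_ofV, if_pos rfl] at h1
    exact h1.symm
  · intro g _ hg
    rw [hf.degOne_ofV, if_neg hg, map_zero, ite_self]
  · exact fun hg => (hg (Finset.mem_univ 1)).elim

/-- The relation `g v = (ρ g v) g` is mapped by `f` and compared in `V φ(g)`. The vanishing of the
degree one part of `f(g)` leaves a single term on each side. -/
theorem HasLeadingPart.map_rep {φ : G → G} {η : V →ₗ[ℂ] V} (hf : HasLeadingPart f φ η)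
    (hG : ∀ g h, degOne ρ h (f (ofG ρ g)) = 0) (g : G) (v : V) :
    η (ρ g v) = ρ (φ g) (η v) := by
  classical
  have h1 : degOne ρ (φ g) (f (ofG ρ g * ofV ρ v))
      = degOne ρ (φ g) (f (ofV ρ (ρ g v) * ofG ρ g)) := by rw [ofG_mul_ofV]
  rw [hf.degOne_ofV_mul, hf.degZero_ofG, if_pos rfl, one_smul, map_mul,
    SupergroupHopf.degOne_mul] at h1
  rw [← h1]
  simp [hG, hf.degZero_ofG, hf.degOne_ofV]

/-- The element `f(g)` is invertible and the reduction to degree zero is multiplicative, so the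
reduction of `f(g)` is a unit. -/
theorem exists_degZero_map_ofG_ne_zero (f : SupergroupAlgebra ρ →ₐ[ℂ] SupergroupAlgebra ρ)
    (g : G) : ∃ k, degZero ρ k (f (ofG ρ g)) ≠ 0 := by
  classical
  by_contra! hk
  have h : degZero ρ 1 (f (ofG ρ g) * f (ofG ρ g⁻¹)) = 1 := by
    rw [← map_mul, ← map_mul, mul_inv_cancel, map_one, map_one, degZero_one, if_pos rfl]
  rw [degZero_mul, Finset.sum_eq_zero fun k _ => by rw [hk, zero_mul]] at h
  exact zero_ne_one h

variable [FiniteDimensional ℂ V] {B B' : V ⊗[ℂ] V}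

/-- Let `k` be the reduction of `f(u)`. The reduction `b` of `f(v)` satisfies `Δ b = b ⊗ 1 + k ⊗ b`,
which makes it a multiple of `1 - k`. It also anticommutes with `k`, which forces it to be zero. -/
theorem degZero_map_ofV (hu : IsParityElement ρ u)
    (hΔ : ∀ x, Algebra.TensorProduct.map f f (comulHom hu B x) = comulHom hu B' (f x))
    (v : V) (h : G) : degZero ρ h (f (ofV ρ v)) = 0 := by
  classical
  obtain ⟨k, hk⟩ := exists_degZero_map_ofG_ne_zero f u
  have hU := eq_ite_of_mul_eq_ite (a := fun h => degZero ρ h (f (ofG ρ u))) (fun h h' => by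
    have h1 := comp₀₀_comulHom hu B' (f (ofG ρ u)) h h'
    rwa [← hΔ, comulHom_ofG_parity, comp₀₀_map, comp₀₀_tmul] at h1) hk
  have hV : ∀ h h', degZero ρ h (f (ofV ρ v)) * (if h' = 1 then 1 else 0)
      + (if h = k then 1 else 0) * degZero ρ h' (f (ofV ρ v))
        = if h = h' then degZero ρ h (f (ofV ρ v)) else 0 := fun h h' => by
    have h1 := comp₀₀_comulHom hu B' (f (ofV ρ v)) h h'
    rwa [← hΔ, comulHom_ofV, comp₀₀_map, map_add, comp₀₀_tmul, comp₀₀_tmul, map_one, degZero_one,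
      hU] at h1
  -- In the anticommutation of `f(u)` and `f(v)`, the coefficient at `k` is the coefficient of
  -- `f(v)` at `1` on both sides, with opposite signs.
  have hb1 : degZero ρ 1 (f (ofV ρ v)) = 0 := by
    have h1 : degZero ρ k (f (ofG ρ u) * f (ofV ρ v))
        = -degZero ρ k (f (ofV ρ v) * f (ofG ρ u)) := by
      rw [← map_mul, ← map_mul, hu.ofG_mul_ofV, map_neg, map_neg]
    rw [degZero_mul, degZero_mul] at h1
    have h2 : ∀ g : G, g⁻¹ * k = k ↔ g = 1 := fun g => by
      rw [mul_eq_right, inv_eq_one]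
    simp only [hU, h2, ite_mul, one_mul, zero_mul, mul_ite, mul_one, mul_zero, Finset.sum_ite_eq',
      Finset.mem_univ, if_true, inv_mul_cancel] at h1
    linear_combination h1 / 2
  by_cases h1 : h = 1
  · rw [h1, hb1]
  -- Away from `1`, the index pair `(k, h)` leaves only `h = k` possible, and there the pair `(k,
  -- 1)` gives zero because `k ≠ 1`.
  · have h3 := hV k h
    have h4 := hV k 1
    rw [if_neg h1, if_pos rfl, mul_zero, zero_add, one_mul] at h3
    rw [if_pos rfl, if_pos rfl, mul_one, one_mul, hb1, add_zero] at h4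
    rw [h3]
    split_ifs with h5
    · rw [h4, if_neg (by rwa [h5])]
    · rfl

/-- A homomorphism between the Hopf algebras `A(G, V, u, B)` has a leading part. -/
theorem exists_hasLeadingPart (hu : IsParityElement ρ u)
    (hΔ : ∀ x, Algebra.TensorProduct.map f f (comulHom hu B x) = comulHom hu B' (f x)) :
    ∃ φ : G →* G, HasLeadingPart f φ (degOne ρ 1 ∘ₗ f.toLinearMap ∘ₗ ofV ρ) := by
  classical
  have hV := degZero_map_ofV hu hΔ
  choose φ hφ using exists_degZero_map_ofG_ne_zero f
  have hG : ∀ g h, degZero ρ h (f (ofG ρ g)) = if h = φ g then 1 else 0 := fun g =>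
    eq_ite_of_mul_eq_ite (a := fun h => degZero ρ h (f (ofG ρ g))) (fun h h' => by
      have h1 := comp₀₀_comulHom hu B' (f (ofG ρ g)) h h'
      rwa [← hΔ, comp₀₀_map, comp₀₀_comulHom_ofG hu hV] at h1) (hφ g)
  have hone : ∀ {h k : G}, (if h = k then (1 : ℂ) else 0) = 1 → h = k := fun {h k} h1 => by
    by_contra hne
    rw [if_neg hne] at h1
    exact zero_ne_one h1
  refine ⟨⟨⟨φ, ?_⟩, ?_⟩, hG, hV, fun v h => ?_⟩
  · refine (hone ?_).symm
    rw [← hG, map_one, map_one, degZero_one, if_pos rfl]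
  · intro a b
    refine (hone ?_).symm
    change (if φ a * φ b = φ (a * b) then (1 : ℂ) else 0) = 1
    rw [← hG, map_mul, map_mul, degZero_mul]
    rw [Finset.sum_eq_single (φ a) (fun k _ hk => by rw [hG, if_neg hk, zero_mul])
      (fun ha => (ha (Finset.mem_univ _)).elim), hG, hG, if_pos rfl, inv_mul_cancel_left, if_pos rfl,
      mul_one]
  -- The component in `V h ⊗ ℂ h` sees only the term `v ⊗ 1`, so it vanishes unless `h = 1`.
  · have h1 := comp₁₀_comulHom hu B' (f (ofV ρ v)) h h
    rw [← hΔ, comulHom_ofV, comp₁₀_map, map_add, comp₁₀_tmul, comp₁₀_tmul, map_one, degZero_one,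
      hV, zero_smul, add_zero, if_pos rfl] at h1
    by_cases hh : h = 1
    · rw [if_pos hh, hh]
      rfl
    · rw [if_neg hh, ← h1, if_neg hh, zero_smul]

/-- The component in `V h ⊗ ℂ h` allows a degree one part only for `h = φ g`, the component in `ℂ u
h ⊗ V h` only for `u h = φ g`. Both can hold only if `u = 1`, and then `V = 0`. -/
theorem degOne_map_ofG (hu : IsParityElement ρ u) {φ : G → G} {η : V →ₗ[ℂ] V}
    (hf : HasLeadingPart f φ η)
    (hΔ : ∀ x, Algebra.TensorProduct.map f f (comulHom hu B x) = comulHom hu B' (f x))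
    (g h : G) : degOne ρ h (f (ofG ρ g)) = 0 := by
  classical
  have h1 := comp₀₁_comulHom hu B' (f (ofG ρ g)) (u * h) h
  have h2 := comp₁₀_comulHom hu B' (f (ofG ρ g)) h h
  rw [← hΔ, comp₀₁_map, comp₀₁_comulHom_ofG hu hf.degZero_ofV, hf.degZero_ofG, if_pos rfl] at h1
  rw [← hΔ, comp₁₀_map, comp₁₀_comulHom_ofG hu hf.degZero_ofV, hf.degZero_ofG, if_pos rfl] at h2
  by_cases hh : h = φ g
  · by_cases hh' : u * h = φ g
    · have hu1 : u = 1 := by rwa [hh, mul_eq_right] at hh'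
      have h3 := hu.apply_eq (degOne ρ h (f (ofG ρ g)))
      rw [hu1, map_one, Module.End.one_apply] at h3
      have h4 : (2 : ℂ) • degOne ρ h (f (ofG ρ g)) = 0 := by
        rw [two_smul]
        exact eq_neg_iff_add_eq_zero.mp h3
      exact (smul_eq_zero.mp h4).resolve_left two_ne_zero
    · rw [← h1, if_neg hh', zero_smul]
  · rw [← h2, if_neg hh, zero_smul]

/-- The term `u ⊗ v` is mapped to leading part `φ u ⊗ η v`, while the coproduct of the target has `u
⊗ η v`. These can be told apart as soon as `η v ≠ 0`. -/
theorem apply_eq_of_ne_zero (hu : IsParityElement ρ u) {φ : G → G} {η : V →ₗ[ℂ] V}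
    (hf : HasLeadingPart f φ η)
    (hΔ : ∀ x, Algebra.TensorProduct.map f f (comulHom hu B x) = comulHom hu B' (f x))
    {v : V} (hv : η v ≠ 0) : φ u = u := by
  classical
  have h1 := comp₀₁_comulHom hu B' (f (ofV ρ v)) u 1
  rw [← hΔ, comulHom_ofV, comp₀₁_map, map_add, comp₀₁_tmul, comp₀₁_tmul, hf.degZero_ofV,
    zero_smul, zero_add, hf.degZero_ofG, hf.degOne_ofV, mul_one, if_pos rfl, if_pos rfl] at h1
  by_contra hne
  rw [if_neg (Ne.symm hne), zero_smul] at h1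
  exact hv h1.symm

/-- The component of the coproduct of `f(g)` in `V u φ(g) ⊗ V φ(g)` is computed in two ways. They
differ by an antisymmetric tensor, which is symmetric as well because `B` and `B'` are, hence zero.
-/
theorem HasLeadingPart.map_sub_eq (hu : IsParityElement ρ u) {φ : G → G} {η : V →ₗ[ℂ] V}
    (hf : HasLeadingPart f φ η) (hφu : φ u = u)
    (hG : ∀ g h, degOne ρ h (f (ofG ρ g)) = 0)
    (hΔ : ∀ x, Algebra.TensorProduct.map f f (comulHom hu B x) = comulHom hu B' (f x))
    (hB : B ∈ SymTensor V) (hB' : B' ∈ SymTensor V) (g : G) :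
    TensorProduct.map η η (TensorProduct.map (ρ g) (ρ g) B - B)
      = TensorProduct.map (ρ (φ g)) (ρ (φ g)) B' - B' := by
  classical
  obtain ⟨w, hw, h1⟩ := exists_comp₁₁_comulHom hu B' (f (ofG ρ g)) (φ g)
  rw [← hΔ, comp₁₁_map, hf.comp₁₁_comulHom_ofG hu, hφu, inv_mul_cancel_left, hf.degZero_ofG,
    if_pos rfl, hG, TensorProduct.zero_tmul, zero_add, mul_one, one_smul, one_smul] at h1
  have hw0 : w = 0 := by
    refine eq_zero_of_comm_eq_neg hw ?_
    rw [← sub_eq_iff_eq_add'.mpr h1]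
    exact Submodule.sub_mem _
      (map_mem_symTensor η (Submodule.sub_mem _ (map_mem_symTensor (ρ g) hB) hB))
      (Submodule.sub_mem _ (map_mem_symTensor (ρ (φ g)) hB') hB')
  rw [h1, hw0, add_zero]

end LeadingPart

/-! ### Classification -/

section Classification

variable {G V : Type*} [Group G] [AddCommGroup V] [Module ℂ V] {ρ : Representation ℂ G V} {u : G}

theorem mk_eq_smul_mk_iff (p : AutPair ρ u) (B B' : SymTensor V) :
    (Submodule.Quotient.mk B' : SymQuot ρ) = p • (Submodule.Quotient.mk B : SymQuot ρ) ↔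
      ∀ g, TensorProduct.map (ρ g) (ρ g)
        ((B' : V ⊗[ℂ] V) - TensorProduct.map (p.1.2 : V →ₗ[ℂ] V) (p.1.2 : V →ₗ[ℂ] V) B)
        = B' - TensorProduct.map (p.1.2 : V →ₗ[ℂ] V) (p.1.2 : V →ₗ[ℂ] V) B := by
  refine (Submodule.Quotient.eq _ (y := symMap (p.1.2 : V →ₗ[ℂ] V) B)).trans ?_
  exact forall_congr' fun g => Subtype.ext_iff

variable [FiniteDimensional ℂ V]

theorem hopfIso_of_mk_eq_smul (hu : IsParityElement ρ u) (p : AutPair ρ u) {B B' : SymTensor V}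
    (h : (Submodule.Quotient.mk B' : SymQuot ρ) = p • (Submodule.Quotient.mk B : SymQuot ρ)) :
    Nonempty (AGVuB ρ u (B : V ⊗[ℂ] V) ≃ₐc[ℂ] AGVuB ρ u (B' : V ⊗[ℂ] V)) :=
  nonempty_bialgEquiv_of_algHom hu (autHom p) (autHom p⁻¹)
    (by rw [← autHom_mul, mul_inv_cancel, autHom_one])
    (by rw [← autHom_mul, inv_mul_cancel, autHom_one])
    (superCounit_autHom p) (comulHom_autHom hu p ((mk_eq_smul_mk_iff p B B').mp h))

theorem exists_mk_eq_smul_of_hopfIso [Finite G] (hu : IsParityElement ρ u) {B B' : SymTensor V}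
    (e : AGVuB ρ u (B : V ⊗[ℂ] V) ≃ₐc[ℂ] AGVuB ρ u (B' : V ⊗[ℂ] V)) :
    ∃ p : AutPair ρ u,
      (Submodule.Quotient.mk B' : SymQuot ρ) = p • (Submodule.Quotient.mk B : SymQuot ρ) := by
  have := Fintype.ofFinite G
  -- For `V = 0` an isomorphism may move `u`, so its `φ` need not give an admissible pair; but then
  -- `S²V = 0` and the trivial pair works.
  rcases subsingleton_or_nontrivial V with hV | hV
  · refine ⟨1, ?_⟩
    rw [one_smul, Subsingleton.elim B B']
  obtain ⟨f, hfe, hΔ⟩ := exists_algHom_of_bialgEquiv hu e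
  obtain ⟨f', hfe', hΔ'⟩ := exists_algHom_of_bialgEquiv hu e.symm
  have hff' : ∀ x, f' (f x) = x := fun x =>
    (hfe' (f x)).trans ((congrArg e.symm (hfe x)).trans (e.symm_apply_apply x))
  have hf'f : ∀ x, f (f' x) = x := fun x =>
    (hfe (f' x)).trans ((congrArg e (hfe' x)).trans (e.apply_symm_apply x))
  obtain ⟨φ, hf⟩ := exists_hasLeadingPart hu hΔ
  obtain ⟨φ', hf'⟩ := exists_hasLeadingPart hu hΔ'
  have hG := degOne_map_ofG hu hf hΔ
  have hG' := degOne_map_ofG hu hf' hΔ'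
  set η := degOne ρ 1 ∘ₗ f.toLinearMap ∘ₗ ofV ρ
  set η' := degOne ρ 1 ∘ₗ f'.toLinearMap ∘ₗ ofV ρ
  have hηη' : Function.LeftInverse η' η := hf.leftInverse_degOne hf' hG' hff'
  have hη'η : Function.LeftInverse η η' := hf'.leftInverse_degOne hf hG hf'f
  obtain ⟨v, hv⟩ := exists_ne (0 : V)
  have hφu : φ u = u := apply_eq_of_ne_zero hu hf hΔ
    (v := v) (fun h0 => hv (by rw [← hηη' v, h0, map_zero]))
  let φe : MulAut G :=
    { toFun := φ
      invFun := φ'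
      left_inv := hf.leftInverse hf' hff'
      right_inv := hf'.leftInverse hf hf'f
      map_mul' := map_mul φ }
  let ηe : V ≃ₗ[ℂ] V := { η with
    invFun := η'
    left_inv := hηη'
    right_inv := hη'η }
  let p : AutPair ρ u := ⟨(φe, ηe), hφu, hf.map_rep hG⟩
  refine ⟨p, (mk_eq_smul_mk_iff p B B').mpr fun g => ?_⟩
  -- The comparison of twists controls only the action of elements `φ k`; surjectivity of `φ` makes
  -- this invariance under all of `G`.
  obtain ⟨k, rfl⟩ := φe.surjective g
  have h1 := hf.map_sub_eq hu hφu hG hΔ B.2 B'.2 k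
  have h2 := map_map_smul p k (B : V ⊗[ℂ] V)
  change TensorProduct.map η η _ = TensorProduct.map (ρ (φ k)) (ρ (φ k))
    (TensorProduct.map η η (B : V ⊗[ℂ] V)) at h2
  change TensorProduct.map (ρ (φ k)) (ρ (φ k)) (B' - TensorProduct.map η η (B : V ⊗[ℂ] V))
    = B' - TensorProduct.map η η (B : V ⊗[ℂ] V)
  rw [map_sub, h2] at h1
  rw [map_sub, sub_eq_sub_iff_sub_eq_sub, h1]

end Classification

end

end SupergroupHopf

/-! ### The theorem -/

theorem corollary2p2 {G V : Type*} [Group G] [Finite G] [AddCommGroup V] [Module ℂ V]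
    [FiniteDimensional ℂ V] (ρ : Representation ℂ G V) (u : G)
    (hu : u ∈ Subgroup.center G) (hu2 : u ^ 2 = 1) (huV : ∀ v : V, ρ u v = -v) :
    (∀ B : SupergroupHopf.SymTensor V,
      SupergroupHopf.IsHopfAlgebra (SupergroupHopf.AGVuB ρ u (B : TensorProduct ℂ V V))) ∧
    ∃ e : SupergroupHopf.HopfIsoClasses ρ u ≃ SupergroupHopf.SymModuli ρ u,
      ∀ B : SupergroupHopf.SymTensor V,
        e (Quotient.mk (SupergroupHopf.hopfIsoSetoid ρ u) B) =
          Quotient.mk (MulAction.orbitRel (SupergroupHopf.AutPair ρ u) (SupergroupHopf.SymQuot ρ))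
            (Submodule.Quotient.mk B) := by
  have h : SupergroupHopf.IsParityElement ρ u :=
    ⟨fun g => (Subgroup.mem_center_iff.mp hu g).symm, by rw [← pow_two, hu2], huV⟩
  refine ⟨SupergroupHopf.isHopfAlgebra_AGVuB h, ?_⟩
  let F : SupergroupHopf.HopfIsoClasses ρ u → SupergroupHopf.SymModuli ρ u :=
    Quotient.lift (fun B => Quotient.mk (MulAction.orbitRel (SupergroupHopf.AutPair ρ u)
      (SupergroupHopf.SymQuot ρ)) (Submodule.Quotient.mk B)) (by
        rintro B B' ⟨e⟩
        obtain ⟨p, hp⟩ := SupergroupHopf.exists_mk_eq_smul_of_hopfIso h e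
        exact (Quotient.sound (MulAction.orbitRel_apply.mpr ⟨p, hp.symm⟩)).symm)
  refine ⟨Equiv.ofBijective F ⟨?_, ?_⟩, fun B => rfl⟩
  · intro x y
    refine Quotient.inductionOn₂ x y fun B B' hBB' => ?_
    obtain ⟨p, hp⟩ := MulAction.orbitRel_apply.mp (Quotient.exact hBB'.symm)
    exact Quotient.sound (SupergroupHopf.hopfIso_of_mk_eq_smul h p hp.symm)
  · intro y
    refine Quotient.inductionOn y fun q => ?_
    obtain ⟨B, rfl⟩ := Submodule.Quotient.mk_surjective _ q
    exact ⟨Quotient.mk _ B, rfl⟩
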